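/- Let $a:\mathbb R^d\times\mathbb R^d\to\mathbb R$ be a real symbol of class $S^0_{0,0}$, i.e. a smooth function all of whose derivatives of every order (including order zero) are bounded. Let $F:\mathbb R^d\to\mathbb R^d$ be a smooth map all of whose derivatives of order at least one are bounded. For $\delta\in\mathbb R$ let $K_\delta$ be the Weyl quantization of the symbol $a(x+F(\delta x),\xi)$, that is, the bounded self-adjoint operator on $L^2(\mathbb R^d)$ determined by $$\langle\psi,K_\delta\phi\rangle=(2\pi)^{-d}\int_{\mathbb R^d}d\xi\int_{\mathbb R^{2d}}dx'\,dx\;e^{i\xi\cdot(x-x')}\,a\Big(\tfrac{x+x'}2+F\big(\delta\,\tfrac{x+x'}2\big),\xi\Big)\,\overline{\psi(x)}\,\phi(x'),\qquad \psi,\phi\in\mathscr S(\mathbb R^d).$$ These operators are well defined, and there are constants $C,\tilde C>0$, depending only on $d$, $a$ and $F$, with the following properties. First, the Hausdorff distance between the spectra satisfies $d_h(\sigma(K_\delta),\sigma(K_0))\le C\sqrt{|\delta|}$ for all $|\delta|\le 1$. Second, let $\lambda_0<\mu_0$ be any two points of $\sigma(K_0)$ such that $(\lambda_0,\mu_0)\cap\sigma(K_0)=\emptyset$.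 Then for all $|\delta|<(\mu_0-\lambda_0)^2/(4C^2)$ the midpoint $(\lambda_0+\mu_0)/2$ lies in the resolvent set of $K_\delta$, and $\sigma(K_\delta)$ has points both below and above this midpoint, so that one may define $$\lambda_\delta:=\sup\Big(\sigma(K_\delta)\cap\big(-\infty,\tfrac{\lambda_0+\mu_0}2\big)\Big),\qquad \mu_\delta:=\inf\Big(\sigma(K_\delta)\cap\big(\tfrac{\lambda_0+\mu_0}2,\infty\big)\Big).$$ Moreover, there is some $\delta_1$ with $0<\delta_1<(\mu_0-\lambda_0)^2/(4C^2)$, which may depend on the gap, such that $$\max\{|\lambda_\delta-\lambda_0|,|\mu_\delta-\mu_0|\}\le\frac{\tilde C\,|\delta|}{\mu_0-\lambda_0}\qquad\text{for all }|\delta|\le\delta_1 .$$ -/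

import Mathlib

open MeasureTheory
open scoped ContDiff SchwartzMap ComplexConjugate

/-- The Euclidean space `ℝ^d`. -/
abbrev Space (d : ℕ) : Type := EuclideanSpace ℝ (Fin d)

/-- The complex Hilbert space `L²(ℝ^d)`; its inner product is antilinear in the first variable. -/
abbrev L2Space (d : ℕ) : Type := Lp ℂ 2 (volume : Measure (Space d))

/-- Real symbols of Hörmander class `S⁰₀,₀(ℝ^d × ℝ^d)`: smooth functions of `(x, ξ)` all of whose
derivatives, of every order `n ≥ 0`, are bounded. -/
def IsRealSymbol {d : ℕ} (a : Space d → Space d → ℝ) : Prop :=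
  ContDiff ℝ ∞ (Function.uncurry a) ∧
    ∀ n : ℕ, ∃ B : ℝ, ∀ p : Space d × Space d,
      ‖iteratedFDeriv ℝ n (Function.uncurry a) p‖ ≤ B

/-- Smooth vector fields on `ℝ^d` all of whose derivatives of order at least one are bounded
(the field itself may grow linearly). -/
def IsAdmissibleField {d : ℕ} (F : Space d → Space d) : Prop :=
  ContDiff ℝ ∞ F ∧
    ∀ n : ℕ, 1 ≤ n → ∃ B : ℝ, ∀ x : Space d, ‖iteratedFDeriv ℝ n F x‖ ≤ B

/-- The sesquilinear form of the Weyl quantization of `b`: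
`(2π)^{-d} ∫ dξ ∫∫ dx dx' e^{i ξ·(x - x')} b((x + x')/2, ξ) conj(ψ(x)) φ(x')`,
where `p = (x, x')`. -/
noncomputable def weylForm {d : ℕ} (b : Space d → Space d → ℝ) (ψ φ : 𝓢(Space d, ℂ)) : ℂ :=
  (((2 * Real.pi) ^ d)⁻¹ : ℝ) *
    ∫ ξ : Space d, ∫ p : Space d × Space d,
      Complex.exp (Complex.I * (inner ℝ ξ (p.1 - p.2) : ℝ)) *
        (b ((1 / 2 : ℝ) • (p.1 + p.2)) ξ : ℂ) * conj (ψ p.1) * φ p.2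

/-- `T` is the bounded operator on `L²(ℝ^d)` generated by the Weyl quantization of `b`. -/
def IsWeylQuantization {d : ℕ} (b : Space d → Space d → ℝ)
    (T : L2Space d →L[ℂ] L2Space d) : Prop :=
  ∀ ψ φ : 𝓢(Space d, ℂ),
    inner ℂ (ψ.toLp 2 volume : L2Space d) (T (φ.toLp 2 volume)) = weylForm b ψ φ

/-- There is at most one such operator. -/
theorem IsWeylQuantization.unique {d : ℕ} {b : Space d → Space d → ℝ}
    {T T' : L2Space d →L[ℂ] L2Space d} (hT : IsWeylQuantization b T)
    (hT' : IsWeylQuantization b T') : T = T' := by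
  have hd : DenseRange (SchwartzMap.toLpCLM ℝ ℂ 2 (volume : Measure (Space d))) :=
    SchwartzMap.denseRange_toLpCLM (by norm_num)
  have key : ∀ φ : 𝓢(Space d, ℂ), T (φ.toLp 2 volume) = T' (φ.toLp 2 volume) := by
    intro φ
    have h : (fun f : L2Space d => inner ℂ f (T (φ.toLp 2 volume))) =
        fun f : L2Space d => inner ℂ f (T' (φ.toLp 2 volume)) := by
      refine hd.equalizer (by fun_prop) (by fun_prop) ?_
      funext ψ
      exact (hT ψ φ).trans (hT' ψ φ).symm
    exact ext_inner_left ℂ fun f => congrFun h f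
  apply DFunLike.coe_injective
  refine hd.equalizer T.continuous T'.continuous ?_
  funext φ
  exact key φ

open Classical in
/-- `Op^w(b)`: the bounded operator on `L²(ℝ^d)` generated by the Weyl quantization of `b`
(and `0` should there be no such bounded operator). -/
noncomputable def weylOp {d : ℕ} (b : Space d → Space d → ℝ) : L2Space d →L[ℂ] L2Space d :=
  if h : ∃ T : L2Space d →L[ℂ] L2Space d, IsWeylQuantization b T then h.choose else 0

/-- The perturbed symbol `a[F]_δ(x, ξ) = a(x + F(δ x), ξ)`. -/
def perturbedSymbol {d : ℕ} (a : Space d → Space d → ℝ) (F : Space d → Space d) (δ : ℝ) :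
    Space d → Space d → ℝ :=
  fun x ξ => a (x + F (δ • x)) ξ

/-- The operator `K_δ = Op^w(a[F]_δ)`. -/
noncomputable def perturbedOp {d : ℕ} (a : Space d → Space d → ℝ) (F : Space d → Space d)
    (δ : ℝ) : L2Space d →L[ℂ] L2Space d :=
  weylOp (perturbedSymbol a F δ)

/-- The edge of a set of reals just below the point `m`. -/
noncomputable def edgeBelow (S : Set ℝ) (m : ℝ) : ℝ := sSup (S ∩ Set.Iio m)

/-- The edge of a set of reals just above the point `m`. -/
noncomputable def edgeAbove (S : Set ℝ) (m : ℝ) : ℝ := sInf (S ∩ Set.Ioi m)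

/-! Write δ = τκ with |τ| = κ = √|δ|. Over a region of diameter about 1/κ the argument δx of F
varies only by O(κ), so near the point s/κ the operator K_δ resembles the frozen operator T_s with
symbol a(x + F(τs), ξ). Every T_s is a translate of K_0, so a lower bound c‖f‖ ≤ ‖(K_0 - E)f‖ holds
for all T_s with the same c (`le_norm_frozenOp_sub`).

To glue these bounds, take Gaussian windows G_s whose squares integrate to one in s. Then Jf = (G_s
f)_s is an isometry into the L²-valued L² functions (`localize`); let T act as T_s on the component
s. With w = (K_δ - E)u and r = J K_δ u - T J u one has Jw - r = (T - E)Ju, whence c²‖u‖² ≤ ‖Jw - r‖²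
= ‖w‖² - 2 Re⟨Jw, r⟩ + ‖r‖². Two facts finish the estimate. First, ‖r‖ = O(κ)‖u‖: one part is the
commutator of K_δ with the windows (`HasDerivBounds.lintegral_commutator_le`), the other the error
of freezing (`HasDerivBounds.lintegral_freeze_le`). Second, ⟨Jf, r⟩ = ⟨f, (K_δ - J*TJ)u⟩ is O(κ²)
and not merely O(κ): J*TJ quantizes an average of shifted symbols against an even Gaussian, so
first-order terms cancel (`HasDerivBounds.norm_inner_sub_average_le`). Hence c²‖u‖² ≤ ‖w‖² +
C|δ|‖u‖² (`exists_le_norm_sq_perturbedOp`).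

An error linear in δ for the squared distance to the spectrum yields both rates. At a point E of the
other spectrum it bounds the distance by a multiple of √|δ|. At the midpoint of a gap, with c half
its length, √(c² - C|δ|) ≥ c - C|δ|/c gives the Lipschitz bound with the gap length in the
denominator (`abs_edge_sub_le`).

The converse comparison, from K_δ to K_0, is the same theorem with the roles exchanged: after
normalising F 0 = 0, K_0 is the perturbation of K_δ by the field -F ∘ (id + δF)⁻¹, whose derivatives
are bounded uniformly for small δ (`exists_hasDerivBounds_inverse`). This works because the constant
C depends on a and F only through derivative bounds.

The operator bounds all come from a weighted Calderón-Vaillancourt estimate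
(`exists_weylForm_bound`), proved with Gaussian wave packets. A weight is needed because the
freezing error grows linearly away from the centre of the window. -/

section Gaussian

/-! ### Gaussians and their derivatives. -/

section Normed

variable {V : Type*} [NormedAddCommGroup V]

/-- The Gaussian `x ↦ exp (-c ‖x‖²)`. -/
noncomputable def gauss (c : ℝ) (x : V) : ℝ := Real.exp (-c * ‖x‖ ^ 2)

lemma gauss_pos (c : ℝ) (x : V) : 0 < gauss c x := Real.exp_pos _

lemma gauss_le_one {c : ℝ} (hc : 0 ≤ c) (x : V) : gauss c x ≤ 1 := by
  unfold gauss
  rw [Real.exp_le_one_iff]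
  nlinarith [sq_nonneg ‖x‖, mul_nonneg hc (sq_nonneg ‖x‖)]

lemma gauss_neg (c : ℝ) (x : V) : gauss c (-x) = gauss c x := by simp [gauss]

end Normed

variable {V : Type*} [NormedAddCommGroup V] [InnerProductSpace ℝ V]

lemma contDiff_gauss (c : ℝ) : ContDiff ℝ ∞ (gauss c : V → ℝ) := by
  unfold gauss
  exact Real.contDiff_exp.comp (contDiff_const.mul (contDiff_norm_sq ℝ))

lemma continuous_gauss (c : ℝ) : Continuous (gauss c : V → ℝ) := (contDiff_gauss c).continuous

lemma norm_iteratedFDeriv_exp (n : ℕ) (t : ℝ) :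
    ‖iteratedFDeriv ℝ n Real.exp t‖ = Real.exp t := by
  rw [norm_iteratedFDeriv_eq_norm_iteratedDeriv, iteratedDeriv_eq_iterate, Real.iter_deriv_exp,
    Real.norm_eq_abs, abs_of_pos (Real.exp_pos t)]

/-- The first derivative is linear in x, so only orders one and two survive. The bound is written as
an i-th power because `norm_iteratedFDeriv_comp_le` asks for this form. -/
lemma norm_iteratedFDeriv_neg_mul_norm_sq_le {c : ℝ} (hc : 0 ≤ c) (i : ℕ) (hi : 1 ≤ i) (x : V) :
    ‖iteratedFDeriv ℝ i (fun x : V => -c * ‖x‖ ^ 2) x‖ ≤ ((1 + 2 * c) * (1 + ‖x‖)) ^ i := by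
  obtain ⟨j, rfl⟩ : ∃ j, i = j + 1 := ⟨i - 1, by omega⟩
  let A : V →L[ℝ] V →L[ℝ] ℝ := (-c * 2) • (innerSL ℝ : V →L[ℝ] V →L[ℝ] ℝ)
  have hf : fderiv ℝ (fun x : V => -c * ‖x‖ ^ 2) = fun x => A x := by
    funext x
    have := ((hasStrictFDerivAt_norm_sq x).hasFDerivAt (𝕜 := ℝ)).const_mul (-c)
    rw [this.fderiv]
    ext y
    change -c * ((2 : ℕ) • inner ℝ x y) = -c * 2 * inner ℝ x y
    rw [nsmul_eq_mul]; push_cast; ring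
  rw [← norm_iteratedFDeriv_fderiv, hf]
  have h1 : 1 ≤ (1 + 2 * c) * (1 + ‖x‖) := by nlinarith [norm_nonneg x]
  have hL : ‖A‖ ≤ 2 * c := by
    refine A.opNorm_le_bound (by positivity) fun y => ?_
    refine (A y).opNorm_le_bound (by positivity) fun z => ?_
    change |-c * 2 * inner ℝ y z| ≤ _
    rw [abs_mul, neg_mul, abs_neg, abs_of_nonneg (by positivity), mul_comm 2 c, mul_assoc (c * 2)]
    exact mul_le_mul_of_nonneg_left (abs_real_inner_le_norm y z) (by positivity)
  match j with
  | 0 =>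
    simp only [norm_iteratedFDeriv_zero, zero_add, pow_one]
    refine (ContinuousLinearMap.le_opNorm _ _).trans ?_
    nlinarith [norm_nonneg x, mul_le_mul_of_nonneg_right hL (norm_nonneg x)]
  | 1 =>
    rw [← norm_iteratedFDeriv_fderiv, norm_iteratedFDeriv_zero, ContinuousLinearMap.fderiv]
    calc _ ≤ 2 * c := hL
      _ ≤ (1 + 2 * c) * (1 + ‖x‖) := by nlinarith [norm_nonneg x]
      _ ≤ _ := le_self_pow₀ h1 (by norm_num)
  | (k + 2) =>
    rw [← norm_iteratedFDeriv_fderiv]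
    have : fderiv ℝ (fun x => A x) = fun _ => A := by
      funext y; exact ContinuousLinearMap.fderiv _
    rw [this, iteratedFDeriv_const_of_ne (by omega)]
    simp only [Pi.zero_apply, norm_zero]
    positivity

lemma norm_iteratedFDeriv_gauss_le_pow {c : ℝ} (hc : 0 ≤ c) (n : ℕ) (x : V) :
    ‖iteratedFDeriv ℝ n (gauss c) x‖ ≤
      n.factorial * gauss c x * ((1 + 2 * c) * (1 + ‖x‖)) ^ n := by
  refine norm_iteratedFDeriv_comp_le (g := Real.exp) (f := fun x : V => -c * ‖x‖ ^ 2)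
    (N := ∞) Real.contDiff_exp (contDiff_const.mul (contDiff_norm_sq ℝ))
    (by exact_mod_cast le_top) x ?_ ?_
  · intro i _
    rw [norm_iteratedFDeriv_exp]; rfl
  · intro i hi _
    exact norm_iteratedFDeriv_neg_mul_norm_sq_le hc i hi x

/-- Since (1 + t)^n ≤ n! exp(1 + t), completing the square in t - c t² suffices. -/
lemma pow_mul_exp_neg_sq_le {c : ℝ} (hc : 0 < c) (n : ℕ) :
    ∃ C : ℝ, 0 ≤ C ∧ ∀ t : ℝ, 0 ≤ t → (1 + t) ^ n * Real.exp (-c * t ^ 2) ≤ C := by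
  refine ⟨n.factorial * Real.exp (1 + 1 / (4 * c)), by positivity, fun t ht => ?_⟩
  have h1 := Real.pow_div_factorial_le_exp (1 + t) (by positivity) n
  rw [div_le_iff₀ (by positivity)] at h1
  calc (1 + t) ^ n * Real.exp (-c * t ^ 2)
      ≤ Real.exp (1 + t) * n.factorial * Real.exp (-c * t ^ 2) := by gcongr
    _ = n.factorial * Real.exp (1 + t + -c * t ^ 2) := by rw [Real.exp_add (1 + t)]; ring
    _ ≤ _ := by
      refine mul_le_mul_of_nonneg_left (Real.exp_le_exp.2 ?_) (by positivity)
      have : 0 ≤ c * (t - 1 / (2 * c)) ^ 2 := by positivity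
      have h2 : c * (t - 1 / (2 * c)) ^ 2 = c * t ^ 2 - t + 1 / (4 * c) := by field_simp; ring
      linarith

lemma pow_mul_gauss_le {c : ℝ} (hc : 0 < c) (n : ℕ) :
    ∃ C : ℝ, 0 ≤ C ∧ ∀ x : V, (1 + ‖x‖) ^ n * gauss c x ≤ C * gauss (c / 2) x := by
  obtain ⟨C, hC, h⟩ := pow_mul_exp_neg_sq_le (half_pos hc) n
  refine ⟨C, hC, fun x => ?_⟩
  have : gauss c x = gauss (c / 2) x * gauss (c / 2) x := by
    unfold gauss; rw [← Real.exp_add]; ring_nf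
  rw [this, ← mul_assoc]
  exact mul_le_mul_of_nonneg_right (h _ (norm_nonneg x)) (gauss_pos _ _).le

/-- Half of the exponent is spent on absorbing the polynomial factors, so that a single integrable
Gaussian dominates all derivatives up to order N. -/
lemma norm_iteratedFDeriv_gauss_le {c : ℝ} (hc : 0 < c) (N : ℕ) :
    ∃ C : ℝ, 0 ≤ C ∧ ∀ n ≤ N, ∀ x : V,
      ‖iteratedFDeriv ℝ n (gauss c) x‖ ≤ C * gauss (c / 2) x := by
  obtain ⟨C, hC, h⟩ := pow_mul_gauss_le (V := V) hc N
  refine ⟨N.factorial * (1 + 2 * c) ^ N * C, by positivity, fun n hn x => ?_⟩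
  refine (norm_iteratedFDeriv_gauss_le_pow hc.le n x).trans ?_
  have h1 : (1 : ℝ) ≤ (1 + 2 * c) * (1 + ‖x‖) := by nlinarith [norm_nonneg x]
  have g0 := (gauss_pos c x).le
  calc n.factorial * gauss c x * ((1 + 2 * c) * (1 + ‖x‖)) ^ n
      ≤ N.factorial * gauss c x * ((1 + 2 * c) * (1 + ‖x‖)) ^ N := by
        gcongr
    _ = N.factorial * (1 + 2 * c) ^ N * ((1 + ‖x‖) ^ N * gauss c x) := by rw [mul_pow]; ring
    _ ≤ N.factorial * (1 + 2 * c) ^ N * (C * gauss (c / 2) x) := 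
        mul_le_mul_of_nonneg_left (h x) (by positivity)
    _ = _ := by ring

lemma hasTemperateGrowth_gauss {c : ℝ} (hc : 0 < c) :
    Function.HasTemperateGrowth (gauss c : V → ℝ) := by
  refine ⟨contDiff_gauss c, fun n => ?_⟩
  obtain ⟨C, hC, h⟩ := norm_iteratedFDeriv_gauss_le (V := V) hc n
  refine ⟨0, C, fun x => (h n le_rfl x).trans ?_⟩
  simpa using mul_le_mul_of_nonneg_left (gauss_le_one (half_pos hc).le x) hC

variable [FiniteDimensional ℝ V] [MeasurableSpace V] [BorelSpace V]

lemma integrable_gauss {c : ℝ} (hc : 0 < c) : Integrable (gauss c : V → ℝ) := by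
  have := (GaussianFourier.integrable_cexp_neg_mul_sq_norm_add (V := V) (b := (c : ℂ))
    (by simpa using hc) 0 0).norm
  refine this.congr (ae_of_all _ fun x => ?_)
  simp [gauss, Complex.norm_exp, ← Complex.ofReal_pow]

lemma integrable_pow_mul_gauss {c : ℝ} (hc : 0 < c) (n : ℕ) :
    Integrable (fun x : V => (1 + ‖x‖) ^ n * gauss c x) := by
  obtain ⟨C, hC, h⟩ := pow_mul_gauss_le (V := V) hc n
  refine ((integrable_gauss (half_pos hc)).const_mul C).mono'
    (Continuous.aestronglyMeasurable (by have := continuous_gauss (V := V) c; fun_prop))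
    (ae_of_all _ fun x => ?_)
  rw [Real.norm_eq_abs, abs_of_nonneg (mul_nonneg (by positivity) (gauss_pos _ _).le)]
  exact h x

lemma integral_gauss_pos {c : ℝ} (hc : 0 < c) : 0 < ∫ x : V, gauss c x := by
  have := GaussianFourier.integral_rexp_neg_mul_sq_norm (V := V) hc
  unfold gauss
  rw [this]; positivity

end Gaussian

/-! ### Temperate growth of characters. -/

section Modulation

variable {V : Type*} [NormedAddCommGroup V] [InnerProductSpace ℝ V]

lemma hasTemperateGrowth_cexp_mul_I :
    Function.HasTemperateGrowth (fun t : ℝ => Complex.exp (Complex.I * t)) := by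
  have hs : ContDiff ℝ ∞ (fun t : ℝ => Complex.exp (Complex.I * t)) := by
    have : ContDiff ℝ ∞ (fun t : ℝ => (t : ℂ)) := Complex.ofRealCLM.contDiff
    fun_prop
  refine ⟨hs, fun n => ⟨0, 1, fun t => ?_⟩⟩
  rw [norm_iteratedFDeriv_eq_norm_iteratedDeriv]
  have key : ∀ n : ℕ, iteratedDeriv n (fun t : ℝ => Complex.exp (Complex.I * t)) =
      fun t : ℝ => Complex.I ^ n * Complex.exp (Complex.I * t) := by
    intro n
    induction n with
    | zero => simp
    | succ n ih =>
      rw [iteratedDeriv_succ, ih]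
      funext t
      have h1 : HasDerivAt (fun t : ℝ => (t : ℂ)) 1 t := Complex.ofRealCLM.hasDerivAt
      have := (((h1.const_mul Complex.I).cexp).const_mul (Complex.I ^ n)).deriv
      rw [this]; ring
  rw [key]
  simp [Complex.norm_exp]

lemma hasTemperateGrowth_modulation (k : V) :
    Function.HasTemperateGrowth (fun x : V => Complex.exp (Complex.I * (inner ℝ k x : ℝ))) :=
  hasTemperateGrowth_cexp_mul_I.comp (by fun_prop)

end Modulation

/-! ### Derivatives of affine pullbacks. -/

section Affine

variable {V W G : Type*} [NormedAddCommGroup V] [NormedSpace ℝ V] [NormedAddCommGroup W]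
  [NormedSpace ℝ W] [NormedAddCommGroup G] [NormedSpace ℝ G]

lemma iteratedFDeriv_comp_affine {f : W → G} (hf : ContDiff ℝ ∞ f) (L : V →L[ℝ] W) (c : W)
    (n : ℕ) (x : V) :
    iteratedFDeriv ℝ n (fun x => f (L x + c)) x =
      (iteratedFDeriv ℝ n f (L x + c)).compContinuousLinearMap fun _ => L := by
  have hf' : ContDiff ℝ ∞ (fun y => f (y + c)) := hf.comp (contDiff_id.add contDiff_const)
  have := L.iteratedFDeriv_comp_right hf' x (i := n) (by exact_mod_cast le_top)
  rw [iteratedFDeriv_comp_add_right] at this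
  exact this

lemma norm_iteratedFDeriv_comp_affine_le {f : W → G} (hf : ContDiff ℝ ∞ f) (L : V →L[ℝ] W)
    (c : W) (n : ℕ) (x : V) :
    ‖iteratedFDeriv ℝ n (fun x => f (L x + c)) x‖ ≤
      ‖iteratedFDeriv ℝ n f (L x + c)‖ * ‖L‖ ^ n := by
  rw [iteratedFDeriv_comp_affine hf]
  refine (ContinuousMultilinearMap.norm_compContinuousLinearMap_le _ _).trans ?_
  simp

end Affine

/-- The character `t ↦ exp (2πit)`. -/
noncomputable def phase (t : ℝ) : ℂ := Complex.exp (Complex.I * (2 * Real.pi * t : ℝ))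

lemma phase_add (s t : ℝ) : phase (s + t) = phase s * phase t := by
  unfold phase
  rw [← Complex.exp_add]; push_cast; ring_nf

@[simp] lemma phase_zero : phase 0 = 1 := by simp [phase]

@[simp] lemma norm_phase (t : ℝ) : ‖phase t‖ = 1 := by
  unfold phase
  rw [mul_comm, Complex.norm_exp_ofReal_mul_I]

lemma conj_phase (t : ℝ) : conj (phase t) = phase (-t) := by
  unfold phase
  rw [← Complex.exp_conj, map_mul, Complex.conj_I, Complex.conj_ofReal]
  push_cast; ring_nf

@[fun_prop] lemma continuous_phase : Continuous phase := by unfold phase; fun_prop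

attribute [fun_prop] continuous_gauss

/-! ### Midpoint and difference coordinates. -/

section PairMap

variable {d : ℕ}

/-- The change of variables from the midpoint and the difference of two points to the points. -/
noncomputable def midpointHomeo (d : ℕ) : Space d × Space d ≃ₜ Space d × Space d where
  toFun z := (z.1 + (1 / 2 : ℝ) • z.2, z.1 - (1 / 2 : ℝ) • z.2)
  invFun p := ((1 / 2 : ℝ) • (p.1 + p.2), p.1 - p.2)
  left_inv z := by ext <;> simp <;> ring
  right_inv p := by ext <;> simp <;> ring
  continuous_toFun := by fun_prop
  continuous_invFun := by fun_prop

/-- The map factors into swaps, a shear and a fibrewise reflection, each of which preserves Lebesgue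
measure. -/
lemma measurePreserving_midpointHomeo : MeasurePreserving (midpointHomeo d) := by
  have h1 : MeasurePreserving (fun z : Space d × Space d => (z.1, (1 / 2 : ℝ) • z.1 + z.2))
      volume volume :=
    (MeasurePreserving.id volume).skew_product (g := fun r X => (1 / 2 : ℝ) • r + X)
      (by unfold Function.uncurry; fun_prop) (ae_of_all _ fun r => map_add_left_eq_self _ _)
  have h2 : MeasurePreserving (fun z : Space d × Space d => (z.1, z.1 - z.2)) volume volume :=
    (MeasurePreserving.id volume).skew_product (g := fun x r => x - r)
      (by unfold Function.uncurry; fun_prop) (ae_of_all _ fun r => (Measure.measurePreserving_sub_left volume r).map_eq)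
  have hs : MeasurePreserving (Prod.swap : Space d × Space d → _) volume volume :=
    Measure.measurePreserving_swap
  have e : ⇑(midpointHomeo d) = (fun z : Space d × Space d => (z.1, z.1 - z.2)) ∘ Prod.swap ∘
      (fun z : Space d × Space d => (z.1, (1 / 2 : ℝ) • z.1 + z.2)) ∘ Prod.swap := by
    funext z
    ext <;> simp [midpointHomeo] <;> ring
  rw [e]
  exact h2.comp (hs.comp (h1.comp hs))

lemma integral_midpointHomeo {G : Type*} [NormedAddCommGroup G] [NormedSpace ℝ G]
    (f : Space d × Space d → G) : ∫ z, f (midpointHomeo d z) = ∫ p, f p :=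
  measurePreserving_midpointHomeo.integral_comp (midpointHomeo d).measurableEmbedding f

lemma integrable_comp_midpointHomeo {G : Type*} [NormedAddCommGroup G]
    {f : Space d × Space d → G} (hf : Integrable f) :
    Integrable (fun z => f (midpointHomeo d z)) :=
  measurePreserving_midpointHomeo.integrable_comp_of_integrable hf

end PairMap

/-! ### The cross-Wigner distribution of Schwartz functions and its integrability. -/

section Wigner

variable {d : ℕ}

/-- The product `conj ψ(X + r/2) φ(X - r/2)`. -/
noncomputable def pairKernel (ψ φ : Space d → ℂ) (X r : Space d) : ℂ :=
  conj (ψ (X + (1 / 2 : ℝ) • r)) * φ (X - (1 / 2 : ℝ) • r)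

/-- The cross-Wigner distribution of two functions. -/
noncomputable def wigner (ψ φ : Space d → ℂ) (z : Space d × Space d) : ℂ :=
  ∫ r : Space d, phase (inner ℝ z.2 r) * pairKernel ψ φ z.1 r

lemma integrable_pair (ψ φ : 𝓢(Space d, ℂ)) :
    Integrable (fun p : Space d × Space d => conj (ψ p.1) * φ p.2) := by
  have h1 : Integrable (fun x => conj (ψ x)) := by
    refine ψ.integrable.norm.mono' (Continuous.aestronglyMeasurable ?_) (by simp)
    exact Complex.continuous_conj.comp ψ.continuous
  exact h1.mul_prod φ.integrable

lemma integrable_pairKernel (ψ φ : 𝓢(Space d, ℂ)) :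
    Integrable (fun z : Space d × Space d => pairKernel ψ φ z.1 z.2) :=
  integrable_comp_midpointHomeo (integrable_pair ψ φ)

lemma continuous_pairKernel (ψ φ : 𝓢(Space d, ℂ)) :
    Continuous (fun z : Space d × Space d => pairKernel ψ φ z.1 z.2) := by
  unfold pairKernel
  have := ψ.continuous
  have := φ.continuous
  exact (Complex.continuous_conj.comp (by fun_prop)).mul (by fun_prop)

lemma integrable_pairKernel_right (ψ φ : 𝓢(Space d, ℂ)) (X : Space d) :
    Integrable (pairKernel ψ φ X) := by
  obtain ⟨C, hC⟩ : ∃ C, ∀ x, ‖φ x‖ ≤ C := by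
    obtain ⟨C, hC⟩ := φ.decay 0 0
    exact ⟨C, fun x => by simpa using hC.2 x⟩
  have h1 : Integrable (fun r : Space d => ψ (X + (1 / 2 : ℝ) • r)) :=
    (ψ.integrable.comp_add_left X).comp_smul (by norm_num)
  refine (h1.norm.mul_const C).mono' ?_ (ae_of_all _ fun r => ?_)
  · have := continuous_pairKernel ψ φ
    exact (this.comp (Continuous.prodMk_right X)).aestronglyMeasurable
  · unfold pairKernel
    rw [norm_mul, RCLike.norm_conj]
    exact mul_le_mul_of_nonneg_left (hC _) (norm_nonneg _)

lemma wigner_eq_fourier (ψ φ : Space d → ℂ) (z : Space d × Space d) :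
    wigner ψ φ z = FourierTransform.fourier (pairKernel ψ φ z.1) (-z.2) := by
  rw [Real.fourier_eq']
  unfold wigner phase
  congr 1; funext r
  rw [smul_eq_mul, inner_neg_right, real_inner_comm]
  congr 2
  push_cast; ring

/-- The sum of the norms of the derivatives of order at most `N`. -/
noncomputable def derivNormSum (N : ℕ) (f : Space d → ℂ) (x : Space d) : ℝ :=
  ∑ i ∈ Finset.range (N + 1), ‖iteratedFDeriv ℝ i f x‖

lemma derivNormSum_nonneg (N : ℕ) (f : Space d → ℂ) (x : Space d) : 0 ≤ derivNormSum N f x :=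
  Finset.sum_nonneg fun _ _ => norm_nonneg _

lemma norm_iteratedFDeriv_le_derivNormSum {N n : ℕ} (h : n ≤ N) (f : Space d → ℂ) (x : Space d) :
    ‖iteratedFDeriv ℝ n f x‖ ≤ derivNormSum N f x :=
  Finset.single_le_sum (f := fun i => ‖iteratedFDeriv ℝ i f x‖) (fun _ _ => norm_nonneg _)
    (Finset.mem_range.2 (by omega))

lemma integrable_derivNormSum (N : ℕ) (f : 𝓢(Space d, ℂ)) : Integrable (derivNormSum N f) := by
  refine integrable_finsetSum _ fun i _ => ?_
  have := f.integrable_pow_mul_iteratedFDeriv (volume : Measure (Space d)) 0 i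
  simpa using this

lemma contDiff_pairKernel (ψ φ : 𝓢(Space d, ℂ)) (X : Space d) :
    ContDiff ℝ ∞ (pairKernel ψ φ X) := by
  have h1 : ContDiff ℝ ∞ (fun r : Space d => ψ (X + (1 / 2 : ℝ) • r)) :=
    (ψ.smooth ⊤).comp (by fun_prop)
  have h2 : ContDiff ℝ ∞ (fun r : Space d => φ (X - (1 / 2 : ℝ) • r)) :=
    (φ.smooth ⊤).comp (by fun_prop)
  exact (Complex.conjCLE.contDiff.comp h1).mul h2

/-- Leibniz rule; the inner factors ±1/2 only shrink derivatives. The right side is a product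
function of the two endpoints, hence integrable in (X, r) after the midpoint change of variables. -/
lemma norm_iteratedFDeriv_pairKernel_le (ψ φ : 𝓢(Space d, ℂ)) {n N : ℕ} (hn : n ≤ N)
    (X r : Space d) :
    ‖iteratedFDeriv ℝ n (pairKernel ψ φ X) r‖ ≤
      2 ^ N * (derivNormSum N ψ (X + (1 / 2 : ℝ) • r) * derivNormSum N φ (X - (1 / 2 : ℝ) • r)) := by
  have e1 : ∀ (f : 𝓢(Space d, ℂ)) (s : ℝ), |s| ≤ 1 → ∀ i ≤ N, 
      ‖iteratedFDeriv ℝ i (fun r : Space d => f ((s • ContinuousLinearMap.id ℝ (Space d)) r + X)) r‖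
        ≤ derivNormSum N f (s • r + X) := by
    intro f s hs i hi
    refine (norm_iteratedFDeriv_comp_affine_le (f.smooth ⊤) _ X i r).trans ?_
    have hL : ‖s • ContinuousLinearMap.id ℝ (Space d)‖ ≤ 1 := by
      rw [norm_smul]
      exact mul_le_one₀ hs (norm_nonneg _) ContinuousLinearMap.norm_id_le
    refine (mul_le_of_le_one_right (norm_nonneg _) (pow_le_one₀ (norm_nonneg _) hL)).trans ?_
    exact norm_iteratedFDeriv_le_derivNormSum hi _ _
  have h1 : ContDiff ℝ ∞ (fun r : Space d => ψ (X + (1 / 2 : ℝ) • r)) :=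
    (ψ.smooth ⊤).comp (by fun_prop)
  have h2 : ContDiff ℝ ∞ (fun r : Space d => φ (X - (1 / 2 : ℝ) • r)) :=
    (φ.smooth ⊤).comp (by fun_prop)
  have hc : ContDiff ℝ ∞ (fun r : Space d => conj (ψ (X + (1 / 2 : ℝ) • r))) :=
    Complex.conjCLE.contDiff.comp h1
  refine (norm_iteratedFDeriv_mul_le hc h2 r (n := n) (by exact_mod_cast le_top)).trans ?_
  have hsum : ∑ i ∈ Finset.range (n + 1), (n.choose i : ℝ) = 2 ^ n := by
    exact_mod_cast Nat.sum_range_choose n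
  have hterm : ∀ i ∈ Finset.range (n + 1),
      (n.choose i : ℝ) * ‖iteratedFDeriv ℝ i (fun r : Space d => conj (ψ (X + (1 / 2 : ℝ) • r))) r‖
        * ‖iteratedFDeriv ℝ (n - i) (fun r : Space d => φ (X - (1 / 2 : ℝ) • r)) r‖ ≤
      (n.choose i : ℝ) * (derivNormSum N ψ (X + (1 / 2 : ℝ) • r) *
        derivNormSum N φ (X - (1 / 2 : ℝ) • r)) := by
    intro i hi
    rw [Finset.mem_range] at hi
    rw [mul_assoc]
    have a1 : ‖iteratedFDeriv ℝ i (fun r : Space d => conj (ψ (X + (1 / 2 : ℝ) • r))) r‖ ≤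
        derivNormSum N ψ (X + (1 / 2 : ℝ) • r) := by
      have := Complex.conjLIE.norm_iteratedFDeriv_comp_left
        (fun r : Space d => ψ (X + (1 / 2 : ℝ) • r)) r i
      have e := e1 ψ (1 / 2) (by norm_num [abs_le]) i (by omega)
      simp only [smul_apply, ContinuousLinearMap.id_apply,
        add_comm _ X] at e
      exact this.le.trans e
    have a2 : ‖iteratedFDeriv ℝ (n - i) (fun r : Space d => φ (X - (1 / 2 : ℝ) • r)) r‖ ≤
        derivNormSum N φ (X - (1 / 2 : ℝ) • r) := by
      have e := e1 φ (-(1 / 2)) (by norm_num [abs_le]) (n - i) (by omega)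
      simp only [smul_apply, ContinuousLinearMap.id_apply,
        add_comm _ X, neg_smul, ← sub_eq_add_neg] at e
      exact e
    gcongr
    exact derivNormSum_nonneg _ _ _
  refine (Finset.sum_le_sum hterm).trans ?_
  rw [← Finset.sum_mul, hsum]
  refine mul_le_mul_of_nonneg_right (pow_le_pow_right₀ (by norm_num) hn)
    (mul_nonneg (derivNormSum_nonneg _ _ _) (derivNormSum_nonneg _ _ _))

lemma measurable_wigner (ψ φ : 𝓢(Space d, ℂ)) :
    AEStronglyMeasurable (wigner ψ φ) (volume : Measure (Space d × Space d)) := by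
  have hc : Continuous (fun q : (Space d × Space d) × Space d =>
      phase (inner ℝ q.1.2 q.2) * pairKernel ψ φ q.1.1 q.2) := by
    have := continuous_pairKernel ψ φ
    have h2 : Continuous (fun q : (Space d × Space d) × Space d => pairKernel ψ φ q.1.1 q.2) :=
      this.comp (by fun_prop : Continuous fun q : (Space d × Space d) × Space d => (q.1.1, q.2))
    fun_prop
  exact (hc.stronglyMeasurable.integral_prod_right).aestronglyMeasurable

/-- For fixed X the distribution is a Fourier transform in r, so d + 1 integrable derivatives of the
pair kernel give decay of order d + 1 in the momentum, enough on a space of dimension d. The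
constant in this decay is an integral over r that is itself integrable in X. -/
lemma integrable_wigner (ψ φ : 𝓢(Space d, ℂ)) :
    Integrable (wigner ψ φ) (volume : Measure (Space d × Space d)) := by
  set N := d + 1
  set P : Space d × Space d → ℝ := fun p => derivNormSum N ψ p.1 * derivNormSum N φ p.2
  have hP : Integrable P := (integrable_derivNormSum N ψ).mul_prod (integrable_derivNormSum N φ)
  have hP2 : Integrable (fun z => P (midpointHomeo d z)) := integrable_comp_midpointHomeo hP
  have hm : Integrable (fun X => ∫ r, P (midpointHomeo d (X, r))) := hP2.integral_prod_left
  have hj : Integrable (fun η : Space d => (1 + ‖η‖) ^ (-(N : ℝ))) :=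
    integrable_one_add_norm (by simp [N])
  have hae := hP2.prod_right_ae
  set K : ℝ := 2 ^ N * (1 + 2 ^ N * (N + 1)) * 2 ^ N
  have hbig : Integrable (fun z : Space d × Space d =>
      (K * ∫ r, P (midpointHomeo d (z.1, r))) * (1 + ‖z.2‖) ^ (-(N : ℝ))) :=
    (hm.const_mul K).mul_prod hj
  refine hbig.mono' (measurable_wigner ψ φ) ?_
  have hae' : ∀ᵐ z : Space d × Space d, Integrable (fun r => P (midpointHomeo d (z.1, r))) :=
    Measure.quasiMeasurePreserving_fst.ae hae
  filter_upwards [hae'] with z hz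
  have hI : ∀ n ≤ N, Integrable (fun r => ‖iteratedFDeriv ℝ n (pairKernel ψ φ z.1) r‖) ∧
      ∫ r, ‖iteratedFDeriv ℝ n (pairKernel ψ φ z.1) r‖ ≤
        2 ^ N * ∫ r, P (midpointHomeo d (z.1, r)) := by
    intro n hn
    have hb : ∀ r, ‖iteratedFDeriv ℝ n (pairKernel ψ φ z.1) r‖ ≤
        2 ^ N * P (midpointHomeo d (z.1, r)) :=
      fun r => norm_iteratedFDeriv_pairKernel_le ψ φ hn z.1 r
    have hi : Integrable (fun r => ‖iteratedFDeriv ℝ n (pairKernel ψ φ z.1) r‖) := by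
      refine (hz.const_mul (2 ^ N)).mono' ?_ (ae_of_all _ fun r => by simpa using hb r)
      exact (((contDiff_pairKernel ψ φ z.1).continuous_iteratedFDeriv
        (by exact_mod_cast le_top)).norm).aestronglyMeasurable
    refine ⟨hi, ?_⟩
    rw [← integral_const_mul]
    exact integral_mono hi (hz.const_mul _) hb
  set I0 := ∫ r, P (midpointHomeo d (z.1, r))
  have hI0 : 0 ≤ I0 := integral_nonneg fun r =>
    mul_nonneg (derivNormSum_nonneg _ _ _) (derivNormSum_nonneg _ _ _)
  have hF : ∀ n ≤ N, ‖z.2‖ ^ n * ‖wigner ψ φ z‖ ≤ 2 ^ N * ((N + 1) * (2 ^ N * I0)) := by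
    intro n hn
    have := Real.pow_mul_norm_iteratedFDeriv_fourier_le (f := pairKernel ψ φ z.1) (K := 0)
      (N := (N : ℕ∞)) ((contDiff_pairKernel ψ φ z.1).of_le (by exact_mod_cast le_top))
      (by
        intro k n hk hn
        have hk0 : k = 0 := by simpa using hk
        subst hk0
        simpa using (hI n (by exact_mod_cast hn)).1) (k := 0) (n := n) le_rfl
        (by exact_mod_cast hn) (-z.2)
    simp only [norm_neg, norm_iteratedFDeriv_zero, pow_zero, one_mul, zero_add,
      Finset.range_one, Finset.singleton_product, Finset.sum_map, Function.Embedding.coeFn_mk,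
      CharP.cast_eq_zero, mul_zero] at this
    rw [wigner_eq_fourier]
    refine this.trans ?_
    have hs : ∑ x ∈ Finset.range (n + 1), ∫ v, ‖iteratedFDeriv ℝ x (pairKernel ψ φ z.1) v‖ ≤
        ∑ x ∈ Finset.range (n + 1), 2 ^ N * I0 :=
      Finset.sum_le_sum fun i hi => (hI i (by rw [Finset.mem_range] at hi; omega)).2
    rw [Finset.sum_const, Finset.card_range, nsmul_eq_mul] at hs
    have h2 : ((n + 1 : ℕ) : ℝ) * (2 ^ N * I0) ≤ (N + 1) * (2 ^ N * I0) := by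
      push_cast
      gcongr
    gcongr
    · exact Finset.sum_nonneg fun i _ => integral_nonneg fun _ => norm_nonneg _
    · norm_num
    · exact hs.trans h2
  have h0 := hF 0 (by omega)
  have hN := hF N le_rfl
  rw [pow_zero, one_mul] at h0
  have hz1 : 0 < 1 + ‖z.2‖ := by positivity
  rw [Real.rpow_neg hz1.le, Real.rpow_natCast, ← div_eq_mul_inv, le_div_iff₀ (by positivity)]
  have hpow : (1 + ‖z.2‖) ^ N ≤ 2 ^ (N - 1) * (1 ^ N + ‖z.2‖ ^ N) :=
    add_pow_le (by norm_num) (norm_nonneg _) N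
  have hpow2 : (2 : ℝ) ^ (N - 1) ≤ 2 ^ N := pow_le_pow_right₀ (by norm_num) (by omega)
  calc ‖wigner ψ φ z‖ * (1 + ‖z.2‖) ^ N
      ≤ ‖wigner ψ φ z‖ * (2 ^ (N - 1) * (1 ^ N + ‖z.2‖ ^ N)) := by gcongr
    _ = 2 ^ (N - 1) * (‖wigner ψ φ z‖ + ‖z.2‖ ^ N * ‖wigner ψ φ z‖) := by ring
    _ ≤ 2 ^ (N - 1) * (2 ^ N * ((N + 1) * (2 ^ N * I0)) + 2 ^ N * ((N + 1) * (2 ^ N * I0))) := by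
        gcongr
    _ = 2 * 2 ^ (N - 1) * (2 ^ N * (N + 1)) * 2 ^ N * I0 := by ring
    _ = 2 ^ N * (2 ^ N * (N + 1)) * 2 ^ N * I0 := by
        rw [← pow_succ']; rfl
    _ ≤ K * I0 := by
        simp only [K]
        gcongr
        linarith

end Wigner

/-- The prefactor of the Gaussian Fourier transform is identified by its value at w = 0, so its
explicit power of π/b never has to be carried along. -/
lemma integral_phase_mul_gauss {V : Type*} [NormedAddCommGroup V] [InnerProductSpace ℝ V]
    [FiniteDimensional ℝ V] [MeasurableSpace V] [BorelSpace V] {b : ℝ} (hb : 0 < b) (w : V) :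
    ∫ η : V, phase (inner ℝ w η) * (gauss b η : ℂ) =
      ((∫ η : V, gauss b η : ℝ) : ℂ) * (gauss (Real.pi ^ 2 / b) w : ℂ) := by
  have h0 : ∀ w : V, ∫ η : V, phase (inner ℝ w η) * (gauss b η : ℂ) =
      (Real.pi / b) ^ (Module.finrank ℝ V / 2 : ℂ) * (gauss (Real.pi ^ 2 / b) w : ℂ) := by
    intro w
    have := GaussianFourier.integral_cexp_neg_mul_sq_norm_add (V := V) (b := (b : ℂ))
      (by simpa using hb) (2 * Real.pi * Complex.I) w
    convert this using 1
    · congr 1; funext η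
      unfold phase gauss
      rw [Complex.ofReal_exp, ← Complex.exp_add]
      push_cast; ring_nf
    · congr 1
      unfold gauss
      rw [Complex.ofReal_exp]
      congr 1
      push_cast
      have : (b : ℂ) ≠ 0 := by exact_mod_cast hb.ne'
      field_simp
      ring_nf
      simp
  have h1 := h0 0
  simp only [inner_zero_left, phase_zero, one_mul] at h1
  have h2 : (gauss (Real.pi ^ 2 / b) (0 : V) : ℂ) = 1 := by simp [gauss]
  rw [h2, mul_one] at h1
  rw [h0, ← h1, integral_complex_ofReal]

/-! ### The Weyl form as a phase space integral. -/

section WeylWigner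

variable {d : ℕ}

lemma integrable_bounded_mul_wigner {c : Space d × Space d → ℂ} (hc : Continuous c) {B : ℝ}
    (hB : ∀ z, ‖c z‖ ≤ B) (ψ φ : 𝓢(Space d, ℂ)) : Integrable (fun z => c z * wigner ψ φ z) :=
  (integrable_wigner ψ φ).bdd_mul hc.aestronglyMeasurable (ae_of_all _ hB)

/-- The defining integral is only iterated. In midpoint coordinates its inner part is an integral of
the Wigner distribution, and the substitution ξ = 2πη consumes the factor (2π)^(-d). What results
converges absolutely, and all later manipulations of the form start from it. -/
lemma weylForm_eq_integral_wigner {b : Space d → Space d → ℝ}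
    (hb : Continuous (Function.uncurry b)) {B : ℝ} (hB : ∀ x ξ, |b x ξ| ≤ B)
    (ψ φ : 𝓢(Space d, ℂ)) :
    weylForm b ψ φ =
      ∫ z : Space d × Space d, (b z.1 ((2 * Real.pi) • z.2) : ℂ) * wigner ψ φ z := by
  have hpi : (2 * Real.pi) ≠ 0 := by positivity
  set G : Space d → ℂ := fun η => ∫ X, (b X ((2 * Real.pi) • η) : ℂ) * wigner ψ φ (X, η) with hG
  have hinner : ∀ ξ : Space d, (∫ p : Space d × Space d,
      Complex.exp (Complex.I * (inner ℝ ξ (p.1 - p.2) : ℝ)) *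
        (b ((1 / 2 : ℝ) • (p.1 + p.2)) ξ : ℂ) * conj (ψ p.1) * φ p.2) =
        G ((2 * Real.pi)⁻¹ • ξ) := by
    intro ξ
    rw [← integral_midpointHomeo]
    have e : ∀ z : Space d × Space d,
        Complex.exp (Complex.I * (inner ℝ ξ ((midpointHomeo d z).1 - (midpointHomeo d z).2) : ℝ)) *
        (b ((1 / 2 : ℝ) • ((midpointHomeo d z).1 + (midpointHomeo d z).2)) ξ : ℂ) *
          conj (ψ (midpointHomeo d z).1) * φ (midpointHomeo d z).2 =
        (b z.1 ξ : ℂ) * (phase (inner ℝ ((2 * Real.pi)⁻¹ • ξ) z.2) * pairKernel ψ φ z.1 z.2) := by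
      intro z
      have e1 : (midpointHomeo d z).1 - (midpointHomeo d z).2 = z.2 :=
        congrArg Prod.snd ((midpointHomeo d).symm_apply_apply z)
      have e2 : (1 / 2 : ℝ) • ((midpointHomeo d z).1 + (midpointHomeo d z).2) = z.1 :=
        congrArg Prod.fst ((midpointHomeo d).symm_apply_apply z)
      rw [e1, e2]
      have e3 : phase (inner ℝ ((2 * Real.pi)⁻¹ • ξ) z.2) =
          Complex.exp (Complex.I * (inner ℝ ξ z.2 : ℝ)) := by
        unfold phase
        rw [real_inner_smul_left, mul_inv_cancel_left₀ hpi]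
      rw [e3]
      have m1 : (midpointHomeo d z).1 = z.1 + (1 / 2 : ℝ) • z.2 := rfl
      have m2 : (midpointHomeo d z).2 = z.1 - (1 / 2 : ℝ) • z.2 := rfl
      rw [m1, m2, pairKernel]
      ring
    simp_rw [e]
    have hb1 : Continuous (fun z : Space d × Space d => (b z.1 ξ : ℂ) *
        phase (inner ℝ ((2 * Real.pi)⁻¹ • ξ) z.2)) := by
      have : Continuous (fun z : Space d × Space d => b z.1 ξ) :=
        hb.comp (by fun_prop : Continuous fun z : Space d × Space d => (z.1, ξ))
      fun_prop
    have hint : Integrable (fun z : Space d × Space d => (b z.1 ξ : ℂ) *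
        (phase (inner ℝ ((2 * Real.pi)⁻¹ • ξ) z.2) * pairKernel ψ φ z.1 z.2)) := by
      simp_rw [← mul_assoc]
      refine (integrable_pairKernel ψ φ).bdd_mul (c := B) hb1.aestronglyMeasurable
        (ae_of_all _ fun z => ?_)
      rw [norm_mul, norm_phase, mul_one, Complex.norm_real]
      exact hB _ _
    rw [Measure.volume_eq_prod] at hint ⊢
    rw [integral_prod _ hint, hG]
    refine integral_congr_ae (ae_of_all _ fun X => ?_)
    dsimp only
    rw [integral_const_mul, smul_inv_smul₀ hpi]
    rfl
  unfold weylForm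
  simp_rw [hinner]
  rw [Measure.integral_comp_smul, finrank_euclideanSpace, Fintype.card_fin]
  have habs : |(((2 * Real.pi)⁻¹ ^ d)⁻¹ : ℝ)| = (2 * Real.pi) ^ d := by
    rw [inv_pow, inv_inv, abs_of_nonneg (by positivity)]
  rw [habs, Complex.real_smul, ← mul_assoc, ← Complex.ofReal_mul,
    inv_mul_cancel₀ (by positivity), Complex.ofReal_one, one_mul]
  have hcont : Continuous (fun z : Space d × Space d => (b z.1 ((2 * Real.pi) • z.2) : ℂ)) := by
    have : Continuous (fun z : Space d × Space d => b z.1 ((2 * Real.pi) • z.2)) :=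
      hb.comp (by fun_prop : Continuous fun z : Space d × Space d => (z.1, (2 * Real.pi) • z.2))
    fun_prop
  have hint := integrable_bounded_mul_wigner hcont (B := B)
    (fun z => by rw [Complex.norm_real]; exact hB _ _) ψ φ
  rw [Measure.volume_eq_prod] at hint ⊢
  rw [integral_prod_symm _ hint]

lemma wigner_conj (ψ φ : Space d → ℂ) (z : Space d × Space d) :
    conj (wigner ψ φ z) = wigner φ ψ z := by
  unfold wigner
  rw [← integral_conj, ← integral_neg_eq_self]
  refine integral_congr_ae (ae_of_all _ fun r => ?_)
  simp only [map_mul, conj_phase, inner_neg_right, neg_neg, pairKernel, smul_neg, sub_neg_eq_add,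
    ← sub_eq_add_neg, Complex.conj_conj]
  ring

lemma weylForm_conj {b : Space d → Space d → ℝ} (hb : Continuous (Function.uncurry b)) {B : ℝ}
    (hB : ∀ x ξ, |b x ξ| ≤ B) (ψ φ : 𝓢(Space d, ℂ)) :
    conj (weylForm b ψ φ) = weylForm b φ ψ := by
  rw [weylForm_eq_integral_wigner hb hB, weylForm_eq_integral_wigner hb hB, ← integral_conj]
  simp_rw [map_mul, wigner_conj, Complex.conj_ofReal]

end WeylWigner

/-! ### Wave packets and Gaussian averages of the Wigner distribution. -/

section WavePacket

variable {d : ℕ}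

/-- The Gaussian wave packet transform. -/
noncomputable def wavePacket (φ : Space d → ℂ) (q p : Space d) : ℂ :=
  ∫ x : Space d, phase (-inner ℝ p x) * (gauss Real.pi (x - q) : ℂ) * φ x

/-- The parallelogram law. It lets Gaussians in midpoint and difference be traded for Gaussians at
the two endpoints. -/
lemma gauss_midpoint (A B : Space d) :
    gauss (2 * Real.pi) ((1 / 2 : ℝ) • (A + B)) * gauss (Real.pi / 2) (A - B) =
      gauss Real.pi A * gauss Real.pi B := by
  unfold gauss
  rw [← Real.exp_add, ← Real.exp_add, norm_smul]
  have := parallelogram_law_with_norm ℝ A B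
  congr 1
  rw [mul_pow, Real.norm_eq_abs]
  have h2 : |(1 / 2 : ℝ)| ^ 2 = 1 / 4 := by norm_num
  rw [h2]
  linear_combination (-Real.pi / 2) * this

/-- The momentum integral is Gaussian in τ + r; together with the Gaussian in X - q it splits by
`gauss_midpoint` into one window for each endpoint. In endpoint coordinates the integral is
therefore a product of two wave packet transforms, displaced in opposite directions by half of (τ,
-ζ). -/
lemma integral_gauss_mul_wigner (ψ φ : 𝓢(Space d, ℂ)) (q p ζ τ : Space d) :
    ∫ z : Space d × Space d, phase (inner ℝ ζ (z.1 - q) + inner ℝ τ (z.2 - p)) *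
        ((gauss (2 * Real.pi) (z.1 - q) * gauss (2 * Real.pi) (z.2 - p) : ℝ) : ℂ) *
        wigner ψ φ z =
      ((∫ η : Space d, gauss (2 * Real.pi) η : ℝ) : ℂ) * phase (-inner ℝ ζ q) *
        (conj (wavePacket ψ (q - (1 / 2 : ℝ) • τ) (p + (1 / 2 : ℝ) • ζ)) *
          wavePacket φ (q + (1 / 2 : ℝ) • τ) (p - (1 / 2 : ℝ) • ζ)) := by
  have h2pi : 0 < 2 * Real.pi := by positivity
  set c : ℝ := ∫ η : Space d, gauss (2 * Real.pi) η
  have hcont : Continuous (fun z : Space d × Space d =>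
      phase (inner ℝ ζ (z.1 - q) + inner ℝ τ (z.2 - p)) *
        ((gauss (2 * Real.pi) (z.1 - q) * gauss (2 * Real.pi) (z.2 - p) : ℝ) : ℂ)) := by
    fun_prop
  have hint := integrable_bounded_mul_wigner hcont (B := 1) (fun z => by
    rw [norm_mul, norm_phase, one_mul, Complex.norm_real, Real.norm_eq_abs,
      abs_of_pos (mul_pos (gauss_pos _ _) (gauss_pos _ _))]
    exact mul_le_one₀ (gauss_le_one h2pi.le _) (gauss_pos _ _).le (gauss_le_one h2pi.le _)) ψ φ
  rw [Measure.volume_eq_prod] at hint ⊢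
  rw [integral_prod _ hint]
  -- the frequency integral
  have hX : ∀ X : Space d, (∫ η : Space d, phase (inner ℝ ζ (X - q) + inner ℝ τ (η - p)) *
        ((gauss (2 * Real.pi) (X - q) * gauss (2 * Real.pi) (η - p) : ℝ) : ℂ) *
        wigner ψ φ (X, η)) =
      ∫ r : Space d, (c * phase (-inner ℝ ζ q)) * ((phase (-inner ℝ (p + (1 / 2 : ℝ) • ζ)
        (midpointHomeo d (X, r)).1) * (gauss Real.pi ((midpointHomeo d (X, r)).1 -
          (q - (1 / 2 : ℝ) • τ)) : ℂ) * ψ (midpointHomeo d (X, r)).1 |> conj) *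
        (phase (-inner ℝ (p - (1 / 2 : ℝ) • ζ)
        (midpointHomeo d (X, r)).2) * (gauss Real.pi ((midpointHomeo d (X, r)).2 -
          (q + (1 / 2 : ℝ) • τ)) : ℂ) * φ (midpointHomeo d (X, r)).2)) := by
    intro X
    have e1 : ∀ η : Space d, phase (inner ℝ ζ (X - q) + inner ℝ τ (η - p)) *
        ((gauss (2 * Real.pi) (X - q) * gauss (2 * Real.pi) (η - p) : ℝ) : ℂ) *
        wigner ψ φ (X, η) = ∫ r : Space d, phase (inner ℝ ζ (X - q) + inner ℝ τ (η - p)) *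
        ((gauss (2 * Real.pi) (X - q) * gauss (2 * Real.pi) (η - p) : ℝ) : ℂ) *
          (phase (inner ℝ η r) * pairKernel ψ φ X r) := by
      intro η
      rw [integral_const_mul]; rfl
    simp_rw [e1]
    rw [integral_integral_swap]
    · refine integral_congr_ae (ae_of_all _ fun r => ?_)
      dsimp only
      have e2 : ∀ η : Space d, phase (inner ℝ ζ (X - q) + inner ℝ τ (η - p)) *
        ((gauss (2 * Real.pi) (X - q) * gauss (2 * Real.pi) (η - p) : ℝ) : ℂ) *
          (phase (inner ℝ η r) * pairKernel ψ φ X r) =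
          (fun η : Space d => phase (inner ℝ (τ + r) η) * (gauss (2 * Real.pi) η : ℂ)) (η - p) *
          (phase (inner ℝ ζ (X - q) + inner ℝ p r) * (gauss (2 * Real.pi) (X - q) : ℂ) *
            pairKernel ψ φ X r) := by
        intro η
        have : phase (inner ℝ ζ (X - q) + inner ℝ τ (η - p)) * phase (inner ℝ η r) =
            phase (inner ℝ (τ + r) (η - p)) * phase (inner ℝ ζ (X - q) + inner ℝ p r) := by
          rw [← phase_add, ← phase_add]
          congr 1
          simp only [inner_add_left, inner_sub_right, real_inner_comm r]
          ring
        push_cast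
        linear_combination ((gauss (2 * Real.pi) (X - q) : ℂ) * (gauss (2 * Real.pi) (η - p) : ℂ) *
          pairKernel ψ φ X r) * this
      simp_rw [e2]
      rw [integral_mul_const, integral_sub_right_eq_self
        (fun η : Space d => phase (inner ℝ (τ + r) η) * (gauss (2 * Real.pi) η : ℂ)),
        integral_phase_mul_gauss h2pi]
      have h3 : Real.pi ^ 2 / (2 * Real.pi) = Real.pi / 2 := by field_simp
      rw [h3]
      have hx1 : (midpointHomeo d (X, r)).1 = X + (1 / 2 : ℝ) • r := rfl
      have hx2 : (midpointHomeo d (X, r)).2 = X - (1 / 2 : ℝ) • r := rfl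
      rw [hx1, hx2]
      simp only [map_mul, conj_phase, neg_neg, Complex.conj_ofReal, pairKernel]
      have hg := gauss_midpoint (X + (1 / 2 : ℝ) • r - (q - (1 / 2 : ℝ) • τ))
        (X - (1 / 2 : ℝ) • r - (q + (1 / 2 : ℝ) • τ))
      have g1 : (1 / 2 : ℝ) • (X + (1 / 2 : ℝ) • r - (q - (1 / 2 : ℝ) • τ) +
        (X - (1 / 2 : ℝ) • r - (q + (1 / 2 : ℝ) • τ))) = X - q := by module
      have g2 : (X + (1 / 2 : ℝ) • r - (q - (1 / 2 : ℝ) • τ) -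
        (X - (1 / 2 : ℝ) • r - (q + (1 / 2 : ℝ) • τ))) = τ + r := by module
      rw [g1, g2] at hg
      have hg' : (gauss (2 * Real.pi) (X - q) : ℂ) * (gauss (Real.pi / 2) (τ + r) : ℂ) = 
        (gauss Real.pi (X + (1 / 2 : ℝ) • r - (q - (1 / 2 : ℝ) • τ)) : ℂ) *
        (gauss Real.pi (X - (1 / 2 : ℝ) • r - (q + (1 / 2 : ℝ) • τ)) : ℂ) := by
        exact_mod_cast hg
      have hph : phase (inner ℝ ζ (X - q) + inner ℝ p r) = phase (-inner ℝ ζ q) *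
          phase (inner ℝ (p + (1 / 2 : ℝ) • ζ) (X + (1 / 2 : ℝ) • r)) *
          phase (-inner ℝ (p - (1 / 2 : ℝ) • ζ) (X - (1 / 2 : ℝ) • r)) := by
        rw [← phase_add, ← phase_add]
        congr 1
        simp only [inner_add_left, inner_add_right, inner_sub_left, inner_sub_right,
          real_inner_smul_left, real_inner_smul_right]
        ring
      rw [hph]
      linear_combination (c * (conj (ψ (X + (1 / 2 : ℝ) • r)) * φ (X - (1 / 2 : ℝ) • r)) *
        phase (-inner ℝ ζ q) *
          phase (inner ℝ (p + (1 / 2 : ℝ) • ζ) (X + (1 / 2 : ℝ) • r)) *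
          phase (-inner ℝ (p - (1 / 2 : ℝ) • ζ) (X - (1 / 2 : ℝ) • r))) * hg'
    · have hg : Integrable (fun η : Space d => ((gauss (2 * Real.pi) (η - p) : ℝ) : ℂ)) :=
        ((integrable_gauss h2pi).comp_sub_right p).ofReal
      have hprod := hg.mul_prod (integrable_pairKernel_right ψ φ X)
      have hcb : Continuous (fun w : Space d × Space d =>
          phase (inner ℝ ζ (X - q) + inner ℝ τ (w.1 - p)) * (gauss (2 * Real.pi) (X - q) : ℂ) *
          phase (inner ℝ w.1 w.2)) := by fun_prop
      refine (hprod.bdd_mul (c := 1) hcb.aestronglyMeasurable (ae_of_all _ fun w => ?_)).congr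
        (ae_of_all _ fun w => ?_)
      · rw [norm_mul, norm_mul, norm_phase, norm_phase, one_mul, mul_one, Complex.norm_real,
          Real.norm_eq_abs, abs_of_pos (gauss_pos _ _)]
        exact gauss_le_one h2pi.le _
      · simp only [Function.uncurry]
        push_cast
        ring
  simp_rw [hX]
  set Q : Space d × Space d → ℂ := fun w => (c * phase (-inner ℝ ζ q)) *
      (conj (phase (-inner ℝ (p + (1 / 2 : ℝ) • ζ) w.1) *
        (gauss Real.pi (w.1 - (q - (1 / 2 : ℝ) • τ)) : ℂ) * ψ w.1) *
        (phase (-inner ℝ (p - (1 / 2 : ℝ) • ζ) w.2) * (gauss Real.pi (w.2 -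
          (q + (1 / 2 : ℝ) • τ)) : ℂ) * φ w.2)) with hQ
  have hQi : Integrable Q := by
    have hcb : Continuous (fun w : Space d × Space d => (c * phase (-inner ℝ ζ q)) *
        (conj (phase (-inner ℝ (p + (1 / 2 : ℝ) • ζ) w.1) *
        (gauss Real.pi (w.1 - (q - (1 / 2 : ℝ) • τ)) : ℂ)) *
        (phase (-inner ℝ (p - (1 / 2 : ℝ) • ζ) w.2) * (gauss Real.pi (w.2 -
          (q + (1 / 2 : ℝ) • τ)) : ℂ)))) :=
      continuous_const.mul ((Complex.continuous_conj.comp (by fun_prop)).mul (by fun_prop))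
    refine ((integrable_pair ψ φ).bdd_mul (c := |c|) hcb.aestronglyMeasurable
      (ae_of_all _ fun w => ?_)).congr (ae_of_all _ fun w => ?_)
    · simp only [norm_mul, RCLike.norm_conj, norm_phase, Complex.norm_real, one_mul, mul_one,
        Real.norm_eq_abs]
      refine mul_le_of_le_one_right (abs_nonneg _) (mul_le_one₀ ?_ (abs_nonneg _) ?_)
      · rw [abs_of_pos (gauss_pos _ _)]; exact gauss_le_one Real.pi_pos.le _
      · rw [abs_of_pos (gauss_pos _ _)]; exact gauss_le_one Real.pi_pos.le _
    · simp only [hQ, map_mul]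
      ring
  have hQi' := integrable_comp_midpointHomeo hQi
  have hfin : ∫ z, Q (midpointHomeo d z) = ∫ X, ∫ r, Q (midpointHomeo d (X, r)) := by
    rw [Measure.volume_eq_prod] at hQi' ⊢
    exact integral_prod _ hQi'
  calc _ = ∫ X, ∫ r, Q (midpointHomeo d (X, r)) := rfl
    _ = ∫ w, Q w := by rw [← hfin, integral_midpointHomeo]
    _ = _ := by
      rw [hQ, integral_const_mul, Measure.volume_eq_prod, integral_prod_mul (L := ℂ)
        (fun x => conj (phase (-inner ℝ (p + (1 / 2 : ℝ) • ζ) x) *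
        (gauss Real.pi (x - (q - (1 / 2 : ℝ) • τ)) : ℂ) * ψ x))
        (fun x => phase (-inner ℝ (p - (1 / 2 : ℝ) • ζ) x) * (gauss Real.pi (x -
          (q + (1 / 2 : ℝ) • τ)) : ℂ) * φ x), integral_conj]
      rfl

end WavePacket

/-! ### Fourier decay of Gaussian-localised symbols. -/

section FourierDecay

variable {V : Type*} [NormedAddCommGroup V] [InnerProductSpace ℝ V] [FiniteDimensional ℝ V]
  [MeasurableSpace V] [BorelSpace V]

lemma norm_fourier_mul_one_add_pow_le {f : V → ℂ} (hf : ContDiff ℝ ∞ f) {N : ℕ} {A : ℝ}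
    (hi : ∀ n ≤ N, Integrable (fun x => ‖iteratedFDeriv ℝ n f x‖))
    (hA : ∀ n ≤ N, ∫ x, ‖iteratedFDeriv ℝ n f x‖ ≤ A) (ζ : V) :
    ‖FourierTransform.fourier f ζ‖ * (1 + ‖ζ‖) ^ N ≤ 2 ^ N * (2 * 2 ^ N * ((N + 1) * A)) := by
  have hA0 : 0 ≤ A := (integral_nonneg fun _ => norm_nonneg _).trans (hA 0 (by omega))
  have hF : ∀ n ≤ N, ‖ζ‖ ^ n * ‖FourierTransform.fourier f ζ‖ ≤ 2 ^ N * ((N + 1) * A) := by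
    intro n hn
    have := Real.pow_mul_norm_iteratedFDeriv_fourier_le (f := f) (K := 0)
      (N := (N : ℕ∞)) (hf.of_le (by exact_mod_cast le_top))
      (by
        intro k n hk hn
        have hk0 : k = 0 := by simpa using hk
        subst hk0
        simpa using hi n (by exact_mod_cast hn)) (k := 0) (n := n) le_rfl
        (by exact_mod_cast hn) ζ
    simp only [norm_iteratedFDeriv_zero, pow_zero, one_mul, zero_add,
      Finset.range_one, Finset.singleton_product, Finset.sum_map, Function.Embedding.coeFn_mk,
      CharP.cast_eq_zero, mul_zero] at this
    refine this.trans ?_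
    have hs : ∑ x ∈ Finset.range (n + 1), ∫ v, ‖iteratedFDeriv ℝ x f v‖ ≤
        ∑ x ∈ Finset.range (n + 1), A :=
      Finset.sum_le_sum fun i hi => hA i (by rw [Finset.mem_range] at hi; omega)
    rw [Finset.sum_const, Finset.card_range, nsmul_eq_mul] at hs
    have h2 : ((n + 1 : ℕ) : ℝ) * A ≤ (N + 1) * A := by
      push_cast
      gcongr
    gcongr
    · exact Finset.sum_nonneg fun i _ => integral_nonneg fun _ => norm_nonneg _
    · norm_num
    · exact hs.trans h2
  have h0 := hF 0 (by omega)
  have hN := hF N le_rfl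
  rw [pow_zero, one_mul] at h0
  have hpow : (1 + ‖ζ‖) ^ N ≤ 2 ^ (N - 1) * (1 ^ N + ‖ζ‖ ^ N) :=
    add_pow_le (by norm_num) (norm_nonneg _) N
  have hpow2 : (2 : ℝ) ^ (N - 1) ≤ 2 ^ N := pow_le_pow_right₀ (by norm_num) (by omega)
  calc ‖FourierTransform.fourier f ζ‖ * (1 + ‖ζ‖) ^ N
      ≤ ‖FourierTransform.fourier f ζ‖ * (2 ^ N * (1 ^ N + ‖ζ‖ ^ N)) := by
        refine mul_le_mul_of_nonneg_left (hpow.trans ?_) (norm_nonneg _)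
        gcongr
    _ = 2 ^ N * (‖FourierTransform.fourier f ζ‖ + ‖ζ‖ ^ N * ‖FourierTransform.fourier f ζ‖) := by
        ring
    _ ≤ 2 ^ N * (2 ^ N * ((N + 1) * A) + 2 ^ N * ((N + 1) * A)) := by
        gcongr
    _ = _ := by ring

/-- The Gaussian localisation of `b` at `z`, recentred at the origin. -/
noncomputable def localSymbol (b : V → ℝ) (z Y : V) : ℂ := ((gauss (2 * Real.pi) Y * b (Y + z) : ℝ) : ℂ)

lemma contDiff_localSymbol {b : V → ℝ} (hb : ContDiff ℝ ∞ b) (z : V) :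
    ContDiff ℝ ∞ (localSymbol b z) := by
  have h1 : ContDiff ℝ ∞ (fun Y => b (Y + z)) := hb.comp (contDiff_id.add contDiff_const)
  exact Complex.ofRealCLM.contDiff.comp ((contDiff_gauss _).mul h1)

/-- The Gaussian absorbs the linear growth allowed to the derivatives of b around z, so the decay is
proportional to the local size M, with a constant independent of b and z. This is how a
position-dependent weight enters the operator bound. -/
lemma exists_norm_fourier_localSymbol_le (V : Type*) [NormedAddCommGroup V]
    [InnerProductSpace ℝ V] [FiniteDimensional ℝ V] [MeasurableSpace V] [BorelSpace V] (N : ℕ) :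
    ∃ C : ℝ, 0 ≤ C ∧ ∀ (b : V → ℝ) (M : ℝ) (z : V), ContDiff ℝ ∞ b →
      (∀ n ≤ N, ∀ Y, ‖iteratedFDeriv ℝ n b (Y + z)‖ ≤ M * (1 + ‖Y‖)) →
      Integrable (localSymbol b z) ∧
      ∀ ζ, ‖FourierTransform.fourier (localSymbol b z) ζ‖ * (1 + ‖ζ‖) ^ N ≤ C * M := by
  have h2pi : 0 < 2 * Real.pi := by positivity
  obtain ⟨CG, hCG, hG⟩ := norm_iteratedFDeriv_gauss_le (V := V) h2pi N
  have hI := (integrable_pow_mul_gauss (V := V) (half_pos h2pi) 1)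
  set I : ℝ := ∫ Y : V, (1 + ‖Y‖) ^ 1 * gauss (2 * Real.pi / 2) Y
  have hI0 : 0 ≤ I := integral_nonneg fun Y => mul_nonneg (by positivity) (gauss_pos _ _).le
  refine ⟨2 ^ N * (2 * 2 ^ N * ((N + 1) * (2 ^ N * CG * I))), by positivity,
    fun b M z hb hM => ?_⟩
  have hM0 : 0 ≤ M := by
    have := (norm_nonneg _).trans (hM 0 (by omega) 0)
    simpa using this
  have hbound : ∀ n ≤ N, ∀ Y, ‖iteratedFDeriv ℝ n (localSymbol b z) Y‖ ≤
      2 ^ N * CG * M * ((1 + ‖Y‖) ^ 1 * gauss (2 * Real.pi / 2) Y) := by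
    intro n hn Y
    have e : ‖iteratedFDeriv ℝ n (localSymbol b z) Y‖ =
        ‖iteratedFDeriv ℝ n (fun Y => gauss (2 * Real.pi) Y * b (Y + z)) Y‖ :=
      Complex.ofRealLI.norm_iteratedFDeriv_comp_left (n := ∞) (f := fun Y => gauss (2 * Real.pi) Y * b (Y + z))
        (((contDiff_gauss _).mul (hb.comp (contDiff_id.add contDiff_const))).contDiffAt) 
        (by exact_mod_cast le_top)
    rw [e]
    refine (norm_iteratedFDeriv_mul_le (contDiff_gauss _)
      (hb.comp (contDiff_id.add contDiff_const)) Y (n := n) (by exact_mod_cast le_top)).trans ?_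
    have hterm : ∀ i ∈ Finset.range (n + 1),
        (n.choose i : ℝ) * ‖iteratedFDeriv ℝ i (gauss (2 * Real.pi)) Y‖ *
          ‖iteratedFDeriv ℝ (n - i) (fun Y => b (Y + z)) Y‖ ≤
        (n.choose i : ℝ) * (CG * M * ((1 + ‖Y‖) ^ 1 * gauss (2 * Real.pi / 2) Y)) := by
      intro i hi
      rw [Finset.mem_range] at hi
      rw [mul_assoc]
      refine mul_le_mul_of_nonneg_left ?_ (by positivity)
      rw [iteratedFDeriv_comp_add_right]
      calc _ ≤ (CG * gauss (2 * Real.pi / 2) Y) * (M * (1 + ‖Y‖)) :=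
            mul_le_mul (hG i (by omega) Y) (hM _ (by omega) Y) (norm_nonneg _)
              (mul_nonneg hCG (gauss_pos _ _).le)
        _ = _ := by ring
    refine (Finset.sum_le_sum hterm).trans ?_
    rw [← Finset.sum_mul]
    have hsum : ∑ i ∈ Finset.range (n + 1), (n.choose i : ℝ) = 2 ^ n := by
      exact_mod_cast Nat.sum_range_choose n
    rw [hsum, mul_assoc (2 ^ N : ℝ), mul_assoc (2 ^ N : ℝ)]
    refine mul_le_mul_of_nonneg_right (pow_le_pow_right₀ (by norm_num) hn) ?_
    have := (gauss_pos (2 * Real.pi / 2) Y).le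
    positivity
  have hcd := contDiff_localSymbol hb z
  have hint : ∀ n ≤ N, Integrable (fun Y => ‖iteratedFDeriv ℝ n (localSymbol b z) Y‖) := by
    intro n hn
    refine (hI.const_mul (2 ^ N * CG * M)).mono' ?_ (ae_of_all _ fun Y => ?_)
    · exact ((hcd.continuous_iteratedFDeriv (by exact_mod_cast le_top)).norm).aestronglyMeasurable
    · rw [norm_norm]; exact hbound n hn Y
  constructor
  · have := hint 0 (by omega)
    simp only [norm_iteratedFDeriv_zero] at this
    exact (integrable_norm_iff hcd.continuous.aestronglyMeasurable).1 this
  · intro ζ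
    refine (norm_fourier_mul_one_add_pow_le hcd hint (A := 2 ^ N * CG * M * I) ?_ ζ).trans
      (le_of_eq (by ring))
    intro n hn
    rw [← integral_const_mul]
    exact integral_mono (hint n hn) (hI.const_mul _) (hbound n hn)

end FourierDecay

/-! ### Weighted L² bounds for wave packets. -/

section WavePacketNorm

variable {d : ℕ}

lemma lintegral_enorm_sq_fourier (f : 𝓢(Space d, ℂ)) :
    ∫⁻ p, ‖FourierTransform.fourier (f : Space d → ℂ) p‖ₑ ^ 2 = ∫⁻ x, ‖f x‖ₑ ^ 2 := by
  have h : ∀ g : 𝓢(Space d, ℂ), ∫⁻ x, ‖g x‖ₑ ^ 2 = ENNReal.ofReal (∫ x, ‖g x‖ ^ 2) := by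
    intro g
    rw [ofReal_integral_eq_lintegral_ofReal ((memLp_two_iff_integrable_sq_norm
      g.continuous.aestronglyMeasurable).1 (g.memLp 2 volume)) (ae_of_all _ fun x => by positivity)]
    congr 1; funext x
    rw [ENNReal.ofReal_pow (norm_nonneg _), ofReal_norm]
  rw [h f, ← SchwartzMap.integral_norm_sq_fourier, ← h, SchwartzMap.fourier_coe]

/-- The product of a Schwartz function with a translated Gaussian. -/
noncomputable def gaussMul (c : ℝ) (q : Space d) (φ : 𝓢(Space d, ℂ)) : 𝓢(Space d, ℂ) :=
  SchwartzMap.smulLeftCLM ℂ (fun x => (gauss c (x - q) : ℂ)) φ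

lemma gaussMul_apply {c : ℝ} (hc : 0 < c) (q : Space d) (φ : 𝓢(Space d, ℂ)) (x : Space d) :
    gaussMul c q φ x = (gauss c (x - q) : ℂ) * φ x := by
  have h1 : Function.HasTemperateGrowth (fun x : Space d => gauss c (x - q)) :=
    (hasTemperateGrowth_gauss hc).comp (by fun_prop)
  have h2 : Function.HasTemperateGrowth (fun x : Space d => (gauss c (x - q) : ℂ)) :=
    Function.HasTemperateGrowth.comp Function.Complex.hasTemperateGrowth_ofReal h1
  exact SchwartzMap.smulLeftCLM_apply_apply h2 φ x

lemma wavePacket_eq_fourier (φ : 𝓢(Space d, ℂ)) (q p : Space d) :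
    wavePacket φ q p = FourierTransform.fourier (gaussMul Real.pi q φ : Space d → ℂ) p := by
  rw [Real.fourier_eq']
  unfold wavePacket phase
  congr 1; funext x
  rw [gaussMul_apply Real.pi_pos, smul_eq_mul, real_inner_comm, ← mul_assoc]
  congr 3
  push_cast; ring

lemma measurable_wavePacket (φ : 𝓢(Space d, ℂ)) :
    Measurable (fun z : Space d × Space d => wavePacket φ z.1 z.2) := by
  have hc : Continuous (fun q : (Space d × Space d) × Space d =>
      phase (-inner ℝ q.1.2 q.2) * (gauss Real.pi (q.2 - q.1.1) : ℂ) * φ q.2) := by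
    have := φ.continuous
    fun_prop
  exact (hc.stronglyMeasurable.integral_prod_right).measurable

/-- Plancherel in p leaves the squared window times |φ|². Moving the weight from q to x costs (1 +
‖x - q‖)², which the squared window integrates. -/
lemma lintegral_wavePacket_le {m : Space d → ℝ} (hm : Continuous m) (hm0 : ∀ x, 0 ≤ m x)
    (hm1 : ∀ x y, m (x + y) ≤ m x * (1 + ‖y‖)) (φ : 𝓢(Space d, ℂ)) :
    ∫⁻ z : Space d × Space d, (ENNReal.ofReal (m z.1) * ‖wavePacket φ z.1 z.2‖ₑ) ^ 2 ≤
      (∫⁻ t : Space d, ENNReal.ofReal ((1 + ‖t‖) ^ 2 * gauss (2 * Real.pi) t)) *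
        ∫⁻ x, (ENNReal.ofReal (m x) * ‖φ x‖ₑ) ^ 2 := by
  have hmeas := measurable_wavePacket φ
  have hφ := φ.continuous
  have hmm : Measurable m := hm.measurable
  rw [Measure.volume_eq_prod, lintegral_prod _ (by fun_prop)]
  have h1 : ∀ q : Space d, ∫⁻ p : Space d, (ENNReal.ofReal (m q) * ‖wavePacket φ q p‖ₑ) ^ 2 =
      ∫⁻ x : Space d, ENNReal.ofReal (m q) ^ 2 *
        (ENNReal.ofReal (gauss (2 * Real.pi) (x - q)) * ‖φ x‖ₑ ^ 2) := by
    intro q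
    simp_rw [mul_pow, wavePacket_eq_fourier]
    rw [lintegral_const_mul' _ _ (by simp), lintegral_const_mul' _ _ (by simp),
      lintegral_enorm_sq_fourier]
    congr 2; funext x
    rw [gaussMul_apply Real.pi_pos, enorm_mul, mul_pow]
    congr 1
    rw [← ofReal_norm, ← ENNReal.ofReal_pow (norm_nonneg _), Complex.norm_real,
      Real.norm_eq_abs, abs_of_pos (gauss_pos _ _)]
    congr 1
    unfold gauss
    rw [sq, ← Real.exp_add]; ring_nf
  dsimp only
  simp_rw [h1]
  have hg : Continuous (gauss (2 * Real.pi) : Space d → ℝ) := continuous_gauss _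
  rw [lintegral_lintegral_swap (by fun_prop), ← lintegral_const_mul _ (by fun_prop)]
  refine lintegral_mono fun x => ?_
  have h2 : ∀ q : Space d, ENNReal.ofReal (m q) ^ 2 *
      (ENNReal.ofReal (gauss (2 * Real.pi) (x - q)) * ‖φ x‖ₑ ^ 2) ≤
      (fun t : Space d => ENNReal.ofReal ((1 + ‖t‖) ^ 2 * gauss (2 * Real.pi) t)) (x - q) *
        (ENNReal.ofReal (m x) * ‖φ x‖ₑ) ^ 2 := by
    intro q
    have hq : m q ≤ m x * (1 + ‖x - q‖) := by
      have := hm1 x (q - x)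
      rwa [add_sub_cancel, norm_sub_rev] at this
    have hq2 : m q ^ 2 ≤ (1 + ‖x - q‖) ^ 2 * m x ^ 2 := by
      calc m q ^ 2 ≤ (m x * (1 + ‖x - q‖)) ^ 2 := pow_le_pow_left₀ (hm0 q) hq 2
        _ = _ := by ring
    have hq3 : ENNReal.ofReal (m q) ^ 2 ≤
        ENNReal.ofReal ((1 + ‖x - q‖) ^ 2) * ENNReal.ofReal (m x) ^ 2 := by
      rw [← ENNReal.ofReal_pow (hm0 _), ← ENNReal.ofReal_pow (hm0 _),
        ← ENNReal.ofReal_mul (by positivity)]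
      exact ENNReal.ofReal_le_ofReal hq2
    dsimp only
    rw [ENNReal.ofReal_mul (by positivity), mul_pow]
    calc _ ≤ ENNReal.ofReal ((1 + ‖x - q‖) ^ 2) * ENNReal.ofReal (m x) ^ 2 *
          (ENNReal.ofReal (gauss (2 * Real.pi) (x - q)) * ‖φ x‖ₑ ^ 2) := by gcongr
      _ = _ := by ring
  refine (lintegral_mono h2).trans ?_
  rw [lintegral_mul_const _ (by fun_prop), lintegral_sub_left_eq_self
    (fun t : Space d => ENNReal.ofReal ((1 + ‖t‖) ^ 2 * gauss (2 * Real.pi) t))]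

end WavePacketNorm

/-! ### Euclidean phase space and the wave packet decomposition of the Weyl form. -/

section CalderonVaillancourt

variable {d : ℕ}

/-- Phase space with its Euclidean structure. -/
abbrev PhaseSpace (d : ℕ) : Type := WithLp 2 (Space d × Space d)

instance : (volume : Measure (PhaseSpace d)).IsNegInvariant :=
  Measure.IsAddHaarMeasure.isNegInvariant_of_regular _

instance : (volume : Measure (Space d × Space d)).IsAddHaarMeasure :=
  inferInstanceAs ((volume : Measure (Space d)).prod volume).IsAddHaarMeasure

lemma finrank_phaseSpace : Module.finrank ℝ (PhaseSpace d) = 2 * d := by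
  rw [LinearEquiv.finrank_eq (WithLp.linearEquiv 2 ℝ (Space d × Space d))]
  simp; ring

lemma inner_phaseSpace (v w : PhaseSpace d) :
    inner ℝ v w = inner ℝ v.fst w.fst + inner ℝ v.snd w.snd := by
  rw [WithLp.prod_inner_apply]; rfl

lemma gauss_phaseSpace (c : ℝ) (v : PhaseSpace d) :
    gauss c v = gauss c v.fst * gauss c v.snd := by
  unfold gauss
  rw [← Real.exp_add, WithLp.prod_norm_sq_eq_of_L2]
  congr 1
  ring

lemma gauss_two_mul {V : Type*} [NormedAddCommGroup V] (c : ℝ) (v : V) :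
    gauss (2 * c) v = gauss c v * gauss c v := by
  unfold gauss
  rw [← Real.exp_add]; ring_nf

lemma integral_phaseSpace (f : Space d × Space d → ℂ) :
    ∫ v : PhaseSpace d, f (WithLp.ofLp v) = ∫ z, f z :=
  (WithLp.volume_preserving_ofLp (Space d) (Space d)).integral_comp
    (WithLp.homeomorphProd 2 (Space d) (Space d)).measurableEmbedding f

lemma lintegral_phaseSpace (f : Space d × Space d → ENNReal) :
    ∫⁻ v : PhaseSpace d, f (WithLp.ofLp v) = ∫⁻ z, f z :=
  (WithLp.volume_preserving_ofLp (Space d) (Space d)).lintegral_comp_emb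
    (WithLp.homeomorphProd 2 (Space d) (Space d)).measurableEmbedding f

/-- The Wigner distribution on Euclidean phase space. -/
noncomputable def wignerV (ψ φ : 𝓢(Space d, ℂ)) (v : PhaseSpace d) : ℂ :=
  wigner ψ φ (WithLp.ofLp v)

lemma integrable_wignerV (ψ φ : 𝓢(Space d, ℂ)) : Integrable (wignerV ψ φ) :=
  (WithLp.volume_preserving_ofLp (Space d) (Space d)).integrable_comp_of_integrable
    (integrable_wigner ψ φ)

lemma enorm_integral_gauss_wignerV (ψ φ : 𝓢(Space d, ℂ)) (z ζ : PhaseSpace d) :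
    ‖∫ v : PhaseSpace d, phase (inner ℝ ζ (v - z)) * (gauss (2 * Real.pi) (v - z) : ℂ) *
        wignerV ψ φ v‖ₑ =
      ENNReal.ofReal (∫ η : Space d, gauss (2 * Real.pi) η) *
        (‖wavePacket ψ (z.fst - (1 / 2 : ℝ) • ζ.snd) (z.snd + (1 / 2 : ℝ) • ζ.fst)‖ₑ *
          ‖wavePacket φ (z.fst + (1 / 2 : ℝ) • ζ.snd) (z.snd - (1 / 2 : ℝ) • ζ.fst)‖ₑ) := by
  have h := integral_gauss_mul_wigner ψ φ z.fst z.snd ζ.fst ζ.snd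
  rw [← integral_phaseSpace] at h
  have e : ∀ v : PhaseSpace d, phase (inner ℝ ζ (v - z)) * (gauss (2 * Real.pi) (v - z) : ℂ) *
        wignerV ψ φ v = phase (inner ℝ ζ.fst ((WithLp.ofLp v).1 - z.fst) +
          inner ℝ ζ.snd ((WithLp.ofLp v).2 - z.snd)) *
        ((gauss (2 * Real.pi) ((WithLp.ofLp v).1 - z.fst) *
          gauss (2 * Real.pi) ((WithLp.ofLp v).2 - z.snd) : ℝ) : ℂ) *
        wigner ψ φ (WithLp.ofLp v) := by
    intro v
    rw [inner_phaseSpace, gauss_phaseSpace]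
    rfl
  simp_rw [e]
  rw [h]
  simp only [enorm_mul]
  rw [← ofReal_norm (phase _), norm_phase, ENNReal.ofReal_one, mul_one]
  congr 1
  · rw [← ofReal_norm, Complex.norm_real, Real.norm_eq_abs,
      abs_of_pos (integral_gauss_pos (by positivity))]
  · congr 1
    rw [← ofReal_norm, RCLike.norm_conj, ofReal_norm]

/-- A bounded symbol paired with the Wigner distribution, in terms of wave packets. -/
lemma integral_symbol_wignerV_le {b : PhaseSpace d → ℝ} (hb : ContDiff ℝ ∞ b) {B : ℝ}
    (hB : ∀ v, |b v| ≤ B) (hloc : ∀ z, Integrable (localSymbol b z))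
    (hF : ∀ z, Integrable (FourierTransform.fourier (localSymbol b z)))
    (ψ φ : 𝓢(Space d, ℂ)) :
    ENNReal.ofReal (∫ v : PhaseSpace d, gauss (2 * (2 * Real.pi)) v) *
        ‖∫ v : PhaseSpace d, (b v : ℂ) * wignerV ψ φ v‖ₑ ≤
      ∫⁻ z : PhaseSpace d, ∫⁻ ζ : PhaseSpace d, ‖FourierTransform.fourier (localSymbol b z) ζ‖ₑ *
        (ENNReal.ofReal (∫ η : Space d, gauss (2 * Real.pi) η) *
        (‖wavePacket ψ (z.fst - (1 / 2 : ℝ) • ζ.snd) (z.snd + (1 / 2 : ℝ) • ζ.fst)‖ₑ *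
          ‖wavePacket φ (z.fst + (1 / 2 : ℝ) • ζ.snd) (z.snd - (1 / 2 : ℝ) • ζ.fst)‖ₑ)) := by
  have h2pi : 0 < 2 * Real.pi := by positivity
  have h4pi : 0 < 2 * (2 * Real.pi) := by positivity
  set c4 := ∫ v : PhaseSpace d, gauss (2 * (2 * Real.pi)) v with hc4
  have hc4pos : 0 < c4 := integral_gauss_pos h4pi
  have hbc := hb.continuous
  have hw := integrable_wignerV ψ φ
  have hbw : Integrable (fun v => (b v : ℂ) * wignerV ψ φ v) :=
    hw.bdd_mul (c := B) (by fun_prop) (ae_of_all _ fun v => by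
      rw [Complex.norm_real]; exact hB v)
  have hP : Integrable (fun p : PhaseSpace d × PhaseSpace d =>
      (gauss (2 * (2 * Real.pi)) (p.1 - p.2) : ℂ) * ((b p.1 : ℂ) * wignerV ψ φ p.1)) := by
    have h1 := hbw.mul_prod ((integrable_gauss (V := PhaseSpace d) h4pi).ofReal (𝕜 := ℂ))
    have hmp : MeasurePreserving (fun p : PhaseSpace d × PhaseSpace d => (p.1, p.1 - p.2))
        volume volume :=
      (MeasurePreserving.id volume).skew_product (g := fun x r => x - r)
        (by unfold Function.uncurry; fun_prop)
        (ae_of_all _ fun r => (Measure.measurePreserving_sub_left volume r).map_eq)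
    refine (hmp.integrable_comp_of_integrable h1).congr (ae_of_all _ fun p => ?_)
    simp only [Function.comp]
    rw [mul_comm]; rfl
  -- A continuous partition of unity: the Gaussians of exponent 4π centred at z have total integral
  -- c4 over z.
  have hstep1 : (c4 : ℂ) * ∫ v : PhaseSpace d, (b v : ℂ) * wignerV ψ φ v =
      ∫ z : PhaseSpace d, ∫ v : PhaseSpace d,
        (gauss (2 * (2 * Real.pi)) (v - z) : ℂ) * ((b v : ℂ) * wignerV ψ φ v) := by
    rw [← integral_integral_swap (f := fun v z : PhaseSpace d =>
        (gauss (2 * (2 * Real.pi)) (v - z) : ℂ) * ((b v : ℂ) * wignerV ψ φ v)) hP,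
      ← integral_const_mul]
    refine integral_congr_ae (ae_of_all _ fun v => ?_)
    dsimp only
    rw [integral_mul_const, integral_complex_ofReal,
      integral_sub_left_eq_self (fun t : PhaseSpace d => gauss (2 * (2 * Real.pi)) t)]
  -- The exponent 4π splits as 2π + 2π. One Gaussian localises the symbol, which is expanded by
  -- Fourier inversion; the other stays with the Wigner distribution and turns each Fourier mode
  -- into a product of wave packets.
  have hstep2 : ∀ z : PhaseSpace d, (∫ v : PhaseSpace d,
        (gauss (2 * (2 * Real.pi)) (v - z) : ℂ) * ((b v : ℂ) * wignerV ψ φ v)) =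
      ∫ ζ : PhaseSpace d, FourierTransform.fourier (localSymbol b z) ζ *
        ∫ v : PhaseSpace d, phase (inner ℝ ζ (v - z)) * (gauss (2 * Real.pi) (v - z) : ℂ) *
          wignerV ψ φ v := by
    intro z
    have hinv : ∀ v : PhaseSpace d, (gauss (2 * Real.pi) (v - z) : ℂ) * (b v : ℂ) =
        ∫ ζ : PhaseSpace d, phase (inner ℝ ζ (v - z)) *
          FourierTransform.fourier (localSymbol b z) ζ := by
      intro v
      have := congrFun ((contDiff_localSymbol hb z).continuous.fourierInv_fourier_eq
        (hloc z) (hF z)) (v - z)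
      rw [Real.fourierInv_eq'] at this
      have e : localSymbol b z (v - z) = (gauss (2 * Real.pi) (v - z) : ℂ) * (b v : ℂ) := by
        unfold localSymbol
        rw [sub_add_cancel]; push_cast; rfl
      rw [← e, ← this]
      refine integral_congr_ae (ae_of_all _ fun ζ => ?_)
      dsimp only
      rw [smul_eq_mul]
      unfold phase
      rw [mul_comm Complex.I]
    have e1 : ∀ v : PhaseSpace d,
        (gauss (2 * (2 * Real.pi)) (v - z) : ℂ) * ((b v : ℂ) * wignerV ψ φ v) =
        ∫ ζ : PhaseSpace d, (phase (inner ℝ ζ (v - z)) *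
          FourierTransform.fourier (localSymbol b z) ζ) *
          ((gauss (2 * Real.pi) (v - z) : ℂ) * wignerV ψ φ v) := by
      intro v
      rw [integral_mul_const, ← hinv, gauss_two_mul]
      push_cast; ring
    simp_rw [e1]
    rw [integral_integral_swap]
    · refine integral_congr_ae (ae_of_all _ fun ζ => ?_)
      dsimp only
      rw [← integral_const_mul]
      refine integral_congr_ae (ae_of_all _ fun v => ?_)
      dsimp only
      ring
    · have hg : Continuous (gauss (2 * Real.pi) : PhaseSpace d → ℝ) := continuous_gauss _
      have hcb : Continuous (fun w : PhaseSpace d × PhaseSpace d =>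
          phase (inner ℝ w.2 (w.1 - z)) * (gauss (2 * Real.pi) (w.1 - z) : ℂ)) := by fun_prop
      refine ((hw.mul_prod (hF z)).bdd_mul (c := 1) hcb.aestronglyMeasurable
        (ae_of_all _ fun w => ?_)).congr (ae_of_all _ fun w => ?_)
      · rw [norm_mul, norm_phase, one_mul, Complex.norm_real, Real.norm_eq_abs,
          abs_of_pos (gauss_pos _ _)]
        exact gauss_le_one h2pi.le _
      · simp only [Function.uncurry]
        ring
  have hnorm : ENNReal.ofReal c4 * ‖∫ v : PhaseSpace d, (b v : ℂ) * wignerV ψ φ v‖ₑ =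
      ‖∫ z : PhaseSpace d, ∫ v : PhaseSpace d,
        (gauss (2 * (2 * Real.pi)) (v - z) : ℂ) * ((b v : ℂ) * wignerV ψ φ v)‖ₑ := by
    rw [← hstep1, enorm_mul]
    congr 1
    rw [← ofReal_norm, Complex.norm_real, Real.norm_eq_abs, abs_of_pos hc4pos]
  rw [hnorm]
  refine (enorm_integral_le_lintegral_enorm _).trans (lintegral_mono fun z => ?_)
  rw [hstep2]
  refine (enorm_integral_le_lintegral_enorm _).trans (lintegral_mono fun ζ => ?_)
  dsimp only
  rw [enorm_mul, enorm_integral_gauss_wignerV]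

/-- The Cauchy-Schwarz step of the weighted `L²` bound. -/
lemma lintegral_wavePacket_mul_le {m : Space d → ℝ} (hm : Continuous m) (hm0 : ∀ x, 0 ≤ m x)
    (hm1 : ∀ x y, m (x + y) ≤ m x * (1 + ‖y‖)) (ψ φ : 𝓢(Space d, ℂ)) (ζ : PhaseSpace d) :
    ∫⁻ z : PhaseSpace d, ENNReal.ofReal (m z.fst) *
        (‖wavePacket ψ (z.fst - (1 / 2 : ℝ) • ζ.snd) (z.snd + (1 / 2 : ℝ) • ζ.fst)‖ₑ *
          ‖wavePacket φ (z.fst + (1 / 2 : ℝ) • ζ.snd) (z.snd - (1 / 2 : ℝ) • ζ.fst)‖ₑ) ≤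
      ENNReal.ofReal (1 + ‖ζ‖) *
      ((∫⁻ t : Space d, ENNReal.ofReal ((1 + ‖t‖) ^ 2 * gauss (2 * Real.pi) t)) *
        ((∫⁻ x, ‖ψ x‖ₑ ^ 2) ^ (1 / 2 : ℝ) *
          (∫⁻ x, (ENNReal.ofReal (m x) * ‖φ x‖ₑ) ^ 2) ^ (1 / 2 : ℝ))) := by
  set I := ∫⁻ t : Space d, ENNReal.ofReal ((1 + ‖t‖) ^ 2 * gauss (2 * Real.pi) t)
  set w : Space d × Space d := ((1 / 2 : ℝ) • ζ.snd, -((1 / 2 : ℝ) • ζ.fst)) with hw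
  set f : Space d × Space d → ENNReal := fun z => ‖wavePacket ψ z.1 z.2‖ₑ with hf
  set g : Space d × Space d → ENNReal :=
    fun z => ENNReal.ofReal (m z.1) * ‖wavePacket φ z.1 z.2‖ₑ with hg
  have hfm : Measurable f := (measurable_wavePacket ψ).enorm
  have hgm : Measurable g :=
    (hm.measurable.comp measurable_fst).ennreal_ofReal.mul (measurable_wavePacket φ).enorm
  have h1 : ∀ z : Space d × Space d, ENNReal.ofReal (m z.1) *
        (‖wavePacket ψ (z.1 - (1 / 2 : ℝ) • ζ.snd) (z.2 + (1 / 2 : ℝ) • ζ.fst)‖ₑ *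
          ‖wavePacket φ (z.1 + (1 / 2 : ℝ) • ζ.snd) (z.2 - (1 / 2 : ℝ) • ζ.fst)‖ₑ) ≤
      ENNReal.ofReal (1 + ‖ζ‖) * (f (z - w) * g (z + w)) := by
    intro z
    have e1 : f (z - w) =
        ‖wavePacket ψ (z.1 - (1 / 2 : ℝ) • ζ.snd) (z.2 + (1 / 2 : ℝ) • ζ.fst)‖ₑ := by
      simp [hf, hw]
    have e2 : g (z + w) = ENNReal.ofReal (m (z.1 + (1 / 2 : ℝ) • ζ.snd)) *
        ‖wavePacket φ (z.1 + (1 / 2 : ℝ) • ζ.snd) (z.2 - (1 / 2 : ℝ) • ζ.fst)‖ₑ := by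
      simp [hg, hw, sub_eq_add_neg]
    -- The weight is moved from z to the centre of the packet of φ, at the price of one power of 1 +
    -- ‖ζ‖.
    have hmz : m z.1 ≤ (1 + ‖ζ‖) * m (z.1 + (1 / 2 : ℝ) • ζ.snd) := by
      have h := hm1 (z.1 + (1 / 2 : ℝ) • ζ.snd) (-((1 / 2 : ℝ) • ζ.snd))
      rw [add_neg_cancel_right, norm_neg, norm_smul] at h
      have h3 : ‖ζ.snd‖ ≤ ‖ζ‖ := WithLp.norm_snd_le _ ζ
      have h4 : ‖(1 / 2 : ℝ)‖ = 1 / 2 := by norm_num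
      rw [h4] at h
      nlinarith [hm0 (z.1 + (1 / 2 : ℝ) • ζ.snd), norm_nonneg ζ.snd]
    have hmz' : ENNReal.ofReal (m z.1) ≤
        ENNReal.ofReal (1 + ‖ζ‖) * ENNReal.ofReal (m (z.1 + (1 / 2 : ℝ) • ζ.snd)) := by
      rw [← ENNReal.ofReal_mul (by positivity)]
      exact ENNReal.ofReal_le_ofReal hmz
    rw [e1, e2]
    calc _ ≤ (ENNReal.ofReal (1 + ‖ζ‖) * ENNReal.ofReal (m (z.1 + (1 / 2 : ℝ) • ζ.snd))) *
        (‖wavePacket ψ (z.1 - (1 / 2 : ℝ) • ζ.snd) (z.2 + (1 / 2 : ℝ) • ζ.fst)‖ₑ *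
          ‖wavePacket φ (z.1 + (1 / 2 : ℝ) • ζ.snd) (z.2 - (1 / 2 : ℝ) • ζ.fst)‖ₑ) := by gcongr
      _ = _ := by ring
  calc _ = ∫⁻ z : Space d × Space d, ENNReal.ofReal (m z.1) *
        (‖wavePacket ψ (z.1 - (1 / 2 : ℝ) • ζ.snd) (z.2 + (1 / 2 : ℝ) • ζ.fst)‖ₑ *
          ‖wavePacket φ (z.1 + (1 / 2 : ℝ) • ζ.snd) (z.2 - (1 / 2 : ℝ) • ζ.fst)‖ₑ) :=
        lintegral_phaseSpace (fun z : Space d × Space d => ENNReal.ofReal (m z.1) *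
        (‖wavePacket ψ (z.1 - (1 / 2 : ℝ) • ζ.snd) (z.2 + (1 / 2 : ℝ) • ζ.fst)‖ₑ *
          ‖wavePacket φ (z.1 + (1 / 2 : ℝ) • ζ.snd) (z.2 - (1 / 2 : ℝ) • ζ.fst)‖ₑ))
    _ ≤ ∫⁻ z : Space d × Space d, ENNReal.ofReal (1 + ‖ζ‖) * (f (z - w) * g (z + w)) :=
        lintegral_mono h1
    _ = ENNReal.ofReal (1 + ‖ζ‖) * ∫⁻ z : Space d × Space d, f (z - w) * g (z + w) :=
        lintegral_const_mul' _ _ (by simp)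
    _ ≤ ENNReal.ofReal (1 + ‖ζ‖) * ((∫⁻ z, f z ^ 2) ^ (1 / 2 : ℝ) *
          (∫⁻ z, g z ^ 2) ^ (1 / 2 : ℝ)) := by
        gcongr
        have := ENNReal.lintegral_mul_le_Lp_mul_Lq volume Real.HolderConjugate.two_two
          (f := fun z => f (z - w)) (g := fun z => g (z + w))
          (by fun_prop) (by fun_prop)
        simp only [Pi.mul_apply, ENNReal.rpow_ofNat] at this
        rwa [lintegral_sub_right_eq_self (fun z => f z ^ 2),
          lintegral_add_right_eq_self (fun z => g z ^ 2)] at this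
    _ ≤ ENNReal.ofReal (1 + ‖ζ‖) * ((I * ∫⁻ x, ‖ψ x‖ₑ ^ 2) ^ (1 / 2 : ℝ) *
          (I * ∫⁻ x, (ENNReal.ofReal (m x) * ‖φ x‖ₑ) ^ 2) ^ (1 / 2 : ℝ)) := by
        gcongr
        · have := lintegral_wavePacket_le (m := fun _ => 1) continuous_const (by simp)
            (by simp) ψ
          simpa using this
        · exact lintegral_wavePacket_le hm hm0 hm1 φ
    _ = _ := by
        rw [ENNReal.mul_rpow_of_nonneg _ _ (by norm_num),
          ENNReal.mul_rpow_of_nonneg _ _ (by norm_num)]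
        have : I ^ (1 / 2 : ℝ) * I ^ (1 / 2 : ℝ) = I := by
          rw [← ENNReal.rpow_add_of_nonneg _ _ (by norm_num) (by norm_num)]
          norm_num
        calc _ = ENNReal.ofReal (1 + ‖ζ‖) * ((I ^ (1 / 2 : ℝ) * I ^ (1 / 2 : ℝ)) *
              ((∫⁻ x, ‖ψ x‖ₑ ^ 2) ^ (1 / 2 : ℝ) *
          (∫⁻ x, (ENNReal.ofReal (m x) * ‖φ x‖ₑ) ^ 2) ^ (1 / 2 : ℝ))) := by ring
          _ = _ := by rw [this]

end CalderonVaillancourt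

/-! ### Weighted Calderón-Vaillancourt estimate. -/

section WeightedBound

/-- The rescaling `(X, ξ) ↦ (X, 2πξ)` from Euclidean phase space. -/
noncomputable def phaseRescale (d : ℕ) : PhaseSpace d →L[ℝ] Space d × Space d :=
  ((ContinuousLinearMap.fst ℝ (Space d) (Space d)).prod
    ((2 * Real.pi) • ContinuousLinearMap.snd ℝ (Space d) (Space d))).comp
    (WithLp.prodContinuousLinearEquiv 2 ℝ (Space d) (Space d)).toContinuousLinearMap

lemma phaseRescale_apply {d : ℕ} (v : PhaseSpace d) :
    phaseRescale d v = (v.fst, (2 * Real.pi) • v.snd) := rfl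

lemma norm_phaseRescale_le (d : ℕ) : ‖phaseRescale d‖ ≤ 2 * Real.pi := by
  have h1 : 1 ≤ 2 * Real.pi := by linarith [Real.pi_gt_three]
  refine ContinuousLinearMap.opNorm_le_bound _ (by positivity) fun v => ?_
  rw [phaseRescale_apply, Prod.norm_def]
  refine max_le ?_ ?_
  · have := WithLp.norm_fst_le _ v
    dsimp only
    nlinarith [norm_nonneg v]
  · dsimp only
    rw [norm_smul, Real.norm_eq_abs, abs_of_nonneg (by positivity)]
    exact mul_le_mul_of_nonneg_left (WithLp.norm_snd_le _ v) (by positivity)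

lemma continuous_fourier {V : Type*} [NormedAddCommGroup V] [InnerProductSpace ℝ V]
    [FiniteDimensional ℝ V] [MeasurableSpace V] [BorelSpace V] {f : V → ℂ} (hf : Integrable f) :
    Continuous (FourierTransform.fourier f) :=
  VectorFourier.fourierIntegral_continuous Real.continuous_fourierChar
    (by exact continuous_inner) hf

/-- Weighted Calderón-Vaillancourt bound for the Weyl form. -/
theorem exists_weylForm_bound (d : ℕ) :
    ∃ C : ℝ, 0 ≤ C ∧ ∀ (b : Space d → Space d → ℝ) (m : Space d → ℝ) (B : ℝ),
      ContDiff ℝ ∞ (Function.uncurry b) → (∀ x ξ, |b x ξ| ≤ B) → Continuous m →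
      (∀ x y, m (x + y) ≤ m x * (1 + ‖y‖)) →
      (∀ n ≤ 2 * d + 2, ∀ z : Space d × Space d,
        ‖iteratedFDeriv ℝ n (Function.uncurry b) z‖ ≤ m z.1) →
      ∀ ψ φ : 𝓢(Space d, ℂ), ‖weylForm b ψ φ‖ₑ ≤ ENNReal.ofReal C *
        ((∫⁻ x, ‖ψ x‖ₑ ^ 2) ^ (1 / 2 : ℝ) *
          (∫⁻ x, (ENNReal.ofReal (m x) * ‖φ x‖ₑ) ^ 2) ^ (1 / 2 : ℝ)) := by
  set N := 2 * d + 2 with hN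
  obtain ⟨C1, hC1, hloc⟩ := exists_norm_fourier_localSymbol_le (PhaseSpace d) N
  set c4 := ∫ v : PhaseSpace d, gauss (2 * (2 * Real.pi)) v
  have hc4 : 0 < c4 := integral_gauss_pos (by positivity)
  set c := ∫ η : Space d, gauss (2 * Real.pi) η
  have hc : 0 < c := integral_gauss_pos (by positivity)
  have hIint : Integrable (fun t : Space d => (1 + ‖t‖) ^ 2 * gauss (2 * Real.pi) t) :=
    integrable_pow_mul_gauss (by positivity) 2
  set I := ∫ t : Space d, (1 + ‖t‖) ^ 2 * gauss (2 * Real.pi) t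
  have hI0 : 0 ≤ I := integral_nonneg fun t => mul_nonneg (by positivity) (gauss_pos _ _).le
  have hIe : ∫⁻ t : Space d, ENNReal.ofReal ((1 + ‖t‖) ^ 2 * gauss (2 * Real.pi) t) =
      ENNReal.ofReal I :=
    (ofReal_integral_eq_lintegral_ofReal hIint
      (ae_of_all _ fun t => mul_nonneg (by positivity) (gauss_pos _ _).le)).symm
  -- One of the N = 2d + 2 orders of decay pays for moving the weight; the remaining 2d + 1 still
  -- exceed the dimension 2d of phase space.
  have hfin : (Module.finrank ℝ (PhaseSpace d) : ℝ) < ((N - 1 : ℕ) : ℝ) := by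
    rw [finrank_phaseSpace]; exact_mod_cast (by omega)
  have hJint : Integrable (fun ζ : PhaseSpace d => (1 + ‖ζ‖) ^ (-((N - 1 : ℕ) : ℝ))) :=
    integrable_one_add_norm hfin
  set J := ∫ ζ : PhaseSpace d, (1 + ‖ζ‖) ^ (-((N - 1 : ℕ) : ℝ))
  have hJ0 : 0 ≤ J := integral_nonneg fun ζ => by positivity
  have hJe : ∫⁻ ζ : PhaseSpace d, ENNReal.ofReal ((1 + ‖ζ‖) ^ (-((N - 1 : ℕ) : ℝ))) =
      ENNReal.ofReal J :=
    (ofReal_integral_eq_lintegral_ofReal hJint (ae_of_all _ fun ζ => by positivity)).symm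
  set C2 := C1 * (2 * Real.pi) ^ N
  have hC2 : 0 ≤ C2 := by positivity
  refine ⟨c4⁻¹ * (C2 * c * (J * I)), by positivity,
    fun b m B hb hB hm hm1 hbm ψ φ => ?_⟩
  have hm0 : ∀ x, 0 ≤ m x := fun x => (norm_nonneg _).trans (hbm 0 (by omega) (x, 0))
  set bV : PhaseSpace d → ℝ := fun v => Function.uncurry b (phaseRescale d v) with hbV
  have hbVs : ContDiff ℝ ∞ bV := hb.comp (phaseRescale d).contDiff
  have hbVB : ∀ v, |bV v| ≤ B := fun v => hB _ _
  have hder : ∀ z : PhaseSpace d, ∀ n ≤ N, ∀ Y : PhaseSpace d,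
      ‖iteratedFDeriv ℝ n bV (Y + z)‖ ≤ (2 * Real.pi) ^ N * m z.fst * (1 + ‖Y‖) := by
    intro z n hn Y
    have h1 := norm_iteratedFDeriv_comp_affine_le hb (phaseRescale d) 0 n (Y + z)
    simp only [add_zero] at h1
    refine h1.trans ?_
    have h2 := hbm n hn (phaseRescale d (Y + z))
    have h3 : m (phaseRescale d (Y + z)).1 ≤ m z.fst * (1 + ‖Y‖) := by
      have := hm1 z.fst Y.fst
      have h4 : (phaseRescale d (Y + z)).1 = z.fst + Y.fst := by
        rw [phaseRescale_apply, WithLp.add_fst, add_comm]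
      rw [h4]
      refine this.trans (mul_le_mul_of_nonneg_left ?_ (hm0 _))
      linarith [WithLp.norm_fst_le _ Y]
    have h2pi : 1 ≤ 2 * Real.pi := by linarith [Real.pi_gt_three]
    calc _ ≤ (m z.fst * (1 + ‖Y‖)) * (2 * Real.pi) ^ N := by
          refine mul_le_mul (h2.trans h3) ?_ (by positivity)
            (mul_nonneg (hm0 _) (by positivity))
          exact (pow_le_pow_left₀ (norm_nonneg _) (norm_phaseRescale_le d) n).trans
            (pow_le_pow_right₀ h2pi hn)
      _ = _ := by ring
  have hli := fun z => (hloc bV _ z hbVs (hder z)).1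
  have hdec : ∀ z ζ : PhaseSpace d, ‖FourierTransform.fourier (localSymbol bV z) ζ‖ ≤
      C2 * m z.fst * ((1 + ‖ζ‖) ^ N)⁻¹ := by
    intro z ζ
    have := (hloc bV _ z hbVs (hder z)).2 ζ
    rw [← div_eq_mul_inv, le_div_iff₀ (by positivity)]
    refine this.trans (le_of_eq ?_)
    simp only [C2]; ring
  have hFi : ∀ z, Integrable (FourierTransform.fourier (localSymbol bV z)) := by
    intro z
    have hj : Integrable (fun ζ : PhaseSpace d => (1 + ‖ζ‖) ^ (-(N : ℝ))) :=
      integrable_one_add_norm (by rw [finrank_phaseSpace]; exact_mod_cast (by omega))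
    refine (hj.const_mul (C2 * m z.fst)).mono'
      (continuous_fourier (hli z)).aestronglyMeasurable (ae_of_all _ fun ζ => ?_)
    rw [Real.rpow_neg (by positivity), Real.rpow_natCast]
    exact hdec z ζ
  have hmain := integral_symbol_wignerV_le hbVs hbVB hli hFi ψ φ
  have hW : ∫ v : PhaseSpace d, (bV v : ℂ) * wignerV ψ φ v = weylForm b ψ φ := by
    rw [weylForm_eq_integral_wigner hb.continuous hB]
    exact integral_phaseSpace (fun z : Space d × Space d =>
      (b z.1 ((2 * Real.pi) • z.2) : ℂ) * wigner ψ φ z)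
  rw [hW] at hmain
  set S := (∫⁻ x, ‖ψ x‖ₑ ^ 2) ^ (1 / 2 : ℝ) *
          (∫⁻ x, (ENNReal.ofReal (m x) * ‖φ x‖ₑ) ^ 2) ^ (1 / 2 : ℝ)
  have hA : Measurable (fun w : PhaseSpace d × PhaseSpace d =>
      ‖wavePacket ψ (w.1.fst - (1 / 2 : ℝ) • w.2.snd) (w.1.snd + (1 / 2 : ℝ) • w.2.fst)‖ₑ) :=
    ((measurable_wavePacket ψ).comp (by fun_prop : Measurable fun w : PhaseSpace d × PhaseSpace d =>
      (w.1.fst - (1 / 2 : ℝ) • w.2.snd, w.1.snd + (1 / 2 : ℝ) • w.2.fst))).enorm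
  have hB' : Measurable (fun w : PhaseSpace d × PhaseSpace d =>
      ‖wavePacket φ (w.1.fst + (1 / 2 : ℝ) • w.2.snd) (w.1.snd - (1 / 2 : ℝ) • w.2.fst)‖ₑ) :=
    ((measurable_wavePacket φ).comp (by fun_prop : Measurable fun w : PhaseSpace d × PhaseSpace d =>
      (w.1.fst + (1 / 2 : ℝ) • w.2.snd, w.1.snd - (1 / 2 : ℝ) • w.2.fst))).enorm
  have hmm : Measurable (fun w : PhaseSpace d × PhaseSpace d => ENNReal.ofReal (m w.1.fst)) :=
    (hm.measurable.comp (by fun_prop)).ennreal_ofReal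
  have hpt : ∀ z ζ : PhaseSpace d, ‖FourierTransform.fourier (localSymbol bV z) ζ‖ₑ *
        (ENNReal.ofReal c *
        (‖wavePacket ψ (z.fst - (1 / 2 : ℝ) • ζ.snd) (z.snd + (1 / 2 : ℝ) • ζ.fst)‖ₑ *
          ‖wavePacket φ (z.fst + (1 / 2 : ℝ) • ζ.snd) (z.snd - (1 / 2 : ℝ) • ζ.fst)‖ₑ)) ≤
      (ENNReal.ofReal (C2 * c) * ENNReal.ofReal ((1 + ‖ζ‖) ^ N)⁻¹) *
        (ENNReal.ofReal (m z.fst) *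
        (‖wavePacket ψ (z.fst - (1 / 2 : ℝ) • ζ.snd) (z.snd + (1 / 2 : ℝ) • ζ.fst)‖ₑ *
          ‖wavePacket φ (z.fst + (1 / 2 : ℝ) • ζ.snd) (z.snd - (1 / 2 : ℝ) • ζ.fst)‖ₑ)) := by
    intro z ζ
    have h1 : ‖FourierTransform.fourier (localSymbol bV z) ζ‖ₑ ≤
        ENNReal.ofReal C2 * ENNReal.ofReal (m z.fst) * ENNReal.ofReal ((1 + ‖ζ‖) ^ N)⁻¹ := by
      rw [← ofReal_norm, ← ENNReal.ofReal_mul hC2,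
        ← ENNReal.ofReal_mul (mul_nonneg hC2 (hm0 _))]
      exact ENNReal.ofReal_le_ofReal (hdec z ζ)
    rw [ENNReal.ofReal_mul hC2]
    refine (mul_le_mul_left h1 _).trans (le_of_eq ?_)
    ring
  have hcalc : ENNReal.ofReal c4 * ‖weylForm b ψ φ‖ₑ ≤
      ENNReal.ofReal (C2 * c * (J * I)) * S := by
    refine hmain.trans ?_
    refine (lintegral_mono fun z => lintegral_mono fun ζ => hpt z ζ).trans ?_
    rw [lintegral_lintegral_swap (by
      refine Measurable.aemeasurable ?_
      unfold Function.uncurry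
      have hq : Measurable fun w : PhaseSpace d × PhaseSpace d =>
          ENNReal.ofReal ((1 + ‖w.2‖) ^ N)⁻¹ := by fun_prop
      exact ((measurable_const.mul hq).mul (hmm.mul (hA.mul hB'))))]
    calc _ ≤ ∫⁻ ζ : PhaseSpace d, (ENNReal.ofReal (C2 * c) * ENNReal.ofReal ((1 + ‖ζ‖) ^ N)⁻¹) *
          (ENNReal.ofReal (1 + ‖ζ‖) * (ENNReal.ofReal I * S)) := by
          refine lintegral_mono fun ζ => ?_
          rw [lintegral_const_mul' _ _ (ENNReal.mul_ne_top ENNReal.ofReal_ne_top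
            ENNReal.ofReal_ne_top)]
          refine mul_le_mul_right ?_ _
          have := lintegral_wavePacket_mul_le hm hm0 hm1 ψ φ ζ
          rwa [hIe] at this
      _ = ∫⁻ ζ : PhaseSpace d, ENNReal.ofReal ((1 + ‖ζ‖) ^ (-((N - 1 : ℕ) : ℝ))) *
          (ENNReal.ofReal (C2 * c) * (ENNReal.ofReal I * S)) := by
          refine lintegral_congr fun ζ => ?_
          have h5 : ENNReal.ofReal ((1 + ‖ζ‖) ^ N)⁻¹ * ENNReal.ofReal (1 + ‖ζ‖) =
              ENNReal.ofReal ((1 + ‖ζ‖) ^ (-((N - 1 : ℕ) : ℝ))) := by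
            rw [← ENNReal.ofReal_mul (by positivity), Real.rpow_neg (by positivity),
              Real.rpow_natCast]
            congr 1
            have : N = (N - 1) + 1 := by omega
            have hne : (1 + ‖ζ‖) ≠ 0 := by positivity
            conv_lhs => rw [this, pow_succ]
            field_simp
          rw [← h5]; ring
      _ = ENNReal.ofReal J * (ENNReal.ofReal (C2 * c) * (ENNReal.ofReal I * S)) := by
          rw [lintegral_mul_const _ (by fun_prop), hJe]
      _ = _ := by
          rw [ENNReal.ofReal_mul (by positivity : 0 ≤ C2 * c), ENNReal.ofReal_mul hJ0]
          ring
  have hc4e : ENNReal.ofReal c4⁻¹ * ENNReal.ofReal c4 = 1 := by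
    rw [← ENNReal.ofReal_mul (by positivity), inv_mul_cancel₀ hc4.ne', ENNReal.ofReal_one]
  calc ‖weylForm b ψ φ‖ₑ = ENNReal.ofReal c4⁻¹ * (ENNReal.ofReal c4 * ‖weylForm b ψ φ‖ₑ) := by
        rw [← mul_assoc, hc4e, one_mul]
    _ ≤ ENNReal.ofReal c4⁻¹ * (ENNReal.ofReal (C2 * c * (J * I)) * S) := by gcongr
    _ = _ := by
        rw [← mul_assoc, ← ENNReal.ofReal_mul (inv_nonneg.2 hc4.le)]

end WeightedBound

/-! ### Existence and self-adjointness of Weyl operators. -/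

section WeylOperator

variable {d : ℕ}

/-- The class in `L²` of a Schwartz function. -/
noncomputable abbrev toL2 (φ : 𝓢(Space d, ℂ)) : L2Space d := φ.toLp 2 volume

lemma enorm_L2_eq (f : L2Space d) : ‖f‖ₑ = (∫⁻ x, ‖f x‖ₑ ^ 2) ^ (1 / 2 : ℝ) := by
  rw [Lp.enorm_def, eLpNorm_eq_lintegral_rpow_enorm_toReal (by norm_num) (by norm_num)]
  simp

lemma enorm_sq_L2_eq (f : L2Space d) : ‖f‖ₑ ^ 2 = ∫⁻ x, ‖f x‖ₑ ^ 2 := by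
  rw [enorm_L2_eq, ← ENNReal.rpow_natCast, ← ENNReal.rpow_mul]
  norm_num

lemma lintegral_enorm_sq_toL2 (φ : 𝓢(Space d, ℂ)) :
    ∫⁻ x, ‖(toL2 φ) x‖ₑ ^ 2 = ∫⁻ x, ‖φ x‖ₑ ^ 2 := by
  refine lintegral_congr_ae ?_
  filter_upwards [φ.coeFn_toLp 2 volume] with x hx
  rw [hx]

lemma enorm_toL2_eq (φ : 𝓢(Space d, ℂ)) : ‖toL2 φ‖ₑ = (∫⁻ x, ‖φ x‖ₑ ^ 2) ^ (1 / 2 : ℝ) := by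
  rw [enorm_L2_eq, lintegral_enorm_sq_toL2]

lemma denseRange_toL2 : DenseRange (toL2 : 𝓢(Space d, ℂ) → L2Space d) :=
  SchwartzMap.denseRange_toLpCLM (F := ℂ) (by norm_num)

lemma IsRealSymbol.exists_bound {b : Space d → Space d → ℝ} (hb : IsRealSymbol b) :
    ∃ B : ℝ, ∀ x ξ, |b x ξ| ≤ B := by
  obtain ⟨B, hB⟩ := hb.2 0
  refine ⟨B, fun x ξ => ?_⟩
  have := hB (x, ξ)
  rwa [norm_iteratedFDeriv_zero] at this

lemma IsRealSymbol.exists_bound_le {b : Space d → Space d → ℝ} (hb : IsRealSymbol b) (N : ℕ) :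
    ∃ B : ℝ, 0 ≤ B ∧ ∀ n ≤ N, ∀ z, ‖iteratedFDeriv ℝ n (Function.uncurry b) z‖ ≤ B := by
  choose B hB using hb.2
  refine ⟨∑ n ∈ Finset.range (N + 1), |B n|, Finset.sum_nonneg fun _ _ => abs_nonneg _,
    fun n hn z => (hB n z).trans ((le_abs_self _).trans ?_)⟩
  exact Finset.single_le_sum (f := fun n => |B n|) (fun _ _ => abs_nonneg _)
    (Finset.mem_range.2 (by omega))

lemma weylForm_add_right {b : Space d → Space d → ℝ} (hb : IsRealSymbol b)
    (ψ φ₁ φ₂ : 𝓢(Space d, ℂ)) :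
    weylForm b ψ (φ₁ + φ₂) = weylForm b ψ φ₁ + weylForm b ψ φ₂ := by
  obtain ⟨B, hB⟩ := hb.exists_bound
  have hc : Continuous (fun z : Space d × Space d => (b z.1 ((2 * Real.pi) • z.2) : ℂ)) := by
    have : Continuous (fun z : Space d × Space d => b z.1 ((2 * Real.pi) • z.2)) :=
      hb.1.continuous.comp
        (by fun_prop : Continuous fun z : Space d × Space d => (z.1, (2 * Real.pi) • z.2))
    exact Complex.continuous_ofReal.comp this
  have hbd : ∀ z : Space d × Space d, ‖(b z.1 ((2 * Real.pi) • z.2) : ℂ)‖ ≤ B := fun z => by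
    rw [Complex.norm_real]; exact hB _ _
  simp only [weylForm_eq_integral_wigner hb.1.continuous hB]
  rw [← integral_add (integrable_bounded_mul_wigner hc hbd ψ φ₁)
    (integrable_bounded_mul_wigner hc hbd ψ φ₂)]
  refine integral_congr_ae (ae_of_all _ fun z => ?_)
  dsimp only
  rw [← mul_add]
  congr 1
  unfold wigner
  have hi : ∀ φ : 𝓢(Space d, ℂ), Integrable fun r : Space d =>
      phase (inner ℝ z.2 r) * pairKernel ψ φ z.1 r := fun φ =>
    (integrable_pairKernel_right ψ φ z.1).bdd_mul (c := 1)
      (Continuous.aestronglyMeasurable (by fun_prop)) (ae_of_all _ fun r => (norm_phase _).le)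
  rw [← integral_add (hi φ₁) (hi φ₂)]
  refine integral_congr_ae (ae_of_all _ fun r => ?_)
  simp only [pairKernel, add_apply]
  ring

lemma weylForm_smul_right {b : Space d → Space d → ℝ} (hb : IsRealSymbol b) (c : ℂ)
    (ψ φ : 𝓢(Space d, ℂ)) : weylForm b ψ (c • φ) = c * weylForm b ψ φ := by
  obtain ⟨B, hB⟩ := hb.exists_bound
  simp only [weylForm_eq_integral_wigner hb.1.continuous hB]
  rw [← integral_const_mul]
  refine integral_congr_ae (ae_of_all _ fun z => ?_)
  dsimp only
  rw [mul_left_comm]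
  congr 1
  unfold wigner
  rw [← integral_const_mul]
  refine integral_congr_ae (ae_of_all _ fun r => ?_)
  simp only [pairKernel, smul_apply, smul_eq_mul]
  ring

/-- The weighted estimate with a constant weight bounds the form on Schwartz functions by the L²
norms; Riesz representation and density do the rest. -/
lemma IsRealSymbol.exists_isWeylQuantization {b : Space d → Space d → ℝ} (hb : IsRealSymbol b) :
    ∃ T : L2Space d →L[ℂ] L2Space d, IsWeylQuantization b T := by
  obtain ⟨C, hC, hbound⟩ := exists_weylForm_bound d
  obtain ⟨B, hB⟩ := hb.exists_bound
  obtain ⟨M, hM, hbM⟩ := hb.exists_bound_le (2 * d + 2)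
  have hform : ∀ ψ φ : 𝓢(Space d, ℂ), ‖weylForm b ψ φ‖ ≤ C * M * (‖toL2 ψ‖ * ‖toL2 φ‖) := by
    intro ψ φ
    have h := hbound b (fun _ => M) B hb.1 hB continuous_const
      (fun x y => le_mul_of_one_le_right hM (by linarith [norm_nonneg y]))
      (fun n hn z => hbM n hn z) ψ φ
    have e : (∫⁻ x, (ENNReal.ofReal M * ‖φ x‖ₑ) ^ 2) ^ (1 / 2 : ℝ) =
        ENNReal.ofReal M * ‖toL2 φ‖ₑ := by
      simp_rw [mul_pow]
      rw [lintegral_const_mul' _ _ (by simp), ENNReal.mul_rpow_of_nonneg _ _ (by norm_num),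
        ← enorm_toL2_eq, ← ENNReal.rpow_natCast, ← ENNReal.rpow_mul]
      norm_num
    rw [e, ← enorm_toL2_eq] at h
    simp only [← ofReal_norm] at h
    rw [← ENNReal.ofReal_mul hM, ← ENNReal.ofReal_mul (norm_nonneg _), ← ENNReal.ofReal_mul hC,
      ENNReal.ofReal_le_ofReal_iff (by positivity)] at h
    linarith
  let e : 𝓢(Space d, ℂ) →ₗ[ℂ] L2Space d :=
    (SchwartzMap.toLpCLM ℂ ℂ 2 (volume : Measure (Space d))).toLinearMap
  have he : ∀ φ, e φ = toL2 φ := fun φ => rfl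
  have hde : DenseRange e := denseRange_toL2
  let ℓ : 𝓢(Space d, ℂ) → (𝓢(Space d, ℂ) →ₗ[ℂ] ℂ) := fun φ =>
    { toFun := fun ψ => weylForm b φ ψ
      map_add' := fun ψ₁ ψ₂ => weylForm_add_right hb φ ψ₁ ψ₂
      map_smul' := fun c ψ => weylForm_smul_right hb c φ ψ }
  have hℓ : ∀ φ, ∀ ψ, ‖ℓ φ ψ‖ ≤ C * M * ‖toL2 φ‖ * ‖e ψ‖ := fun φ ψ =>
    (hform φ ψ).trans (le_of_eq (by rw [he]; ring))
  -- The form is linear in its second slot, so Riesz is applied there, with φ in the first slot;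
  -- Hermitian symmetry of the form puts φ back into the second.
  let v : 𝓢(Space d, ℂ) → L2Space d := fun φ =>
    (InnerProductSpace.toDual ℂ (L2Space d)).symm ((ℓ φ).extendOfNorm e)
  have hv : ∀ φ ψ, inner ℂ (toL2 ψ) (v φ) = weylForm b ψ φ := by
    intro φ ψ
    rw [← inner_conj_symm, InnerProductSpace.toDual_symm_apply, ← he,
      LinearMap.extendOfNorm_eq hde ⟨_, hℓ φ⟩]
    exact weylForm_conj hb.1.continuous hB φ ψ
  have hext : ∀ f g : L2Space d, (∀ ψ : 𝓢(Space d, ℂ), inner ℂ (toL2 ψ) f = inner ℂ (toL2 ψ) g) →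
      f = g := by
    intro f g h
    have : (fun u : L2Space d => inner ℂ u f) = fun u => inner ℂ u g :=
      denseRange_toL2.equalizer (by fun_prop) (by fun_prop) (funext h)
    exact ext_inner_left ℂ fun u => congrFun this u
  let K : 𝓢(Space d, ℂ) →ₗ[ℂ] L2Space d :=
    { toFun := v
      map_add' := fun φ₁ φ₂ => hext _ _ fun ψ => by
        rw [inner_add_right, hv, hv, hv, weylForm_add_right hb]
      map_smul' := fun c φ => hext _ _ fun ψ => by
        rw [RingHom.id_apply, inner_smul_right, hv, hv, weylForm_smul_right hb] }
  have hK : ∀ φ, ‖K φ‖ ≤ C * M * ‖e φ‖ := by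
    intro φ
    change ‖(InnerProductSpace.toDual ℂ (L2Space d)).symm ((ℓ φ).extendOfNorm e)‖ ≤ _
    rw [LinearIsometryEquiv.norm_map]
    exact LinearMap.opNorm_extendOfNorm_le hde (by positivity) (hℓ φ)
  refine ⟨K.extendOfNorm e, fun ψ φ => ?_⟩
  rw [← hv φ ψ]
  congr 1
  exact LinearMap.extendOfNorm_eq hde ⟨_, hK⟩ φ

lemma IsRealSymbol.isWeylQuantization {b : Space d → Space d → ℝ} (hb : IsRealSymbol b) :
    IsWeylQuantization b (weylOp b) := by
  have h := hb.exists_isWeylQuantization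
  unfold weylOp
  rw [dif_pos h]
  exact h.choose_spec

lemma IsRealSymbol.inner_weylOp {b : Space d → Space d → ℝ} (hb : IsRealSymbol b)
    (ψ φ : 𝓢(Space d, ℂ)) : inner ℂ (toL2 ψ) (weylOp b (toL2 φ)) = weylForm b ψ φ :=
  hb.isWeylQuantization ψ φ

/-- The form of a real symbol is Hermitian, so the adjoint quantizes the same symbol, and
quantizations are unique. -/
lemma IsRealSymbol.isSelfAdjoint {b : Space d → Space d → ℝ} (hb : IsRealSymbol b) :
    IsSelfAdjoint (weylOp b) := by
  have : IsWeylQuantization b (ContinuousLinearMap.adjoint (weylOp b)) := by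
    intro ψ φ
    obtain ⟨B, hB⟩ := hb.exists_bound
    rw [ContinuousLinearMap.adjoint_inner_right, ← inner_conj_symm, hb.inner_weylOp,
      weylForm_conj hb.1.continuous hB]
  rw [ContinuousLinearMap.isSelfAdjoint_iff']
  exact this.unique hb.isWeylQuantization

lemma norm_le_of_forall_inner_toL2_le {f : L2Space d} {K : ℝ} (hK : 0 ≤ K)
    (h : ∀ ψ : 𝓢(Space d, ℂ), ‖inner ℂ (toL2 ψ) f‖ ≤ K * ‖toL2 ψ‖) : ‖f‖ ≤ K := by
  have h2 : ∀ u : L2Space d, ‖inner ℂ u f‖ ≤ K * ‖u‖ := fun u =>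
    denseRange_toL2.induction_on (p := fun u => ‖inner ℂ u f‖ ≤ K * ‖u‖) u
      (isClosed_le (by fun_prop) (by fun_prop)) h
  have h3 := h2 f
  rcases eq_or_ne f 0 with rfl | hf
  · simpa using hK
  · rw [inner_self_eq_norm_sq_to_K] at h3
    simp only [Complex.coe_algebraMap, norm_pow, Complex.norm_real, norm_norm] at h3
    have : 0 < ‖f‖ := norm_pos_iff.2 hf
    nlinarith

end WeylOperator

/-! ### Multiplication operators, Gaussian windows and the localisation isometry. -/

section Multiplication

variable {d : ℕ}

lemma enorm_bcf_mul_le (g : BoundedContinuousFunction (Space d) ℂ) (f : L2Space d) :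
    ∀ᵐ x, ‖g x * f x‖ ≤ ‖g‖ * ‖f x‖ :=
  ae_of_all _ fun x => by
    rw [norm_mul]
    exact mul_le_mul_of_nonneg_right (g.norm_coe_le_norm x) (norm_nonneg _)

lemma memLp_bcf_mul (g : BoundedContinuousFunction (Space d) ℂ) (f : L2Space d) :
    MemLp (fun x => g x * f x) 2 volume :=
  (Lp.memLp f).of_le_mul (g.continuous.aestronglyMeasurable.mul (Lp.aestronglyMeasurable f))
    (enorm_bcf_mul_le g f)

/-- Multiplication by a bounded continuous function, as an operator on `L²`. -/
noncomputable def mulOp (g : BoundedContinuousFunction (Space d) ℂ) :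
    L2Space d →L[ℂ] L2Space d :=
  LinearMap.mkContinuous
    { toFun := fun f => (memLp_bcf_mul g f).toLp _
      map_add' := fun f₁ f₂ => by
        rw [← MemLp.toLp_add]
        refine MemLp.toLp_congr _ _ ?_
        filter_upwards [Lp.coeFn_add f₁ f₂] with x hx
        simp only [hx, Pi.add_apply]
        ring
      map_smul' := fun c f => by
        rw [RingHom.id_apply, ← MemLp.toLp_const_smul]
        refine MemLp.toLp_congr _ _ ?_
        filter_upwards [Lp.coeFn_smul c f] with x hx
        simp only [hx, Pi.smul_apply, smul_eq_mul]
        ring } ‖g‖ fun f => by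
    refine Lp.norm_le_mul_norm_of_ae_le_mul ?_
    filter_upwards [MemLp.coeFn_toLp (memLp_bcf_mul g f), enorm_bcf_mul_le g f] with x hx h
    change ‖((memLp_bcf_mul g f).toLp _ : L2Space d) x‖ ≤ _
    rw [hx]; exact h

lemma coeFn_mulOp (g : BoundedContinuousFunction (Space d) ℂ) (f : L2Space d) :
    ∀ᵐ x, mulOp g f x = g x * f x :=
  MemLp.coeFn_toLp (memLp_bcf_mul g f)

lemma mulOp_toL2 (g : BoundedContinuousFunction (Space d) ℂ) (φ φ' : 𝓢(Space d, ℂ))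
    (h : ∀ x, φ' x = g x * φ x) : mulOp g (toL2 φ) = toL2 φ' := by
  refine Lp.ext ?_
  filter_upwards [coeFn_mulOp g (toL2 φ), φ.coeFn_toLp 2 volume, φ'.coeFn_toLp 2 volume]
    with x h1 h2 h3
  rw [h1, h2, h3, h]

lemma inner_mulOp (g g' : BoundedContinuousFunction (Space d) ℂ) (h : ∀ x, g' x = conj (g x))
    (f₁ f₂ : L2Space d) : inner ℂ f₁ (mulOp g f₂) = inner ℂ (mulOp g' f₁) f₂ := by
  rw [L2.inner_def, L2.inner_def]
  refine integral_congr_ae ?_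
  filter_upwards [coeFn_mulOp g f₂, coeFn_mulOp g' f₁] with x h1 h2
  rw [h1, h2, h, RCLike.inner_apply, RCLike.inner_apply, map_mul, Complex.conj_conj]
  ring

/-- Dominated convergence gives strong continuity from pointwise continuity of the multipliers; it
supplies the measurability in s and η needed below. -/
lemma continuous_mulOp {S : Type*} [TopologicalSpace S] [FirstCountableTopology S]
    (g : S → BoundedContinuousFunction (Space d) ℂ) {B : ℝ} (hB : ∀ s, ‖g s‖ ≤ B)
    (hg : ∀ x, Continuous fun s => g s x) (f : L2Space d) : Continuous fun s => mulOp (g s) f := by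
  rw [continuous_iff_continuousAt]
  intro s₀
  unfold ContinuousAt
  rw [tendsto_iff_edist_tendsto_0]
  have he : ∀ s, edist (mulOp (g s) f) (mulOp (g s₀) f) =
      (∫⁻ x, (‖g s x - g s₀ x‖ₑ * ‖f x‖ₑ) ^ 2) ^ (1 / 2 : ℝ) := by
    intro s
    rw [edist_eq_enorm_sub, enorm_L2_eq]
    congr 1
    refine lintegral_congr_ae ?_
    filter_upwards [Lp.coeFn_sub (mulOp (g s) f) (mulOp (g s₀) f), coeFn_mulOp (g s) f,
      coeFn_mulOp (g s₀) f] with x h1 h2 h3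
    rw [h1, Pi.sub_apply, h2, h3, ← sub_mul, enorm_mul]
  simp_rw [he]
  have hl : Filter.Tendsto (fun s => ∫⁻ x, (‖g s x - g s₀ x‖ₑ * ‖f x‖ₑ) ^ 2) (nhds s₀)
      (nhds (∫⁻ x : Space d, 0)) := by
    refine tendsto_lintegral_filter_of_dominated_convergence
      (fun x => (ENNReal.ofReal (2 * B) * ‖f x‖ₑ) ^ 2) ?_ ?_ ?_ ?_
    · refine Filter.Eventually.of_forall fun s => ?_
      have h1 : Measurable fun x => ‖g s x - g s₀ x‖ₑ :=
        ((g s).continuous.sub (g s₀).continuous).measurable.enorm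
      have h2 : Measurable fun x => ‖f x‖ₑ := (Lp.stronglyMeasurable f).measurable.enorm
      exact (h1.mul h2).pow_const 2
    · refine Filter.Eventually.of_forall fun s => ae_of_all _ fun x => ?_
      gcongr
      rw [← ofReal_norm]
      refine ENNReal.ofReal_le_ofReal ((norm_sub_le _ _).trans ?_)
      linarith [(g s).norm_coe_le_norm x, (g s₀).norm_coe_le_norm x, hB s, hB s₀]
    · simp_rw [mul_pow]
      rw [lintegral_const_mul' _ _ (by finiteness), ← enorm_sq_L2_eq]
      finiteness
    · refine ae_of_all _ fun x => ?_
      have h1 : Filter.Tendsto (fun s => ‖g s x - g s₀ x‖ₑ) (nhds s₀) (nhds 0) := by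
        have : Filter.Tendsto (fun s => ‖g s x - g s₀ x‖ₑ) (nhds s₀) (nhds ‖g s₀ x - g s₀ x‖ₑ) :=
          (((hg x).sub continuous_const).enorm).continuousAt
        simpa using this
      have h2 := ENNReal.Tendsto.mul_const (b := ‖f x‖ₑ) h1 (Or.inr enorm_ne_top)
      have h3 := ((ENNReal.continuous_pow 2).tendsto _).comp h2
      simpa [Function.comp_def] using h3
  rw [lintegral_zero] at hl
  have h4 := hl.ennrpow_const (1 / 2 : ℝ)
  rwa [ENNReal.zero_rpow_of_pos (by norm_num)] at h4

/-- The character `x ↦ exp (2πi ⟨k, x⟩)` as a bounded continuous function. -/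
noncomputable def phaseFun (k : Space d) : BoundedContinuousFunction (Space d) ℂ :=
  BoundedContinuousFunction.ofNormedAddCommGroup (fun x => phase (inner ℝ k x)) (by fun_prop) 1
    fun x => (norm_phase _).le

@[simp] lemma phaseFun_apply (k x : Space d) : phaseFun k x = phase (inner ℝ k x) := rfl

lemma norm_phaseFun_le (k : Space d) : ‖phaseFun k‖ ≤ 1 :=
  BoundedContinuousFunction.norm_ofNormedAddCommGroup_le _ zero_le_one _

/-- The normalisation making the squares of the windows a partition of unity. -/
noncomputable def windowConst (d : ℕ) : ℝ := (√(∫ t : Space d, gauss (2 * Real.pi) t))⁻¹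

lemma windowConst_pos : 0 < windowConst d :=
  inv_pos.2 (Real.sqrt_pos.2 (integral_gauss_pos (by positivity)))

lemma windowConst_sq_mul :
    windowConst d ^ 2 * ∫ t : Space d, gauss (2 * Real.pi) t = 1 := by
  have h : 0 < ∫ t : Space d, gauss (2 * Real.pi) t := integral_gauss_pos (by positivity)
  rw [windowConst, inv_pow, Real.sq_sqrt h.le, inv_mul_cancel₀ h.ne']

/-- The Gaussian window of scale `κ⁻¹` centred at `κ⁻¹ s`. -/
noncomputable def window (κ : ℝ) (s : Space d) : BoundedContinuousFunction (Space d) ℂ :=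
  BoundedContinuousFunction.ofNormedAddCommGroup
    (fun x => ((windowConst d * gauss Real.pi (κ • x - s) : ℝ) : ℂ)) (by fun_prop) (windowConst d)
    fun x => by
      rw [Complex.norm_real, Real.norm_eq_abs,
        abs_of_pos (mul_pos windowConst_pos (gauss_pos _ _))]
      exact mul_le_of_le_one_right windowConst_pos.le (gauss_le_one Real.pi_pos.le _)

lemma window_apply (κ : ℝ) (s x : Space d) :
    window κ s x = ((windowConst d * gauss Real.pi (κ • x - s) : ℝ) : ℂ) := rfl

lemma norm_window_le (κ : ℝ) (s : Space d) : ‖window κ s‖ ≤ windowConst d :=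
  BoundedContinuousFunction.norm_ofNormedAddCommGroup_le _ windowConst_pos.le _

lemma gauss_sq (c : ℝ) (x : Space d) : gauss c x ^ 2 = gauss (2 * c) x := by
  unfold gauss
  rw [sq, ← Real.exp_add]; ring_nf

lemma enorm_window_sq (κ : ℝ) (s x : Space d) :
    ‖window κ s x‖ₑ ^ 2 =
      ENNReal.ofReal (windowConst d ^ 2) * ENNReal.ofReal (gauss (2 * Real.pi) (κ • x - s)) := by
  rw [window_apply, ← ofReal_norm, Complex.norm_real, Real.norm_eq_abs,
    abs_of_pos (mul_pos windowConst_pos (gauss_pos _ _)), ← ENNReal.ofReal_pow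
    (mul_nonneg windowConst_pos.le (gauss_pos _ _).le), mul_pow, gauss_sq, ENNReal.ofReal_mul
    (sq_nonneg _)]

/-- By Tonelli one substitutes t = κx - s at fixed x, which has unit Jacobian. No power of κ appears
because windows are indexed by κ times their centre. -/
lemma lintegral_window_mul (κ : ℝ) {h : Space d → ENNReal} (hh : Measurable h)
    {w : Space d → ENNReal} (hw : Measurable w) :
    ∫⁻ s : Space d, ∫⁻ x : Space d, w (κ • x - s) * ‖window κ s x‖ₑ ^ 2 * h x =
      (ENNReal.ofReal (windowConst d ^ 2) *
        ∫⁻ t : Space d, w t * ENNReal.ofReal (gauss (2 * Real.pi) t)) * ∫⁻ x, h x := by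
  simp_rw [enorm_window_sq]
  have hg : Measurable (gauss (2 * Real.pi) : Space d → ℝ) := (continuous_gauss _).measurable
  rw [lintegral_lintegral_swap (by
    refine Measurable.aemeasurable ?_
    unfold Function.uncurry
    fun_prop)]
  have : ∀ x : Space d, ∫⁻ s : Space d, w (κ • x - s) * (ENNReal.ofReal (windowConst d ^ 2) *
      ENNReal.ofReal (gauss (2 * Real.pi) (κ • x - s))) * h x =
      (ENNReal.ofReal (windowConst d ^ 2) *
        ∫⁻ t : Space d, w t * ENNReal.ofReal (gauss (2 * Real.pi) t)) * h x := by
    intro x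
    rw [lintegral_mul_const _ (by fun_prop)]
    congr 1
    rw [lintegral_sub_left_eq_self (fun t : Space d => w t *
      (ENNReal.ofReal (windowConst d ^ 2) * ENNReal.ofReal (gauss (2 * Real.pi) t))),
      ← lintegral_const_mul _ (by fun_prop)]
    congr 1; funext t; ring
  simp_rw [this]
  rw [lintegral_const_mul _ hh]

lemma lintegral_enorm_sq_mulOp_window (κ : ℝ) (f : L2Space d) :
    ∫⁻ s, ‖mulOp (window κ s) f‖ₑ ^ 2 = ‖f‖ₑ ^ 2 := by
  have h1 : ∀ s, ‖mulOp (window κ s) f‖ₑ ^ 2 =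
      ∫⁻ x, 1 * ‖window κ s x‖ₑ ^ 2 * ‖f x‖ₑ ^ 2 := by
    intro s
    rw [enorm_sq_L2_eq]
    refine lintegral_congr_ae ?_
    filter_upwards [coeFn_mulOp (window κ s) f] with x hx
    rw [hx, enorm_mul, mul_pow, one_mul]
  simp_rw [h1]
  have := lintegral_window_mul κ (h := fun x => ‖f x‖ₑ ^ 2)
    (((Lp.stronglyMeasurable f).measurable.enorm).pow_const 2) (w := fun _ => 1) measurable_const
  rw [this, enorm_sq_L2_eq]
  simp_rw [one_mul]
  rw [← ofReal_integral_eq_lintegral_ofReal (integrable_gauss (by positivity))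
    (ae_of_all _ fun t => (gauss_pos _ _).le), ← ENNReal.ofReal_mul (sq_nonneg _),
    windowConst_sq_mul, ENNReal.ofReal_one, one_mul]

lemma continuous_mulOp_window (κ : ℝ) (f : L2Space d) :
    Continuous fun s => mulOp (window κ s) f :=
  continuous_mulOp _ (norm_window_le κ) (fun x => by
    simp only [window_apply]
    fun_prop) f

lemma continuous_mulOp_phase (f : L2Space d) : Continuous fun k => mulOp (phaseFun k) f :=
  continuous_mulOp _ norm_phaseFun_le (fun x => by
    simp only [phaseFun_apply]
    fun_prop) f

lemma memLp_two_of_lintegral_enorm_sq {H : Type*} [NormedAddCommGroup H] {f : Space d → H}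
    (hf : AEStronglyMeasurable f) (h : ∫⁻ s, ‖f s‖ₑ ^ 2 ≠ ⊤) : MemLp f 2 := by
  refine ⟨hf, ?_⟩
  rw [eLpNorm_eq_lintegral_rpow_enorm_toReal (by norm_num) (by norm_num)]
  simp only [ENNReal.toReal_ofNat, ENNReal.rpow_ofNat]
  exact ENNReal.rpow_lt_top_of_nonneg (by norm_num) h

lemma enorm_sq_toLp_two {H : Type*} [NormedAddCommGroup H] {f : Space d → H} (hf : MemLp f 2) :
    ‖hf.toLp f‖ₑ ^ 2 = ∫⁻ s, ‖f s‖ₑ ^ 2 := by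
  rw [Lp.enorm_toLp, eLpNorm_eq_lintegral_rpow_enorm_toReal (by norm_num) (by norm_num),
    ← ENNReal.rpow_natCast, ← ENNReal.rpow_mul]
  norm_num

lemma memLp_mulOp_window (κ : ℝ) (f : L2Space d) :
    MemLp (fun s => mulOp (window κ s) f) 2 volume :=
  memLp_two_of_lintegral_enorm_sq (continuous_mulOp_window κ f).aestronglyMeasurable
    (by rw [lintegral_enorm_sq_mulOp_window]; finiteness)

/-- Localisation to Gaussian windows, as an isometry of `L²` into the `L²`-valued `L²`
functions. -/
noncomputable def localize (κ : ℝ) :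
    L2Space d →ₗᵢ[ℂ] Lp (L2Space d) 2 (volume : Measure (Space d)) where
  toFun f := (memLp_mulOp_window κ f).toLp _
  map_add' f₁ f₂ := by
    rw [← MemLp.toLp_add]
    refine MemLp.toLp_congr _ _ (ae_of_all _ fun s => ?_)
    simp
  map_smul' c f := by
    rw [RingHom.id_apply, ← MemLp.toLp_const_smul]
    refine MemLp.toLp_congr _ _ (ae_of_all _ fun s => ?_)
    simp
  norm_map' f := by
    have h : ‖(memLp_mulOp_window κ f).toLp _‖ₑ ^ 2 = ‖f‖ₑ ^ 2 := by
      rw [enorm_sq_toLp_two, lintegral_enorm_sq_mulOp_window]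
    have h2 := congrArg ENNReal.toReal h
    simp only [ENNReal.toReal_pow, toReal_enorm] at h2
    exact (pow_left_inj₀ (norm_nonneg _) (norm_nonneg _) two_ne_zero).1 h2

end Multiplication

/-! ### Operator norm bounds and differences of symbols. -/

section OperatorBounds

variable {d : ℕ}

lemma exists_enorm_weylOp_toL2_le (d : ℕ) : ∃ C : ℝ, 0 ≤ C ∧
    ∀ (b : Space d → Space d → ℝ) (m : Space d → ℝ), IsRealSymbol b → Continuous m →
      (∀ x y, m (x + y) ≤ m x * (1 + ‖y‖)) →
      (∀ n ≤ 2 * d + 2, ∀ z, ‖iteratedFDeriv ℝ n (Function.uncurry b) z‖ ≤ m z.1) →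
      ∀ φ : 𝓢(Space d, ℂ), ‖weylOp b (toL2 φ)‖ₑ ≤
        ENNReal.ofReal C * (∫⁻ x, (ENNReal.ofReal (m x) * ‖φ x‖ₑ) ^ 2) ^ (1 / 2 : ℝ) := by
  obtain ⟨C, hC, hbound⟩ := exists_weylForm_bound d
  refine ⟨C, hC, fun b m hb hm hm1 hbm φ => ?_⟩
  obtain ⟨B, hB⟩ := hb.exists_bound
  set S := (∫⁻ x, (ENNReal.ofReal (m x) * ‖φ x‖ₑ) ^ 2) ^ (1 / 2 : ℝ) with hS
  rcases eq_or_ne (ENNReal.ofReal C * S) ⊤ with h | h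
  · rw [h]; exact le_top
  rw [← ENNReal.ofReal_toReal h, ← ofReal_norm]
  refine ENNReal.ofReal_le_ofReal (norm_le_of_forall_inner_toL2_le ENNReal.toReal_nonneg ?_)
  intro ψ
  have h1 := hbound b m B hb.1 hB hm hm1 hbm ψ φ
  rw [← hS, ← enorm_toL2_eq, ← hb.inner_weylOp ψ φ, mul_left_comm, mul_comm ‖toL2 ψ‖ₑ,
    ← ENNReal.ofReal_toReal h, ← ofReal_norm, ← ofReal_norm,
    ← ENNReal.ofReal_mul ENNReal.toReal_nonneg, ENNReal.ofReal_le_ofReal_iff (by positivity)] at h1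
  exact h1

lemma norm_clm_le_of_toL2 (T : L2Space d →L[ℂ] L2Space d) {K : ℝ} (hK : 0 ≤ K)
    (h : ∀ φ : 𝓢(Space d, ℂ), ‖T (toL2 φ)‖ ≤ K * ‖toL2 φ‖) : ‖T‖ ≤ K := by
  refine ContinuousLinearMap.opNorm_le_bound _ hK fun f => ?_
  exact denseRange_toL2.induction_on (p := fun u => ‖T u‖ ≤ K * ‖u‖) f
    (isClosed_le (by fun_prop) (by fun_prop)) h

lemma exists_norm_weylOp_le (d : ℕ) : ∃ C : ℝ, 0 ≤ C ∧
    ∀ (b : Space d → Space d → ℝ) (M : ℝ), IsRealSymbol b → 0 ≤ M →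
      (∀ n ≤ 2 * d + 2, ∀ z, ‖iteratedFDeriv ℝ n (Function.uncurry b) z‖ ≤ M) →
      ‖weylOp b‖ ≤ C * M := by
  obtain ⟨C, hC, hbound⟩ := exists_enorm_weylOp_toL2_le d
  refine ⟨C, hC, fun b M hb hM hbM => norm_clm_le_of_toL2 _ (by positivity) fun φ => ?_⟩
  have h := hbound b (fun _ => M) hb continuous_const
    (fun x y => le_mul_of_one_le_right hM (by linarith [norm_nonneg y])) hbM φ
  have e : (∫⁻ x, (ENNReal.ofReal M * ‖φ x‖ₑ) ^ 2) ^ (1 / 2 : ℝ) =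
      ENNReal.ofReal M * ‖toL2 φ‖ₑ := by
    simp_rw [mul_pow]
    rw [lintegral_const_mul' _ _ (by simp), ENNReal.mul_rpow_of_nonneg _ _ (by norm_num),
      ← enorm_toL2_eq, ← ENNReal.rpow_natCast, ← ENNReal.rpow_mul]
    norm_num
  rw [e] at h
  simp only [← ofReal_norm] at h
  rw [← ENNReal.ofReal_mul hM, ← ENNReal.ofReal_mul hC,
    ENNReal.ofReal_le_ofReal_iff (by positivity)] at h
  linarith

lemma IsRealSymbol.sub {b₁ b₂ : Space d → Space d → ℝ} (h₁ : IsRealSymbol b₁)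
    (h₂ : IsRealSymbol b₂) : IsRealSymbol fun x ξ => b₁ x ξ - b₂ x ξ := by
  have e : Function.uncurry (fun x ξ => b₁ x ξ - b₂ x ξ) =
      Function.uncurry b₁ - Function.uncurry b₂ := rfl
  refine ⟨by rw [e]; exact h₁.1.sub h₂.1, fun n => ?_⟩
  obtain ⟨B₁, hB₁⟩ := h₁.2 n
  obtain ⟨B₂, hB₂⟩ := h₂.2 n
  refine ⟨B₁ + B₂, fun p => ?_⟩
  rw [e, iteratedFDeriv_sub_apply (h₁.1.contDiffAt.of_le (by exact_mod_cast le_top))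
    (h₂.1.contDiffAt.of_le (by exact_mod_cast le_top))]
  exact (norm_sub_le _ _).trans (add_le_add (hB₁ p) (hB₂ p))

lemma continuous_rescaled_symbol {b : Space d → Space d → ℝ} (hb : IsRealSymbol b) :
    Continuous (fun z : Space d × Space d => (b z.1 ((2 * Real.pi) • z.2) : ℂ)) := by
  have : Continuous (fun z : Space d × Space d => b z.1 ((2 * Real.pi) • z.2)) :=
    hb.1.continuous.comp
      (by fun_prop : Continuous fun z : Space d × Space d => (z.1, (2 * Real.pi) • z.2))
  exact Complex.continuous_ofReal.comp this

lemma IsRealSymbol.integrable_mul_wigner {b : Space d → Space d → ℝ} (hb : IsRealSymbol b)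
    (ψ φ : 𝓢(Space d, ℂ)) :
    Integrable fun z : Space d × Space d => (b z.1 ((2 * Real.pi) • z.2) : ℂ) * wigner ψ φ z := by
  obtain ⟨B, hB⟩ := hb.exists_bound
  refine integrable_bounded_mul_wigner (continuous_rescaled_symbol hb) (B := B) (fun z => ?_) ψ φ
  rw [Complex.norm_real]; exact hB _ _

lemma IsRealSymbol.weylForm_eq {b : Space d → Space d → ℝ} (hb : IsRealSymbol b)
    (ψ φ : 𝓢(Space d, ℂ)) : weylForm b ψ φ =
      ∫ z : Space d × Space d, (b z.1 ((2 * Real.pi) • z.2) : ℂ) * wigner ψ φ z := by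
  obtain ⟨B, hB⟩ := hb.exists_bound
  exact weylForm_eq_integral_wigner hb.1.continuous hB ψ φ

lemma weylForm_sub {b₁ b₂ : Space d → Space d → ℝ} (h₁ : IsRealSymbol b₁)
    (h₂ : IsRealSymbol b₂) (ψ φ : 𝓢(Space d, ℂ)) :
    weylForm (fun x ξ => b₁ x ξ - b₂ x ξ) ψ φ = weylForm b₁ ψ φ - weylForm b₂ ψ φ := by
  rw [(h₁.sub h₂).weylForm_eq, h₁.weylForm_eq, h₂.weylForm_eq,
    ← integral_sub (h₁.integrable_mul_wigner ψ φ) (h₂.integrable_mul_wigner ψ φ)]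
  refine integral_congr_ae (ae_of_all _ fun z => ?_)
  push_cast; ring

lemma weylOp_sub {b₁ b₂ : Space d → Space d → ℝ} (h₁ : IsRealSymbol b₁)
    (h₂ : IsRealSymbol b₂) :
    weylOp (fun x ξ => b₁ x ξ - b₂ x ξ) = weylOp b₁ - weylOp b₂ := by
  refine (h₁.sub h₂).isWeylQuantization.unique fun ψ φ => ?_
  rw [sub_apply, inner_sub_right, h₁.inner_weylOp, h₂.inner_weylOp,
    weylForm_sub h₁ h₂]

end OperatorBounds

/-! ### Covariance under translations and modulations. -/

section Covariance

variable {d : ℕ}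

lemma IsRealSymbol.comp_add {b : Space d → Space d → ℝ} (hb : IsRealSymbol b) (v k : Space d) :
    IsRealSymbol fun x ξ => b (x + v) (ξ + k) := by
  have e : Function.uncurry (fun x ξ => b (x + v) (ξ + k)) =
      fun z => Function.uncurry b (z + (v, k)) := rfl
  refine ⟨by rw [e]; exact hb.1.comp (by fun_prop), fun n => ?_⟩
  obtain ⟨B, hB⟩ := hb.2 n
  refine ⟨B, fun p => ?_⟩
  rw [e, iteratedFDeriv_comp_add_right]
  exact hB _

/-- Translation of Schwartz functions. -/
noncomputable abbrev shift (v : Space d) (φ : 𝓢(Space d, ℂ)) : 𝓢(Space d, ℂ) :=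
  SchwartzMap.compSubConstCLM ℂ v φ

lemma norm_toL2_shift (v : Space d) (φ : 𝓢(Space d, ℂ)) :
    ‖toL2 (shift v φ)‖ = ‖toL2 φ‖ := by
  have h : ‖toL2 (shift v φ)‖ₑ = ‖toL2 φ‖ₑ := by
    rw [enorm_toL2_eq, enorm_toL2_eq]
    congr 1
    exact lintegral_sub_right_eq_self (fun x => ‖φ x‖ₑ ^ 2) v
  rw [← toReal_enorm, h, toReal_enorm]

lemma inner_toL2_shift (v : Space d) (ψ φ : 𝓢(Space d, ℂ)) :
    inner ℂ (toL2 (shift v ψ)) (toL2 (shift v φ)) = inner ℂ (toL2 ψ) (toL2 φ) := by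
  have h : ∀ ψ φ : 𝓢(Space d, ℂ), inner ℂ (toL2 ψ) (toL2 φ) = ∫ x, inner ℂ (ψ x) (φ x) := by
    intro ψ φ
    rw [L2.inner_def]
    refine integral_congr_ae ?_
    filter_upwards [ψ.coeFn_toLp 2 volume, φ.coeFn_toLp 2 volume] with x h1 h2
    rw [h1, h2]
  rw [h, h]
  exact integral_sub_right_eq_self (fun x => inner ℂ (ψ x) (φ x)) v

lemma wigner_shift (v : Space d) (ψ φ : 𝓢(Space d, ℂ)) (z : Space d × Space d) :
    wigner (shift v ψ) (shift v φ) z = wigner ψ φ (z.1 - v, z.2) := by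
  unfold wigner pairKernel
  simp only [SchwartzMap.compSubConstCLM_apply, add_sub_right_comm, sub_right_comm]

lemma weylForm_shift {b : Space d → Space d → ℝ} (hb : IsRealSymbol b) (v : Space d)
    (ψ φ : 𝓢(Space d, ℂ)) :
    weylForm b (shift v ψ) (shift v φ) = weylForm (fun x ξ => b (x + v) ξ) ψ φ := by
  have h2 := hb.comp_add v 0
  simp only [add_zero] at h2
  rw [hb.weylForm_eq, h2.weylForm_eq]
  simp_rw [wigner_shift]
  rw [← integral_add_right_eq_self _ ((v, 0) : Space d × Space d)]
  refine integral_congr_ae (ae_of_all _ fun z => ?_)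
  simp

/-- Translating the symbol in position conjugates the operator by a unitary translation. It is
enough to see this on the forms over Schwartz functions, so the unitary itself is never constructed
on L². -/
lemma le_norm_weylOp_shift_sub {b : Space d → Space d → ℝ} (hb : IsRealSymbol b)
    (v : Space d) {c E : ℝ} (h : ∀ f, c * ‖f‖ ≤ ‖weylOp b f - (E : ℂ) • f‖) (f : L2Space d) :
    c * ‖f‖ ≤ ‖weylOp (fun x ξ => b (x + v) ξ) f - (E : ℂ) • f‖ := by
  have h2 := hb.comp_add v 0
  simp only [add_zero] at h2
  refine denseRange_toL2.induction_on (p := fun f => c * ‖f‖ ≤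
    ‖weylOp (fun x ξ => b (x + v) ξ) f - (E : ℂ) • f‖) f
    (isClosed_le (by fun_prop) (by fun_prop)) fun φ => ?_
  rw [← norm_toL2_shift v φ]
  refine (h _).trans (norm_le_of_forall_inner_toL2_le (norm_nonneg _) fun ψ => ?_)
  have hψ : ψ = shift v (shift (-v) ψ) := by
    ext x; simp
  have e : inner ℂ (toL2 ψ) (weylOp b (toL2 (shift v φ)) - (E : ℂ) • toL2 (shift v φ)) =
      inner ℂ (toL2 (shift (-v) ψ))
        (weylOp (fun x ξ => b (x + v) ξ) (toL2 φ) - (E : ℂ) • toL2 φ) := by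
    conv_lhs => rw [hψ]
    rw [inner_sub_right, inner_sub_right, inner_smul_right, inner_smul_right, hb.inner_weylOp,
      h2.inner_weylOp, weylForm_shift hb, inner_toL2_shift]
  rw [e, mul_comm, ← norm_toL2_shift (-v) ψ]
  exact norm_inner_le_norm _ _

/-- Multiplication of a Schwartz function by a character. -/
noncomputable def modulate (k : Space d) (φ : 𝓢(Space d, ℂ)) : 𝓢(Space d, ℂ) :=
  SchwartzMap.smulLeftCLM ℂ (fun x => phase (inner ℝ k x)) φ

lemma modulate_apply (k : Space d) (φ : 𝓢(Space d, ℂ)) (x : Space d) :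
    modulate k φ x = phase (inner ℝ k x) * φ x := by
  have h : Function.HasTemperateGrowth (fun x : Space d => phase (inner ℝ k x)) := by
    have h1 : (fun x : Space d => phase (inner ℝ k x)) =
        fun x => Complex.exp (Complex.I * (inner ℝ ((2 * Real.pi) • k) x : ℝ)) := by
      funext x
      unfold phase
      rw [inner_smul_left]; simp
    rw [h1]
    exact hasTemperateGrowth_modulation ((2 * Real.pi) • k)
  exact SchwartzMap.smulLeftCLM_apply_apply h φ x

lemma wigner_modulate_left (k : Space d) (ψ φ : 𝓢(Space d, ℂ)) (z : Space d × Space d) :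
    wigner (modulate (-k) ψ) φ z = wigner ψ (modulate k φ) (z.1, z.2 + k) := by
  unfold wigner pairKernel
  refine integral_congr_ae (ae_of_all _ fun r => ?_)
  dsimp only
  simp only [modulate_apply, map_mul, conj_phase]
  have : phase (inner ℝ z.2 r) *
      phase (-inner ℝ (-k) (z.1 + (1 / 2 : ℝ) • r)) =
      phase (inner ℝ (z.2 + k) r) * phase (inner ℝ k (z.1 - (1 / 2 : ℝ) • r)) := by
    rw [← phase_add, ← phase_add]
    congr 1
    simp only [inner_neg_left, inner_add_left, inner_add_right, inner_sub_right, inner_smul_right]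
    ring
  calc _ = (phase (inner ℝ z.2 r) * phase (-inner ℝ (-k) (z.1 + (1 / 2 : ℝ) • r))) *
        (conj (ψ (z.1 + (1 / 2 : ℝ) • r)) * φ (z.1 - (1 / 2 : ℝ) • r)) := by ring
    _ = _ := by rw [this]; ring

lemma weylForm_modulate_left {b : Space d → Space d → ℝ} (hb : IsRealSymbol b) (k : Space d)
    (ψ φ : 𝓢(Space d, ℂ)) :
    weylForm b (modulate (-k) ψ) φ =
      weylForm (fun x ξ => b x (ξ + -((2 * Real.pi) • k))) ψ (modulate k φ) := by
  have h2 := hb.comp_add 0 (-((2 * Real.pi) • k))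
  simp only [add_zero] at h2
  rw [hb.weylForm_eq, h2.weylForm_eq]
  simp_rw [wigner_modulate_left]
  rw [← integral_add_right_eq_self (fun z : Space d × Space d =>
    (b z.1 ((2 * Real.pi) • z.2 + -((2 * Real.pi) • k)) : ℂ) * wigner ψ (modulate k φ) z)
    ((0, k) : Space d × Space d)]
  refine integral_congr_ae (ae_of_all _ fun z => ?_)
  have : z + ((0, k) : Space d × Space d) = (z.1, z.2 + k) := by ext1 <;> simp
  simp [this, smul_add]

lemma mulOp_phaseFun_toL2 (k : Space d) (φ : 𝓢(Space d, ℂ)) :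
    mulOp (phaseFun k) (toL2 φ) = toL2 (modulate k φ) :=
  mulOp_toL2 _ _ _ fun x => modulate_apply k φ x

lemma norm_toL2_modulate (k : Space d) (φ : 𝓢(Space d, ℂ)) :
    ‖toL2 (modulate k φ)‖ = ‖toL2 φ‖ := by
  have h : ‖toL2 (modulate k φ)‖ₑ = ‖toL2 φ‖ₑ := by
    rw [enorm_toL2_eq, enorm_toL2_eq]
    congr 2; funext x
    rw [modulate_apply, enorm_mul, ← ofReal_norm (phase _), norm_phase, ENNReal.ofReal_one, one_mul]
  rw [← toReal_enorm, h, toReal_enorm]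

/-- Conjugation by a character shifts the symbol in frequency, by 2πk in the normalisation of
`phase`. The commutator is thus the quantization of a frequency difference, applied to a modulated
function of the same norm. -/
lemma norm_commutator_phase_le {b : Space d → Space d → ℝ} (hb : IsRealSymbol b) (k : Space d)
    (φ : 𝓢(Space d, ℂ)) :
    ‖mulOp (phaseFun k) (weylOp b (toL2 φ)) - weylOp b (mulOp (phaseFun k) (toL2 φ))‖ ≤
      ‖weylOp (fun x ξ => b x (ξ + -((2 * Real.pi) • k)) - b x ξ)‖ * ‖toL2 φ‖ := by
  have h2 := hb.comp_add 0 (-((2 * Real.pi) • k))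
  simp only [add_zero] at h2
  refine norm_le_of_forall_inner_toL2_le (by positivity) fun ψ => ?_
  have e : inner ℂ (toL2 ψ) (mulOp (phaseFun k) (weylOp b (toL2 φ)) -
      weylOp b (mulOp (phaseFun k) (toL2 φ))) = inner ℂ (toL2 ψ)
      (weylOp (fun x ξ => b x (ξ + -((2 * Real.pi) • k)) - b x ξ) (toL2 (modulate k φ))) := by
    rw [(h2.sub hb).inner_weylOp, weylForm_sub h2 hb, inner_sub_right,
      inner_mulOp (phaseFun k) (phaseFun (-k)) (fun x => by
        rw [phaseFun_apply, phaseFun_apply, conj_phase, inner_neg_left]),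
      mulOp_phaseFun_toL2, mulOp_phaseFun_toL2, hb.inner_weylOp, hb.inner_weylOp,
      weylForm_modulate_left hb]
  rw [e]
  refine (norm_inner_le_norm _ _).trans ((mul_comm _ _).trans_le
    (mul_le_mul_of_nonneg_right ?_ (norm_nonneg _)))
  rw [← norm_toL2_modulate k φ]
  exact ContinuousLinearMap.le_opNorm _ _

end Covariance

/-! ### Plancherel for Hilbert-space-valued functions. -/

section Plancherel

variable {d : ℕ} {H : Type*} [NormedAddCommGroup H] [InnerProductSpace ℂ H] [CompleteSpace H]

/-- The integral Fourier transform and the L² one agree as distributions on test functions, hence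
almost everywhere, and the latter is isometric. -/
lemma lintegral_enorm_sq_fourier_of_memLp {f : Space d → H} (h1 : Integrable f)
    (h2 : MemLp f 2) : ∫⁻ s, ‖FourierTransform.fourier f s‖ₑ ^ 2 = ∫⁻ s, ‖f s‖ₑ ^ 2 := by
  set fL := h2.toLp f with hfL
  have hc : Continuous (FourierTransform.fourier f : Space d → H) :=
    VectorFourier.fourierIntegral_continuous Real.continuous_fourierChar
      (L := innerₗ (Space d)) continuous_inner h1
  have hae : ∀ᵐ s, FourierTransform.fourier f s =
      (FourierTransform.fourier fL : Lp H 2 (volume : Measure (Space d))) s := by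
    refine ae_eq_of_integral_contDiff_smul_eq hc.locallyIntegrable
      ((Lp.memLp _).locallyIntegrable (by norm_num)) fun g hg hgs => ?_
    have hgC : ContDiff ℝ ∞ (fun x => (g x : ℂ)) := Complex.ofRealCLM.contDiff.comp hg
    have hgCs : HasCompactSupport (fun x => (g x : ℂ)) := hgs.comp_left Complex.ofReal_zero
    let G : 𝓢(Space d, ℂ) := hgCs.toSchwartzMap hgC
    have hG : ∀ x, G x = (g x : ℂ) := fun x => rfl
    have e1 := congrArg (fun T : TemperedDistribution (Space d) H => T G)
      (Lp.fourier_toTemperedDistribution_eq fL)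
    simp only [TemperedDistribution.fourier_apply, Lp.toTemperedDistribution_apply] at e1
    have e2 : ∫ x, g x • (FourierTransform.fourier fL : Lp H 2 (volume : Measure (Space d))) x =
        ∫ x, G x • (FourierTransform.fourier fL : Lp H 2 (volume : Measure (Space d))) x := by
      congr 1
    rw [e2, ← e1]
    have e3 : ∫ x, (FourierTransform.fourier G) x • fL x =
        ∫ x, (FourierTransform.fourier G) x • f x := by
      refine integral_congr_ae ?_
      filter_upwards [MemLp.coeFn_toLp h2] with x hx
      rw [hx]
    rw [e3, SchwartzMap.fourier_coe]
    have e4 := VectorFourier.integral_fourierIntegral_smul_eq_flip (L := innerₗ (Space d))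
      Real.continuous_fourierChar continuous_inner (G.integrable (μ := volume)) h1
    rw [flip_innerₗ] at e4
    refine Eq.trans ?_ e4.symm
    congr 1
  have h3 : ∫⁻ s, ‖FourierTransform.fourier f s‖ₑ ^ 2 =
      ‖(FourierTransform.fourier fL : Lp H 2 (volume : Measure (Space d)))‖ₑ ^ 2 := by
    rw [Lp.enorm_def, eLpNorm_eq_lintegral_rpow_enorm_toReal (by norm_num) (by norm_num),
      ← ENNReal.rpow_natCast, ← ENNReal.rpow_mul]
    norm_num
    refine lintegral_congr_ae ?_
    filter_upwards [hae] with s hs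
    rw [hs]
  rw [h3, ← enorm_sq_toLp_two h2, ← ofReal_norm, Lp.norm_fourier_eq, ofReal_norm]

end Plancherel

/-! ### Commutators with windows. -/

section WindowCommutator

variable {d : ℕ}

lemma integral_gauss_pi : ∫ η : Space d, gauss Real.pi η = 1 := by
  have := GaussianFourier.integral_rexp_neg_mul_sq_norm (V := Space d) Real.pi_pos
  unfold gauss
  rw [this, div_self Real.pi_ne_zero, Real.one_rpow]

/-- The Gaussian of exponent π is its own Fourier transform, so a window is a superposition of
characters. The identity is tested against h in L² and follows by Fubini. -/
lemma integral_gauss_smul_mulOp_phase (κ : ℝ) (s : Space d) (f : L2Space d) :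
    ∫ η : Space d, (phase (-inner ℝ η s) * (gauss Real.pi η : ℂ)) •
      mulOp (phaseFun (κ • η)) f = (windowConst d : ℂ)⁻¹ • mulOp (window κ s) f := by
  have hc : Continuous fun η : Space d => mulOp (phaseFun (κ • η)) f :=
    (continuous_mulOp_phase f).comp (by fun_prop)
  have hnorm : ∀ k : Space d, ‖mulOp (phaseFun k) f‖ ≤ ‖f‖ := fun k => by
    refine Lp.norm_le_norm_of_ae_le ?_
    filter_upwards [coeFn_mulOp (phaseFun k) f] with x hx
    rw [hx, norm_mul, phaseFun_apply, norm_phase, one_mul]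
  have hi : Integrable fun η : Space d => (phase (-inner ℝ η s) * (gauss Real.pi η : ℂ)) •
      mulOp (phaseFun (κ • η)) f := by
    refine ((integrable_gauss (V := Space d) Real.pi_pos).mul_const ‖f‖).mono'
      (Continuous.aestronglyMeasurable (by fun_prop)) (ae_of_all _ fun η => ?_)
    rw [norm_smul, norm_mul, norm_phase, one_mul, Complex.norm_real, Real.norm_eq_abs,
      abs_of_pos (gauss_pos _ _)]
    exact mul_le_mul_of_nonneg_left (hnorm _) (gauss_pos _ _).le
  refine ext_inner_left ℂ fun h => ?_
  rw [← integral_inner hi h, inner_smul_right, L2.inner_def]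
  have hF : Integrable fun x => conj (h x) * f x := by
    have := L2.integrable_inner (𝕜 := ℂ) h f
    refine this.congr (ae_of_all _ fun x => ?_)
    simp only [RCLike.inner_apply]; ring
  have e1 : ∀ η : Space d, inner ℂ h ((phase (-inner ℝ η s) * (gauss Real.pi η : ℂ)) •
      mulOp (phaseFun (κ • η)) f) = ∫ x, (phase (inner ℝ (κ • x - s) η) *
        (gauss Real.pi η : ℂ)) * (conj (h x) * f x) := by
    intro η
    rw [inner_smul_right, L2.inner_def, ← integral_const_mul]
    refine integral_congr_ae ?_
    filter_upwards [coeFn_mulOp (phaseFun (κ • η)) f] with x hx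
    rw [hx, RCLike.inner_apply, phaseFun_apply]
    have : phase (inner ℝ (κ • x - s) η) = phase (-inner ℝ η s) * phase (inner ℝ (κ • η) x) := by
      rw [← phase_add]
      congr 1
      rw [inner_sub_left, inner_smul_left, inner_smul_left, real_inner_comm x η,
        real_inner_comm s η]
      simp; ring
    rw [this]; ring
  simp_rw [e1]
  rw [integral_integral_swap]
  · rw [← integral_const_mul]
    refine integral_congr_ae ?_
    filter_upwards [coeFn_mulOp (window κ s) f] with x hx
    rw [integral_mul_const, integral_phase_mul_gauss Real.pi_pos, integral_gauss_pi, hx,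
      RCLike.inner_apply, window_apply]
    have hw : (windowConst d : ℂ) ≠ 0 := by exact_mod_cast windowConst_pos.ne'
    have hp : Real.pi ^ 2 / Real.pi = Real.pi := by field_simp
    rw [hp]
    push_cast
    field_simp
  · have h5 : Integrable fun q : Space d × Space d =>
        (gauss Real.pi q.1 : ℂ) * (conj (h q.2) * f q.2) :=
      (integrable_gauss (V := Space d) Real.pi_pos).ofReal.mul_prod hF
    have h6 : Integrable fun q : Space d × Space d => phase (inner ℝ (κ • q.2 - s) q.1) *
        ((gauss Real.pi q.1 : ℂ) * (conj (h q.2) * f q.2)) :=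
      h5.bdd_mul (c := 1) (Continuous.aestronglyMeasurable (by fun_prop))
        (ae_of_all _ fun q => (norm_phase _).le)
    refine h6.congr (ae_of_all _ fun q => ?_)
    simp only [Function.uncurry]
    ring

/-- As a function of s, the commutator with the window is a multiple of the Fourier transform of the
Gaussian times the commutator with the character of frequency κη. Plancherel in s converts pointwise
bounds in η into the square integral over s. -/
lemma lintegral_commutator_window (κ : ℝ) (T : L2Space d →L[ℂ] L2Space d) (f : L2Space d) {A : ℝ}
    (hA : 0 ≤ A) (h : ∀ η : Space d, ‖mulOp (phaseFun (κ • η)) (T f) -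
      T (mulOp (phaseFun (κ • η)) f)‖ ≤ A * ‖η‖) :
    ∫⁻ s, ‖mulOp (window κ s) (T f) - T (mulOp (window κ s) f)‖ₑ ^ 2 ≤
      ENNReal.ofReal (windowConst d ^ 2 * (A ^ 2 *
        ∫ η : Space d, (1 + ‖η‖) ^ 2 * gauss (2 * Real.pi) η)) := by
  set D : Space d → L2Space d := fun η => mulOp (phaseFun (κ • η)) (T f) -
      T (mulOp (phaseFun (κ • η)) f) with hD
  have hc : ∀ f : L2Space d, Continuous fun η : Space d => mulOp (phaseFun (κ • η)) f := fun f =>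
    (continuous_mulOp_phase f).comp (by fun_prop)
  have hDc : Continuous D := (hc _).sub (T.continuous.comp (hc _))
  set g : Space d → L2Space d := fun η => (gauss Real.pi η : ℂ) • D η with hg
  have hgc : Continuous g := by
    have : Continuous fun η : Space d => (gauss Real.pi η : ℂ) := by fun_prop
    exact this.smul hDc
  have hgn : ∀ η, ‖g η‖ ≤ A * ((1 + ‖η‖) ^ 1 * gauss Real.pi η) := by
    intro η
    rw [hg]; dsimp only
    rw [norm_smul, Complex.norm_real, Real.norm_eq_abs, abs_of_pos (gauss_pos _ _)]
    have h1 := h η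
    have h2 : A * ‖η‖ ≤ A * (1 + ‖η‖) := by gcongr; linarith
    have := mul_le_mul_of_nonneg_left (h1.trans h2) (gauss_pos Real.pi η).le
    refine this.trans (le_of_eq (by ring))
  have hg1 : Integrable g :=
    ((integrable_pow_mul_gauss (V := Space d) Real.pi_pos 1).const_mul A).mono'
      hgc.aestronglyMeasurable (ae_of_all _ hgn)
  have hI := integrable_pow_mul_gauss (V := Space d) (c := 2 * Real.pi) (by positivity) 2
  have hgl : ∫⁻ η, ‖g η‖ₑ ^ 2 ≤
      ENNReal.ofReal (A ^ 2 * ∫ η : Space d, (1 + ‖η‖) ^ 2 * gauss (2 * Real.pi) η) := by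
    rw [← integral_const_mul, ofReal_integral_eq_lintegral_ofReal (hI.const_mul _)
      (ae_of_all _ fun η => by have := gauss_pos (2 * Real.pi) η; positivity)]
    refine lintegral_mono fun η => ?_
    rw [← ofReal_norm, ← ENNReal.ofReal_pow (norm_nonneg _)]
    refine ENNReal.ofReal_le_ofReal ((pow_le_pow_left₀ (norm_nonneg _) (hgn η) 2).trans
      (le_of_eq ?_))
    rw [mul_pow, mul_pow, gauss_sq]; ring
  have hg2 : MemLp g 2 := memLp_two_of_lintegral_enorm_sq hgc.aestronglyMeasurable
    (ne_top_of_le_ne_top ENNReal.ofReal_ne_top hgl)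
  have hi : ∀ (f : L2Space d) (s : Space d),
      Integrable fun η : Space d => (phase (-inner ℝ η s) * (gauss Real.pi η : ℂ)) •
      mulOp (phaseFun (κ • η)) f := by
    intro f s
    have := hc f
    refine ((integrable_gauss (V := Space d) Real.pi_pos).mul_const ‖f‖).mono'
      (Continuous.aestronglyMeasurable (by fun_prop)) (ae_of_all _ fun η => ?_)
    rw [norm_smul, norm_mul, norm_phase, one_mul, Complex.norm_real, Real.norm_eq_abs,
      abs_of_pos (gauss_pos _ _)]
    refine mul_le_mul_of_nonneg_left ?_ (gauss_pos _ _).le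
    refine Lp.norm_le_norm_of_ae_le ?_
    filter_upwards [coeFn_mulOp (phaseFun (κ • η)) f] with x hx
    rw [hx, norm_mul, phaseFun_apply, norm_phase, one_mul]
  have hF : ∀ s, mulOp (window κ s) (T f) - T (mulOp (window κ s) f) =
      (windowConst d : ℂ) • FourierTransform.fourier g s := by
    intro s
    have hw : (windowConst d : ℂ) ≠ 0 := by exact_mod_cast windowConst_pos.ne'
    have e : FourierTransform.fourier g s = (windowConst d : ℂ)⁻¹ •
        (mulOp (window κ s) (T f) - T (mulOp (window κ s) f)) := by
      rw [smul_sub, ← T.map_smul, ← integral_gauss_smul_mulOp_phase, ← integral_gauss_smul_mulOp_phase,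
        ← ContinuousLinearMap.integral_comp_comm T (hi f s),
        ← integral_sub (hi _ s) (T.integrable_comp (hi f s)), Real.fourier_eq']
      refine integral_congr_ae (ae_of_all _ fun η => ?_)
      dsimp only [hg, hD]
      rw [map_smul, ← smul_sub, smul_smul]
      congr 2
      unfold phase
      congr 1
      push_cast; ring
    rw [e, smul_smul, mul_inv_cancel₀ hw, one_smul]
  simp_rw [hF, enorm_smul, mul_pow]
  rw [lintegral_const_mul' _ _ (by finiteness), lintegral_enorm_sq_fourier_of_memLp hg1 hg2]
  have hwc : ‖(windowConst d : ℂ)‖ₑ ^ 2 = ENNReal.ofReal (windowConst d ^ 2) := by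
    rw [← ofReal_norm, Complex.norm_real, Real.norm_eq_abs, abs_of_pos windowConst_pos,
      ENNReal.ofReal_pow windowConst_pos.le]
  rw [hwc, ENNReal.ofReal_mul (sq_nonneg _)]
  gcongr

end WindowCommutator

/-! ### The Wigner distribution of windowed functions. -/

section Averaging

variable {d : ℕ}

/-- Multiplication of a Schwartz function by a Gaussian window. -/
noncomputable def windowMul (κ : ℝ) (s : Space d) (φ : 𝓢(Space d, ℂ)) : 𝓢(Space d, ℂ) :=
  SchwartzMap.smulLeftCLM ℂ (fun x => window κ s x) φ

lemma windowMul_apply (κ : ℝ) (s : Space d) (φ : 𝓢(Space d, ℂ)) (x : Space d) :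
    windowMul κ s φ x = window κ s x * φ x := by
  have h1 : Function.HasTemperateGrowth (fun x : Space d => gauss Real.pi (κ • x - s)) :=
    (hasTemperateGrowth_gauss Real.pi_pos).comp (by fun_prop)
  have h2 : Function.HasTemperateGrowth
      (fun x : Space d => windowConst d * gauss Real.pi (κ • x - s)) :=
    (Function.HasTemperateGrowth.const _).mul h1
  have h3 : Function.HasTemperateGrowth
      (fun x : Space d => ((windowConst d * gauss Real.pi (κ • x - s) : ℝ) : ℂ)) :=
    Function.HasTemperateGrowth.comp Function.Complex.hasTemperateGrowth_ofReal h2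
  exact SchwartzMap.smulLeftCLM_apply_apply h3 φ x

lemma mulOp_window_toL2 (κ : ℝ) (s : Space d) (φ : 𝓢(Space d, ℂ)) :
    mulOp (window κ s) (toL2 φ) = toL2 (windowMul κ s φ) :=
  mulOp_toL2 _ _ _ fun x => windowMul_apply κ s φ x

lemma window_mul_window (κ : ℝ) (s X r : Space d) :
    window κ s (X + (1 / 2 : ℝ) • r) * window κ s (X - (1 / 2 : ℝ) • r) =
      ((windowConst d ^ 2 * gauss (2 * Real.pi) (κ • X - s) *
        gauss (Real.pi / 2) (κ • r) : ℝ) : ℂ) := by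
  rw [window_apply, window_apply, ← Complex.ofReal_mul]
  congr 1
  have h := gauss_midpoint (κ • (X + (1 / 2 : ℝ) • r) - s) (κ • (X - (1 / 2 : ℝ) • r) - s)
  have h1 : (1 / 2 : ℝ) • ((κ • (X + (1 / 2 : ℝ) • r) - s) + (κ • (X - (1 / 2 : ℝ) • r) - s)) =
      κ • X - s := by module
  have h2 : (κ • (X + (1 / 2 : ℝ) • r) - s) - (κ • (X - (1 / 2 : ℝ) • r) - s) = κ • r := by module
  rw [h1, h2] at h
  linear_combination (-windowConst d ^ 2) * h

/-- The windows at the two endpoints multiply to a Gaussian in X times a Gaussian in r; under the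
Fourier transform in r the latter acts as a convolution in the momentum at scale κ. -/
lemma wigner_windowMul (κ : ℝ) (s : Space d) (ψ φ : 𝓢(Space d, ℂ)) (z : Space d × Space d) :
    wigner (windowMul κ s ψ) (windowMul κ s φ) z =
      (windowConst d ^ 4 : ℝ) * ((gauss (2 * Real.pi) (κ • z.1 - s) : ℂ) *
        ∫ η : Space d, (gauss (2 * Real.pi) η : ℂ) * wigner ψ φ (z.1, z.2 + κ • η)) := by
  have e1 : wigner (windowMul κ s ψ) (windowMul κ s φ) z = ∫ r : Space d,
      ((windowConst d ^ 2 * gauss (2 * Real.pi) (κ • z.1 - s) : ℝ) : ℂ) *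
        ((gauss (Real.pi / 2) (κ • r) : ℂ) * (phase (inner ℝ z.2 r) * pairKernel ψ φ z.1 r)) := by
    unfold wigner
    refine integral_congr_ae (ae_of_all _ fun r => ?_)
    have := window_mul_window κ s z.1 r
    have hreal : ∀ x, conj (window κ s x) = window κ s x := fun x => by
      rw [window_apply, Complex.conj_ofReal]
    simp only [pairKernel, windowMul_apply, map_mul, hreal]
    push_cast at this ⊢
    linear_combination (phase (inner ℝ z.2 r) * conj (ψ (z.1 + (1 / 2 : ℝ) • r)) *
      φ (z.1 - (1 / 2 : ℝ) • r)) * this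
  have e2 : ∫ η : Space d, (gauss (2 * Real.pi) η : ℂ) * wigner ψ φ (z.1, z.2 + κ • η) =
      ∫ r : Space d, ((∫ η : Space d, gauss (2 * Real.pi) η : ℝ) : ℂ) *
        ((gauss (Real.pi / 2) (κ • r) : ℂ) * (phase (inner ℝ z.2 r) * pairKernel ψ φ z.1 r)) := by
    have hpi : Real.pi ^ 2 / (2 * Real.pi) = Real.pi / 2 := by
      field_simp
    have h3 : ∀ r : Space d, ((∫ η : Space d, gauss (2 * Real.pi) η : ℝ) : ℂ) *
        ((gauss (Real.pi / 2) (κ • r) : ℂ) * (phase (inner ℝ z.2 r) * pairKernel ψ φ z.1 r)) =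
        ∫ η : Space d, (gauss (2 * Real.pi) η : ℂ) *
          (phase (inner ℝ (z.2 + κ • η) r) * pairKernel ψ φ z.1 r) := by
      intro r
      have h4 := integral_phase_mul_gauss (V := Space d) (b := 2 * Real.pi) (by positivity) (κ • r)
      rw [hpi] at h4
      rw [← mul_assoc, ← h4, ← integral_mul_const]
      refine integral_congr_ae (ae_of_all _ fun η => ?_)
      have : phase (inner ℝ (z.2 + κ • η) r) = phase (inner ℝ (κ • r) η) * phase (inner ℝ z.2 r) := by
        rw [← phase_add]
        congr 1
        rw [inner_add_left, inner_smul_left, inner_smul_left, real_inner_comm r η]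
        ring
      dsimp only
      rw [this]; ring
    simp_rw [h3]
    unfold wigner
    simp_rw [← integral_const_mul]
    rw [integral_integral_swap]
    have h5 : Integrable fun q : Space d × Space d =>
        (gauss (2 * Real.pi) q.1 : ℂ) * pairKernel ψ φ z.1 q.2 :=
      (integrable_gauss (V := Space d) (by positivity)).ofReal.mul_prod
        (integrable_pairKernel_right ψ φ z.1)
    have h6 := h5.bdd_mul (c := 1) (f := fun q : Space d × Space d =>
      phase (inner ℝ (z.2 + κ • q.1) q.2))
      (Continuous.aestronglyMeasurable (by fun_prop)) (ae_of_all _ fun q => (norm_phase _).le)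
    refine h6.congr (ae_of_all _ fun q => ?_)
    simp only [Function.uncurry]
    ring
  rw [e1, e2, integral_const_mul, integral_const_mul]
  -- Two of the four normalising factors in the goal cancel the Gaussian mass that comes from `e2`.
  have hw : ((windowConst d : ℝ) : ℂ) ^ 2 * ((∫ t : Space d, gauss (2 * Real.pi) t : ℝ) : ℂ) = 1 := by
    exact_mod_cast windowConst_sq_mul (d := d)
  push_cast
  linear_combination (-(windowConst d : ℂ) ^ 2 * (gauss (2 * Real.pi) (κ • z.1 - s) : ℂ) *
    ∫ r : Space d, (gauss (Real.pi / 2) (κ • r) : ℂ) *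
      (phase (inner ℝ z.2 r) * pairKernel ψ φ z.1 r)) * hw

/-- The change of variables `(X, p), (s, η) ↦ (X, p + κ η), (κ X - s, η)`. -/
noncomputable def windowShear (κ : ℝ) (q : (Space d × Space d) × (Space d × Space d)) :
    (Space d × Space d) × (Space d × Space d) :=
  ((q.1.1, q.1.2 + κ • q.2.2), (κ • q.1.1 - q.2.1, q.2.2))

lemma measurePreserving_windowShear (κ : ℝ) :
    MeasurePreserving (windowShear κ : (Space d × Space d) × (Space d × Space d) → _) := by
  have h1 : MeasurePreserving (fun q : (Space d × Space d) × (Space d × Space d) =>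
      (q.1, (κ • q.1.1 - q.2.1, q.2.2))) := by
    refine (MeasurePreserving.id _).skew_product
      (g := fun (z : Space d × Space d) (w : Space d × Space d) => (κ • z.1 - w.1, w.2))
      (by fun_prop) (ae_of_all _ fun z => ?_)
    exact ((Measure.measurePreserving_sub_left volume (κ • z.1)).prod
      (MeasurePreserving.id _)).map_eq
  have h2 : MeasurePreserving (fun q : (Space d × Space d) × (Space d × Space d) =>
      (q.1, q.2 + ((0, κ • q.1.2) : Space d × Space d))) := by
    refine (MeasurePreserving.id _).skew_product
      (g := fun (w : Space d × Space d) (z : Space d × Space d) => z + (0, κ • w.2))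
      (by fun_prop) (ae_of_all _ fun w => ?_)
    exact (measurePreserving_add_right volume _).map_eq
  have h3 := (Measure.measurePreserving_swap.comp h2).comp (Measure.measurePreserving_swap.comp h1)
  convert h3 using 1
  · funext q
    simp [windowShear, Prod.ext_iff]
  · rfl

end Averaging

/-! ### Averages of windowed Weyl forms. -/

section AveragedForm

variable {d : ℕ}

/-- Reordering of the variables `s, ((X, p), η) ↦ (X, p), (s, η)`. -/
def exchangeWindow (q : Space d × ((Space d × Space d) × Space d)) :
    (Space d × Space d) × (Space d × Space d) := (q.2.1, (q.1, q.2.2))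

lemma measurePreserving_exchangeWindow :
    MeasurePreserving (exchangeWindow : Space d × ((Space d × Space d) × Space d) → _) := by
  have h1 := (measurePreserving_prodAssoc (volume : Measure (Space d))
    (volume : Measure (Space d × Space d)) (volume : Measure (Space d))).symm
  have h2 : MeasurePreserving (Prod.map Prod.swap id :
      (Space d × (Space d × Space d)) × Space d → _) :=
    Measure.measurePreserving_swap.prod (MeasurePreserving.id _)
  have h3 := measurePreserving_prodAssoc (volume : Measure (Space d × Space d))
    (volume : Measure (Space d)) (volume : Measure (Space d))
  exact (h3.comp h2).comp h1

lemma isNegInvariant_volume_prod (d : ℕ) :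
    (volume : Measure (Space d × Space d)).IsNegInvariant where
  neg_eq_self := ((Measure.measurePreserving_neg (volume : Measure (Space d))).prod
    (Measure.measurePreserving_neg (volume : Measure (Space d)))).map_eq

/-- The change of variables `windowShear` moves the Gaussian smearing from the Wigner distribution
onto the symbol. The operator assembled from all windows thus becomes a Gaussian average of
quantizations of shifted symbols. -/
lemma integral_weylForm_windowMul {κ : ℝ} {b : Space d → Space d → Space d → ℝ} {B : ℝ}
    (hc : Continuous fun q : Space d × (Space d × Space d) => b q.1 q.2.1 q.2.2)
    (hB : ∀ s x ξ, |b s x ξ| ≤ B) (hb : ∀ s, IsRealSymbol (b s))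
    (hs : ∀ t η : Space d, IsRealSymbol fun x ξ => b (κ • x - t) x (ξ - (2 * Real.pi * κ) • η))
    (ψ φ : 𝓢(Space d, ℂ)) :
    Integrable (fun w : Space d × Space d =>
      ((gauss (2 * Real.pi) w.1 * gauss (2 * Real.pi) w.2 : ℝ) : ℂ) *
        weylForm (fun x ξ => b (κ • x - w.1) x (ξ - (2 * Real.pi * κ) • w.2)) ψ φ) ∧
    ∫ s, weylForm (b s) (windowMul κ s ψ) (windowMul κ s φ) = (windowConst d ^ 4 : ℝ) *
      ∫ w : Space d × Space d, ((gauss (2 * Real.pi) w.1 * gauss (2 * Real.pi) w.2 : ℝ) : ℂ) *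
        weylForm (fun x ξ => b (κ • x - w.1) x (ξ - (2 * Real.pi * κ) • w.2)) ψ φ := by
  set g : Space d → ℝ := gauss (2 * Real.pi) with hg
  have hgi : Integrable g := integrable_gauss (by positivity)
  set H : (Space d × Space d) × (Space d × Space d) → ℂ := fun q =>
    (b (κ • q.1.1 - q.2.1) q.1.1 ((2 * Real.pi) • q.1.2 - (2 * Real.pi * κ) • q.2.2) : ℂ) *
      (wigner ψ φ q.1 * ((g q.2.1 : ℂ) * (g q.2.2 : ℂ))) with hH
  have hHi : Integrable H := by
    have h1 : Integrable fun q : (Space d × Space d) × (Space d × Space d) =>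
        wigner ψ φ q.1 * ((g q.2.1 : ℂ) * (g q.2.2 : ℂ)) :=
      (integrable_wigner ψ φ).mul_prod (hgi.ofReal.mul_prod hgi.ofReal)
    refine h1.bdd_mul (c := B) (Continuous.aestronglyMeasurable ?_) (ae_of_all _ fun q => ?_)
    · refine Complex.continuous_ofReal.comp (hc.comp (by fun_prop :
        Continuous fun q : (Space d × Space d) × (Space d × Space d) =>
          (κ • q.1.1 - q.2.1,
            (q.1.1, (2 * Real.pi) • q.1.2 - (2 * Real.pi * κ) • q.2.2))))
    · rw [Complex.norm_real]; exact hB _ _ _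
  have hHw : ∀ w : Space d × Space d, ∫ z, H (z, w) = ((g w.1 * g w.2 : ℝ) : ℂ) *
      weylForm (fun x ξ => b (κ • x - w.1) x (ξ - (2 * Real.pi * κ) • w.2)) ψ φ := by
    intro w
    rw [(hs w.1 w.2).weylForm_eq, ← integral_const_mul]
    refine integral_congr_ae (ae_of_all _ fun z => ?_)
    simp only [hH]
    push_cast; ring
  refine ⟨(hHi.integral_prod_right).congr (ae_of_all _ hHw), ?_⟩
  have hT := (measurePreserving_windowShear (d := d) κ).comp measurePreserving_exchangeWindow
  set H2 : Space d × ((Space d × Space d) × Space d) → ℂ := fun q =>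
    (b q.1 q.2.1.1 ((2 * Real.pi) • q.2.1.2) : ℂ) * ((g (κ • q.2.1.1 - q.1) : ℂ) *
      ((g q.2.2 : ℂ) * wigner ψ φ (q.2.1.1, q.2.1.2 + κ • q.2.2))) with hH2
  have hcomp : H2 = H ∘ (windowShear κ ∘ exchangeWindow) := by
    funext q
    simp only [hH2, hH, Function.comp_apply, windowShear, exchangeWindow, sub_sub_cancel, smul_add,
      smul_smul, add_sub_cancel_right]
    ring
  have hH2i : Integrable H2 := by
    rw [hcomp]
    exact hT.integrable_comp_of_integrable hHi
  have hint : ∫ q, H2 q = ∫ q, H q := by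
    have h1 := integral_map hT.measurable.aemeasurable
      (by rw [hT.map_eq]; exact hHi.aestronglyMeasurable)
    rw [hT.map_eq] at h1
    rw [h1, hcomp]; rfl
  have e1 : ∀ᵐ s, weylForm (b s) (windowMul κ s ψ) (windowMul κ s φ) =
      (windowConst d ^ 4 : ℝ) * ∫ w : (Space d × Space d) × Space d, H2 (s, w) := by
    filter_upwards [hH2i.prod_right_ae] with s hsi
    have e5 : ∫ w : (Space d × Space d) × Space d, H2 (s, w) = ∫ z, ∫ η, H2 (s, (z, η)) :=
      integral_prod _ hsi
    rw [e5, (hb s).weylForm_eq, ← integral_const_mul]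
    refine integral_congr_ae (ae_of_all _ fun z => ?_)
    simp only [hH2]
    rw [wigner_windowMul, integral_const_mul, integral_const_mul]
    ring
  rw [integral_congr_ae e1, integral_const_mul]
  congr 1
  have e2 : ∫ s, ∫ w : (Space d × Space d) × Space d, H2 (s, w) = ∫ q, H2 q :=
    (integral_prod _ hH2i).symm
  rw [e2, hint]
  have e3 : ∫ q, H q = ∫ w, ∫ z, H (z, w) := integral_prod_symm _ hHi
  rw [e3]
  exact integral_congr_ae (ae_of_all _ hHw)

/-- The averaging Gaussian is even and has total mass one after normalisation, so the shifts (t, η)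
and -(t, η) can be paired: only symmetric second differences have to be small. -/
lemma norm_inner_sub_integral_window_le {κ : ℝ} {b : Space d → Space d → Space d → ℝ} {B : ℝ}
    (hc : Continuous fun q : Space d × (Space d × Space d) => b q.1 q.2.1 q.2.2)
    (hB : ∀ s x ξ, |b s x ξ| ≤ B) (hb : ∀ s, IsRealSymbol (b s))
    (hs : ∀ t η : Space d, IsRealSymbol fun x ξ => b (κ • x - t) x (ξ - (2 * Real.pi * κ) • η))
    {b₀ : Space d → Space d → ℝ} {A : ℝ} (ψ φ : 𝓢(Space d, ℂ))
    (hA : ∀ t η : Space d, ‖2 * weylForm b₀ ψ φ -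
      weylForm (fun x ξ => b (κ • x - t) x (ξ - (2 * Real.pi * κ) • η)) ψ φ -
      weylForm (fun x ξ => b (κ • x - -t) x (ξ - (2 * Real.pi * κ) • -η)) ψ φ‖ ≤
        A * ((1 + ‖t‖) ^ 2 * (1 + ‖η‖) ^ 2)) :
    ‖weylForm b₀ ψ φ - ∫ s, weylForm (b s) (windowMul κ s ψ) (windowMul κ s φ)‖ ≤
      windowConst d ^ 4 * (∫ t : Space d, (1 + ‖t‖) ^ 2 * gauss (2 * Real.pi) t) ^ 2 * A := by
  obtain ⟨hi, heq⟩ := integral_weylForm_windowMul hc hB hb hs ψ φ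
  rw [heq]
  set g : Space d → ℝ := gauss (2 * Real.pi) with hg
  have hgi : Integrable g := integrable_gauss (by positivity)
  set w4 : ℝ := windowConst d ^ 4 with hw4
  set W : Space d × Space d → ℂ := fun w =>
    weylForm (fun x ξ => b (κ • x - w.1) x (ξ - (2 * Real.pi * κ) • w.2)) ψ φ with hW
  have hmass : w4 * ((∫ t : Space d, g t) * ∫ t : Space d, g t) = 1 := by
    have := windowConst_sq_mul (d := d)
    rw [← hg] at this
    calc _ = (windowConst d ^ 2 * ∫ t : Space d, g t) ^ 2 := by rw [hw4]; ring
      _ = 1 := by rw [this, one_pow]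
  have hG2 : Integrable fun w : Space d × Space d => ((g w.1 * g w.2 : ℝ) : ℂ) :=
    (hgi.mul_prod hgi).ofReal
  have hGint : ∫ w : Space d × Space d, ((g w.1 * g w.2 : ℝ) : ℂ) =
      (((∫ t : Space d, g t) * ∫ t : Space d, g t : ℝ) : ℂ) := by
    refine (integral_ofReal (𝕜 := ℂ)).trans ?_
    congr 1
    exact integral_prod_mul g g
  have hneg : ∫ w : Space d × Space d, ((g w.1 * g w.2 : ℝ) : ℂ) * W w =
      ∫ w : Space d × Space d, ((g w.1 * g w.2 : ℝ) : ℂ) * W (-w) := by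
    have := isNegInvariant_volume_prod d
    rw [← integral_neg_eq_self]
    refine integral_congr_ae (ae_of_all _ fun w => ?_)
    simp only [Prod.fst_neg, Prod.snd_neg, hg, gauss_neg]
  have hi' : Integrable fun w : Space d × Space d => ((g w.1 * g w.2 : ℝ) : ℂ) * W (-w) := by
    have := isNegInvariant_volume_prod d
    have := hi.comp_neg
    refine this.congr (ae_of_all _ fun w => ?_)
    simp only [Prod.fst_neg, Prod.snd_neg, hg, gauss_neg, hW]
  have hdecomp : weylForm b₀ ψ φ - (w4 : ℂ) * ∫ w : Space d × Space d,
      ((g w.1 * g w.2 : ℝ) : ℂ) * W w = (w4 / 2 : ℂ) * ∫ w : Space d × Space d,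
        ((g w.1 * g w.2 : ℝ) : ℂ) * (2 * weylForm b₀ ψ φ - W w - W (-w)) := by
    have e1 : ∫ w : Space d × Space d,
        ((g w.1 * g w.2 : ℝ) : ℂ) * (2 * weylForm b₀ ψ φ - W w - W (-w)) =
        (∫ w : Space d × Space d, ((g w.1 * g w.2 : ℝ) : ℂ)) * (2 * weylForm b₀ ψ φ) -
        (∫ w : Space d × Space d, ((g w.1 * g w.2 : ℝ) : ℂ) * W w) -
        ∫ w : Space d × Space d, ((g w.1 * g w.2 : ℝ) : ℂ) * W (-w) := by
      have t1 := integral_sub' ((hG2.mul_const (2 * weylForm b₀ ψ φ)).sub hi) hi'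
      have t2 := integral_sub' (hG2.mul_const (2 * weylForm b₀ ψ φ)) hi
      rw [t2, integral_mul_const] at t1
      rw [← t1]
      refine integral_congr_ae (ae_of_all _ fun w => ?_)
      simp only [Pi.sub_apply]
      ring
    rw [e1, ← hneg, hGint]
    have hm : (w4 : ℂ) * (((∫ t : Space d, g t) * ∫ t : Space d, g t : ℝ) : ℂ) = 1 := by
      exact_mod_cast hmass
    linear_combination (-weylForm b₀ ψ φ) * hm
  rw [hdecomp, norm_mul]
  have hw4n : ‖(w4 / 2 : ℂ)‖ = w4 / 2 := by
    rw [norm_div, Complex.norm_real, Real.norm_eq_abs, abs_of_nonneg (by positivity)]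
    simp
  have hI := integrable_pow_mul_gauss (V := Space d) (c := 2 * Real.pi) (by positivity) 2
  have hbound : ‖∫ w : Space d × Space d,
      ((g w.1 * g w.2 : ℝ) : ℂ) * (2 * weylForm b₀ ψ φ - W w - W (-w))‖ ≤
      A * (∫ t : Space d, (1 + ‖t‖) ^ 2 * g t) ^ 2 := by
    have e : A * (∫ t : Space d, (1 + ‖t‖) ^ 2 * g t) ^ 2 = ∫ w : Space d × Space d,
        A * (((1 + ‖w.1‖) ^ 2 * g w.1) * ((1 + ‖w.2‖) ^ 2 * g w.2)) := by
      rw [integral_const_mul, sq]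
      congr 1
      exact (integral_prod_mul _ _).symm
    rw [e]
    refine norm_integral_le_of_norm_le ((hI.mul_prod hI).const_mul A) (ae_of_all _ fun w => ?_)
    have hgp : 0 < g w.1 * g w.2 := mul_pos (gauss_pos _ _) (gauss_pos _ _)
    rw [norm_mul, Complex.norm_real, Real.norm_eq_abs, abs_of_pos hgp]
    refine (mul_le_mul_of_nonneg_left (hA w.1 w.2) hgp.le).trans (le_of_eq ?_)
    ring
  rw [hw4n]
  have hA0 : 0 ≤ A := by
    have := (norm_nonneg _).trans (hA 0 0)
    simpa using this
  calc w4 / 2 * _ ≤ w4 / 2 * (A * (∫ t : Space d, (1 + ‖t‖) ^ 2 * g t) ^ 2) := by gcongr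
    _ ≤ w4 * (A * (∫ t : Space d, (1 + ‖t‖) ^ 2 * g t) ^ 2) := by
        have : 0 ≤ w4 := by positivity
        gcongr; linarith
    _ = _ := by ring

end AveragedForm

/-! ### First and second difference estimates for derivatives. -/

section Differences

variable {V W G : Type*} [NormedAddCommGroup V] [NormedSpace ℝ V] [NormedAddCommGroup W]
  [NormedSpace ℝ W] [NormedAddCommGroup G] [NormedSpace ℝ G]

lemma norm_iteratedFDeriv_sub_le {f : W → G} (hf : ContDiff ℝ ∞ f) {n : ℕ} {M : ℝ}
    (hM : ∀ z, ‖iteratedFDeriv ℝ (n + 1) f z‖ ≤ M) (z z' : W) :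
    ‖iteratedFDeriv ℝ n f z' - iteratedFDeriv ℝ n f z‖ ≤ M * ‖z' - z‖ := by
  refine convex_univ.norm_image_sub_le_of_norm_fderiv_le (𝕜 := ℝ) (fun x _ => ?_) (fun x _ => ?_)
    (Set.mem_univ z) (Set.mem_univ z')
  · exact (hf.differentiable_iteratedFDeriv (by exact_mod_cast WithTop.coe_lt_top n)) x
  · rw [norm_fderiv_iteratedFDeriv]; exact hM x

lemma norm_iteratedFDeriv_shift_sub_le {f : W → G} (hf : ContDiff ℝ ∞ f) {n : ℕ} {M : ℝ}
    (hM : ∀ z, ‖iteratedFDeriv ℝ (n + 1) f z‖ ≤ M) (k z : W) :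
    ‖iteratedFDeriv ℝ n (fun z => f (z + k) - f z) z‖ ≤ M * ‖k‖ := by
  have hf' : ContDiff ℝ ∞ fun z => f (z + k) := hf.comp (by fun_prop)
  rw [fun_iteratedFDeriv_sub_apply (hf'.contDiffAt.of_le (by exact_mod_cast le_top))
    (hf.contDiffAt.of_le (by exact_mod_cast le_top)), iteratedFDeriv_comp_add_right]
  simpa using norm_iteratedFDeriv_sub_le hf hM z (z + k)

/-- The second difference is the first difference with step -k of the first difference with step k.
-/
lemma norm_iteratedFDeriv_second_difference_le {f : W → G} (hf : ContDiff ℝ ∞ f) {n : ℕ} {M : ℝ}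
    (hM : ∀ z, ‖iteratedFDeriv ℝ (n + 2) f z‖ ≤ M) (k z : W) :
    ‖iteratedFDeriv ℝ n (fun z => (2 : ℝ) • f z - f (z + k) - f (z - k)) z‖ ≤ M * ‖k‖ ^ 2 := by
  have hg : ContDiff ℝ ∞ fun z => f (z + k) - f z := by
    have : ContDiff ℝ ∞ fun z => f (z + k) := hf.comp (by fun_prop)
    exact this.sub hf
  have h := norm_iteratedFDeriv_shift_sub_le hg (n := n) (M := M * ‖k‖)
    (fun z => norm_iteratedFDeriv_shift_sub_le hf hM k z) (-k) z
  have e : (fun z => (2 : ℝ) • f z - f (z + k) - f (z - k)) =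
      fun z => (fun z => f (z + k) - f z) (z + -k) - (fun z => f (z + k) - f z) z := by
    funext z
    simp only [← sub_eq_add_neg, sub_add_cancel]
    module
  rw [e]
  refine h.trans (le_of_eq ?_)
  rw [norm_neg]; ring

lemma norm_compContinuousLinearMap_sub_le {n : ℕ}
    (q : ContinuousMultilinearMap ℝ (fun _ : Fin n => W) G) {L₁ L₂ : V →L[ℝ] W}
    (h₁ : ‖L₁‖ ≤ 1) (h₂ : ‖L₂‖ ≤ 1) :
    ‖q.compContinuousLinearMap (fun _ => L₁) - q.compContinuousLinearMap (fun _ => L₂)‖ ≤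
      ‖q‖ * (n * ‖L₁ - L₂‖) := by
  refine ContinuousMultilinearMap.opNorm_le_bound (by positivity) fun x => ?_
  rw [sub_apply, ContinuousMultilinearMap.compContinuousLinearMap_apply,
    ContinuousMultilinearMap.compContinuousLinearMap_apply]
  refine (q.norm_image_sub_le' _ _).trans ?_
  rw [mul_assoc]
  refine mul_le_mul_of_nonneg_left ?_ (norm_nonneg _)
  have h : ∀ i ∈ Finset.univ, (∏ j : Fin n, if j = i then ‖L₁ (x i) - L₂ (x i)‖ else
      max ‖L₁ (x j)‖ ‖L₂ (x j)‖) ≤ ‖L₁ - L₂‖ * ∏ j, ‖x j‖ := by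
    intro i _
    have h1 : ∏ j : Fin n, (if j = i then ‖L₁ (x i) - L₂ (x i)‖ else
        max ‖L₁ (x j)‖ ‖L₂ (x j)‖) ≤ ∏ j : Fin n, (if j = i then ‖L₁ - L₂‖ else 1) * ‖x j‖ := by
      refine Finset.prod_le_prod (fun j _ => by split_ifs <;> positivity) fun j _ => ?_
      split_ifs with hj
      · rw [hj]
        simpa using (L₁ - L₂).le_opNorm (x i)
      · rw [one_mul]
        refine max_le ((L₁.le_opNorm _).trans ?_) ((L₂.le_opNorm _).trans ?_)
        · exact mul_le_of_le_one_left (norm_nonneg _) h₁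
        · exact mul_le_of_le_one_left (norm_nonneg _) h₂
    refine h1.trans (le_of_eq ?_)
    rw [Finset.prod_mul_distrib, Finset.prod_ite_eq' Finset.univ i]
    simp
  refine (Finset.sum_le_card_nsmul _ _ _ h).trans (le_of_eq ?_)
  simp [mul_assoc]

/-- The derivative of order n + 1 controls the change of base point; exchanging the linear part in
the n slots one at a time gives the second term. -/
lemma norm_iteratedFDeriv_comp_affine_sub_le {f : W → G} (hf : ContDiff ℝ ∞ f) {n : ℕ} {M : ℝ}
    (hM : ∀ j, n ≤ j → j ≤ n + 1 → ∀ z, ‖iteratedFDeriv ℝ j f z‖ ≤ M) {L₁ L₂ : V →L[ℝ] W}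
    (h₁ : ‖L₁‖ ≤ 1) (h₂ : ‖L₂‖ ≤ 1) (c₁ c₂ : W) (v : V) :
    ‖iteratedFDeriv ℝ n (fun v => f (L₁ v + c₁) - f (L₂ v + c₂)) v‖ ≤
      M * (‖(L₁ v + c₁) - (L₂ v + c₂)‖ + n * ‖L₁ - L₂‖) := by
  have hs : ∀ (L : V →L[ℝ] W) (c : W), ContDiff ℝ ∞ fun v => f (L v + c) := fun L c =>
    hf.comp (L.contDiff.add contDiff_const)
  rw [fun_iteratedFDeriv_sub_apply ((hs L₁ c₁).contDiffAt.of_le (by exact_mod_cast le_top))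
    ((hs L₂ c₂).contDiffAt.of_le (by exact_mod_cast le_top)), iteratedFDeriv_comp_affine hf,
    iteratedFDeriv_comp_affine hf]
  set q₁ := iteratedFDeriv ℝ n f (L₁ v + c₁)
  set q₂ := iteratedFDeriv ℝ n f (L₂ v + c₂)
  have e : q₁.compContinuousLinearMap (fun _ => L₁) - q₂.compContinuousLinearMap (fun _ => L₂) =
      (q₁ - q₂).compContinuousLinearMap (fun _ => L₁) +
      (q₂.compContinuousLinearMap (fun _ => L₁) - q₂.compContinuousLinearMap (fun _ => L₂)) := by
    ext x; simp
  rw [e, mul_add]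
  refine (norm_add_le _ _).trans (add_le_add ?_ ?_)
  · refine (ContinuousMultilinearMap.norm_compContinuousLinearMap_le _ _).trans ?_
    rw [Finset.prod_const, Finset.card_univ, Fintype.card_fin]
    refine (mul_le_of_le_one_right (norm_nonneg _) (pow_le_one₀ (norm_nonneg _) h₁)).trans ?_
    exact norm_iteratedFDeriv_sub_le hf (fun z => hM (n + 1) (by omega) le_rfl z) _ _
  · refine (norm_compContinuousLinearMap_sub_le q₂ h₁ h₂).trans ?_
    exact mul_le_mul_of_nonneg_right (hM n le_rfl (by omega) _) (by positivity)

lemma norm_iteratedFDeriv_continuousLinearMap_le (L : V →L[ℝ] W) {i : ℕ} (hi : 1 ≤ i) (v : V) :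
    ‖iteratedFDeriv ℝ i L v‖ ≤ ‖L‖ := by
  obtain ⟨j, rfl⟩ : ∃ j, i = j + 1 := ⟨i - 1, by omega⟩
  rw [← norm_iteratedFDeriv_fderiv]
  have : fderiv ℝ L = fun _ => L := by funext x; exact L.fderiv
  rw [this]
  rcases Nat.eq_zero_or_pos j with rfl | hj
  · rw [norm_iteratedFDeriv_zero]
  · rw [iteratedFDeriv_const_of_ne hj.ne']
    simp

end Differences

/-! ### One smooth function behind all symbols. -/

section ShiftedSymbol

variable {d : ℕ}

/-- The function `((X, ξ), (h, k)) ↦ a (X + F h, ξ + k)`. -/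
def shiftedSymbol (a : Space d → Space d → ℝ) (F : Space d → Space d)
    (q : (Space d × Space d) × (Space d × Space d)) : ℝ := a (q.1.1 + F q.2.1) (q.1.2 + q.2.2)

/-- Bounds for the derivatives of `a` of order at most `N` and for those of `F` of order between
`1` and `N`. -/
structure HasDerivBounds (N : ℕ) (A : ℝ) (a : Space d → Space d → ℝ)
    (F : Space d → Space d) : Prop where
  symbol : IsRealSymbol a
  field : IsAdmissibleField F
  symbol_le : ∀ n ≤ N, ∀ z, ‖iteratedFDeriv ℝ n (Function.uncurry a) z‖ ≤ A
  field_le : ∀ n, 1 ≤ n → n ≤ N → ∀ x, ‖iteratedFDeriv ℝ n F x‖ ≤ A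

lemma contDiff_shiftedSymbol {a : Space d → Space d → ℝ} {F : Space d → Space d}
    (ha : IsRealSymbol a) (hF : IsAdmissibleField F) : ContDiff ℝ ∞ (shiftedSymbol a F) := by
  have h : ContDiff ℝ ∞ fun q : (Space d × Space d) × (Space d × Space d) =>
      (q.1.1 + F q.2.1, q.1.2 + q.2.2) := by
    have := hF.1
    fun_prop
  exact ha.1.comp h

/-- The field itself may be unbounded, but the chain rule only sees derivatives of the inner map of
order at least one, and a is bounded wherever it is evaluated. -/
lemma norm_iteratedFDeriv_shiftedSymbol_le {N : ℕ} {A : ℝ} {a : Space d → Space d → ℝ}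
    {F : Space d → Space d} (h : HasDerivBounds N A a F) {n : ℕ} (hn : n ≤ N)
    (q : (Space d × Space d) × (Space d × Space d)) :
    ‖iteratedFDeriv ℝ n (shiftedSymbol a F) q‖ ≤ N.factorial * A * (2 + A) ^ N := by
  have hA : 0 ≤ A := (norm_nonneg _).trans (h.symbol_le 0 (Nat.zero_le _) 0)
  let L : (Space d × Space d) × (Space d × Space d) →L[ℝ] Space d × Space d :=
    ContinuousLinearMap.fst ℝ _ _ + (ContinuousLinearMap.inr ℝ (Space d) (Space d)).comp
      ((ContinuousLinearMap.snd ℝ (Space d) (Space d)).comp (ContinuousLinearMap.snd ℝ _ _))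
  let I : Space d →L[ℝ] Space d × Space d := ContinuousLinearMap.inl ℝ _ _
  let Q : (Space d × Space d) × (Space d × Space d) →L[ℝ] Space d :=
    (ContinuousLinearMap.fst ℝ (Space d) (Space d)).comp (ContinuousLinearMap.snd ℝ _ _)
  have hLn : ‖L‖ ≤ 2 := by
    refine ContinuousLinearMap.opNorm_le_bound _ (by norm_num) fun q => ?_
    have h1 : ‖L q‖ ≤ ‖q.1‖ + ‖q.2‖ := by
      have : L q = q.1 + (0, q.2.2) := by simp [L]
      rw [this]
      refine (norm_add_le _ _).trans (add_le_add le_rfl ?_)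
      rw [Prod.norm_mk, norm_zero, max_eq_right (norm_nonneg _)]
      exact norm_snd_le _
    linarith [norm_fst_le q, norm_snd_le q]
  have hQn : ‖Q‖ ≤ 1 := ContinuousLinearMap.opNorm_le_bound _ zero_le_one fun q => by
    rw [one_mul]
    exact (norm_fst_le q.2).trans (norm_snd_le q)
  have hIn : ‖I‖ ≤ 1 := ContinuousLinearMap.norm_inl_le_one ℝ _ _
  let β : (Space d × Space d) × (Space d × Space d) → Space d × Space d :=
    fun q => L q + I (F (Q q + 0))
  have hFQ : ContDiff ℝ ∞ fun q => F (Q q + 0) :=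
    h.field.1.comp (Q.contDiff.add contDiff_const)
  have hβ : ContDiff ℝ ∞ β := L.contDiff.add (I.contDiff.comp hFQ)
  have e : shiftedSymbol a F = Function.uncurry a ∘ β := by
    funext q
    simp [shiftedSymbol, β, L, I, Q, Function.uncurry]
  have hD : ∀ i, 1 ≤ i → i ≤ n → ‖iteratedFDeriv ℝ i β q‖ ≤ (2 + A) ^ i := by
    intro i hi hin
    have h1 : ‖iteratedFDeriv ℝ i β q‖ ≤ 2 + A := by
      have e1 : iteratedFDeriv ℝ i β q = iteratedFDeriv ℝ i L q +
          iteratedFDeriv ℝ i (fun q => I (F (Q q + 0))) q :=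
        fun_iteratedFDeriv_add_apply (L.contDiff.contDiffAt)
          ((I.contDiff.comp hFQ).contDiffAt.of_le (by exact_mod_cast le_top))
      rw [e1]
      refine (norm_add_le _ _).trans (add_le_add
        ((norm_iteratedFDeriv_continuousLinearMap_le L hi q).trans hLn) ?_)
      have h2 := I.norm_iteratedFDeriv_comp_left (f := fun q => F (Q q + 0)) (x := q) (N := ∞)
        hFQ.contDiffAt (n := i) (by exact_mod_cast le_top)
      refine h2.trans ((mul_le_of_le_one_left (norm_nonneg _) hIn).trans ?_)
      refine (norm_iteratedFDeriv_comp_affine_le h.field.1 Q 0 i q).trans ?_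
      exact (mul_le_of_le_one_right (norm_nonneg _) (pow_le_one₀ (norm_nonneg _) hQn)).trans
        (h.field_le i hi (hin.trans hn) _)
    exact h1.trans (le_self_pow₀ (by linarith) (by omega))
  rw [e]
  refine (norm_iteratedFDeriv_comp_le h.symbol.1 hβ (by exact_mod_cast le_top) q
    (fun i hi => h.symbol_le i (hi.trans hn) _) hD).trans ?_
  have h3 : (n.factorial : ℝ) ≤ N.factorial := by exact_mod_cast Nat.factorial_le hn
  have h4 : (2 + A) ^ n ≤ (2 + A) ^ N := pow_le_pow_right₀ (by linarith) hn
  gcongr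

end ShiftedSymbol

/-! ### Comparison of perturbed and frozen symbols. -/

section SymbolFamilies

variable {d : ℕ}

lemma exists_hasDerivBounds {a : Space d → Space d → ℝ} {F : Space d → Space d}
    (ha : IsRealSymbol a) (hF : IsAdmissibleField F) (N : ℕ) : ∃ A, HasDerivBounds N A a F := by
  obtain ⟨A₁, hA₁, h₁⟩ := ha.exists_bound_le N
  choose! B hB using hF.2
  have h2 : ∀ n, 1 ≤ n → n ≤ N → B n ≤ ∑ n ∈ Finset.range (N + 1), |B n| := fun n _ hn =>
    (le_abs_self _).trans (Finset.single_le_sum (f := fun n => |B n|) (fun _ _ => abs_nonneg _)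
      (Finset.mem_range.2 (by omega)))
  have h3 : 0 ≤ ∑ n ∈ Finset.range (N + 1), |B n| := Finset.sum_nonneg fun _ _ => abs_nonneg _
  exact ⟨A₁ + ∑ n ∈ Finset.range (N + 1), |B n|, ha, hF,
    fun n hn z => (h₁ n hn z).trans (by linarith),
    fun n hn hnN x => (hB n hn x).trans ((h2 n hn hnN).trans (by linarith))⟩

lemma isRealSymbol_shiftedSymbol_comp {a : Space d → Space d → ℝ} {F : Space d → Space d}
    (ha : IsRealSymbol a) (hF : IsAdmissibleField F)
    (L : Space d × Space d →L[ℝ] (Space d × Space d) × (Space d × Space d))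
    (c : (Space d × Space d) × (Space d × Space d)) :
    IsRealSymbol fun x ξ => shiftedSymbol a F (L (x, ξ) + c) := by
  have e : Function.uncurry (fun x ξ => shiftedSymbol a F (L (x, ξ) + c)) =
      fun v => shiftedSymbol a F (L v + c) := rfl
  have hs := contDiff_shiftedSymbol ha hF
  refine ⟨by rw [e]; exact hs.comp (L.contDiff.add contDiff_const), fun n => ?_⟩
  obtain ⟨A, hA⟩ := exists_hasDerivBounds ha hF n
  refine ⟨n.factorial * A * (2 + A) ^ n * ‖L‖ ^ n, fun v => ?_⟩
  rw [e]
  refine (norm_iteratedFDeriv_comp_affine_le hs L c n v).trans ?_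
  gcongr
  exact norm_iteratedFDeriv_shiftedSymbol_le hA le_rfl _

lemma norm_zero_prodMk {V W : Type*} [SeminormedAddCommGroup V] [SeminormedAddCommGroup W] (w : W) :
    ‖((0, w) : V × W)‖ = ‖w‖ := by
  rw [Prod.norm_mk, norm_zero, max_eq_right (norm_nonneg _)]

lemma norm_prodMk_zero {V W : Type*} [SeminormedAddCommGroup V] [SeminormedAddCommGroup W] (v : V) :
    ‖((v, 0) : V × W)‖ = ‖v‖ := by
  rw [Prod.norm_mk, norm_zero, max_eq_left (norm_nonneg _)]

/-- The linear map `(x, ξ) ↦ ((x, ξ), (δ x, 0))`. -/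
noncomputable def tilt (δ : ℝ) :
    Space d × Space d →L[ℝ] (Space d × Space d) × (Space d × Space d) :=
  (ContinuousLinearMap.id ℝ _).prod
    ((δ • ContinuousLinearMap.fst ℝ (Space d) (Space d)).prod 0)

lemma tilt_apply (δ : ℝ) (v : Space d × Space d) : tilt δ v = (v, (δ • v.1, 0)) := by
  simp [tilt]

lemma norm_tilt_le {δ : ℝ} (hδ : |δ| ≤ 1) :
    ‖(tilt δ : Space d × Space d →L[ℝ] _)‖ ≤ 1 := by
  refine ContinuousLinearMap.opNorm_le_bound _ zero_le_one fun v => ?_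
  rw [tilt_apply, one_mul, Prod.norm_mk (x := v), norm_prodMk_zero, norm_smul, Real.norm_eq_abs]
  exact max_le le_rfl ((mul_le_of_le_one_left (norm_nonneg _) hδ).trans (norm_fst_le v))

lemma norm_tilt_sub_le (δ : ℝ) :
    ‖(tilt δ - tilt 0 : Space d × Space d →L[ℝ] _)‖ ≤ |δ| := by
  refine ContinuousLinearMap.opNorm_le_bound _ (abs_nonneg _) fun v => ?_
  have e : (tilt δ - tilt 0 : Space d × Space d →L[ℝ] _) v = (0, (δ • v.1, 0)) := by
    rw [sub_apply, tilt_apply, tilt_apply]; simp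
  rw [e, norm_zero_prodMk, norm_prodMk_zero, norm_smul, Real.norm_eq_abs]
  exact mul_le_mul_of_nonneg_left (norm_fst_le v) (abs_nonneg _)

/-- Perturbed and frozen symbols are pullbacks of the same function by affine maps, so comparing
them reduces to comparing these maps. -/
lemma perturbedSymbol_eq (a : Space d → Space d → ℝ) (F : Space d → Space d) (δ : ℝ) :
    perturbedSymbol a F δ = fun x ξ => shiftedSymbol a F (tilt δ (x, ξ) + 0) := by
  funext x ξ
  simp [perturbedSymbol, shiftedSymbol, tilt_apply]

/-- The symbol `(x, ξ) ↦ a (x + F h, ξ)`, in which the argument of the field is frozen. -/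
def frozenSymbol (a : Space d → Space d → ℝ) (F : Space d → Space d) (h : Space d) :
    Space d → Space d → ℝ := fun x ξ => a (x + F h) ξ

lemma frozenSymbol_eq (a : Space d → Space d → ℝ) (F : Space d → Space d) (h : Space d) :
    frozenSymbol a F h = fun x ξ => shiftedSymbol a F (tilt 0 (x, ξ) + (0, (h, 0))) := by
  funext x ξ
  simp [frozenSymbol, shiftedSymbol, tilt_apply]

lemma frozenSymbol_shift_eq (a : Space d → Space d → ℝ) (F : Space d → Space d) (κ τ : ℝ)
    (t k : Space d) :
    (fun x ξ => frozenSymbol a F (τ • (κ • x - t)) x (ξ - k)) =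
      fun x ξ => shiftedSymbol a F (tilt (τ * κ) (x, ξ) + (0, (-(τ • t), -k))) := by
  funext x ξ
  simp [frozenSymbol, shiftedSymbol, tilt_apply, smul_smul, sub_eq_add_neg]

lemma IsRealSymbol.perturbedSymbol {a : Space d → Space d → ℝ} {F : Space d → Space d}
    (ha : IsRealSymbol a) (hF : IsAdmissibleField F) (δ : ℝ) :
    IsRealSymbol (perturbedSymbol a F δ) := by
  rw [perturbedSymbol_eq]; exact isRealSymbol_shiftedSymbol_comp ha hF _ _

lemma IsRealSymbol.frozenSymbol {a : Space d → Space d → ℝ} {F : Space d → Space d}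
    (ha : IsRealSymbol a) (hF : IsAdmissibleField F) (h : Space d) :
    IsRealSymbol (frozenSymbol a F h) := by
  rw [frozenSymbol_eq]; exact isRealSymbol_shiftedSymbol_comp ha hF _ _

lemma continuous_frozenSymbol {a : Space d → Space d → ℝ} {F : Space d → Space d}
    (ha : IsRealSymbol a) (hF : IsAdmissibleField F) (τ : ℝ) :
    Continuous fun q : Space d × (Space d × Space d) =>
      frozenSymbol a F (τ • q.1) q.2.1 q.2.2 := by
  have h1 := hF.1.continuous
  have h2 := ha.1.continuous
  exact h2.comp (by fun_prop : Continuous fun q : Space d × (Space d × Space d) =>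
    (q.2.1 + F (τ • q.1), q.2.2))

/-- The bound for the derivatives of the shifted symbol of order at most `2d + 4`. -/
noncomputable def shiftBound (d : ℕ) (A : ℝ) : ℝ :=
  (2 * d + 4).factorial * A * (2 + A) ^ (2 * d + 4)

variable {A : ℝ} {a : Space d → Space d → ℝ} {F : Space d → Space d}

lemma HasDerivBounds.nonneg {N : ℕ} (h : HasDerivBounds N A a F) : 0 ≤ A :=
  (norm_nonneg _).trans (h.symbol_le 0 (Nat.zero_le _) 0)

lemma HasDerivBounds.shiftBound_nonneg {N : ℕ} (h : HasDerivBounds N A a F) :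
    0 ≤ shiftBound d A := by
  have := h.nonneg
  unfold shiftBound; positivity

lemma HasDerivBounds.contDiff {N : ℕ} (h : HasDerivBounds N A a F) :
    ContDiff ℝ ∞ (shiftedSymbol a F) := contDiff_shiftedSymbol h.symbol h.field

lemma HasDerivBounds.shifted_le (h : HasDerivBounds (2 * d + 4) A a F) {n : ℕ}
    (hn : n ≤ 2 * d + 4) (q : (Space d × Space d) × (Space d × Space d)) :
    ‖iteratedFDeriv ℝ n (shiftedSymbol a F) q‖ ≤ shiftBound d A :=
  norm_iteratedFDeriv_shiftedSymbol_le h hn q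

lemma HasDerivBounds.perturbedSymbol_le (h : HasDerivBounds (2 * d + 4) A a F) {δ : ℝ}
    (hδ : |δ| ≤ 1) {n : ℕ} (hn : n ≤ 2 * d + 4) (z : Space d × Space d) :
    ‖iteratedFDeriv ℝ n (Function.uncurry (perturbedSymbol a F δ)) z‖ ≤ shiftBound d A := by
  rw [perturbedSymbol_eq]
  refine (norm_iteratedFDeriv_comp_affine_le h.contDiff (tilt δ) 0 n z).trans ?_
  exact (mul_le_of_le_one_right (norm_nonneg _) (pow_le_one₀ (norm_nonneg _)
    (norm_tilt_le hδ))).trans (h.shifted_le hn _)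

lemma HasDerivBounds.modulation_le (h : HasDerivBounds (2 * d + 4) A a F) {δ : ℝ}
    (hδ : |δ| ≤ 1) {n : ℕ} (hn : n ≤ 2 * d + 2) (k : Space d) (z : Space d × Space d) :
    ‖iteratedFDeriv ℝ n (Function.uncurry fun x ξ =>
      perturbedSymbol a F δ x (ξ + k) - perturbedSymbol a F δ x ξ) z‖ ≤ shiftBound d A * ‖k‖ := by
  have e : (Function.uncurry fun x ξ =>
      perturbedSymbol a F δ x (ξ + k) - perturbedSymbol a F δ x ξ) = fun z =>
      Function.uncurry (perturbedSymbol a F δ) (z + (0, k)) -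
        Function.uncurry (perturbedSymbol a F δ) z := by
    funext z; simp [Function.uncurry]
  rw [e]
  refine (norm_iteratedFDeriv_shift_sub_le (h.symbol.perturbedSymbol h.field δ).1
    (fun z => h.perturbedSymbol_le hδ (by omega) z) _ z).trans (le_of_eq ?_)
  simp [Prod.norm_mk]

lemma HasDerivBounds.frozen_sub_le (h : HasDerivBounds (2 * d + 4) A a F) {n : ℕ}
    (hn : n ≤ 2 * d + 2) (y y' : Space d) (z : Space d × Space d) :
    ‖iteratedFDeriv ℝ n (Function.uncurry fun x ξ =>
      frozenSymbol a F y x ξ - frozenSymbol a F y' x ξ) z‖ ≤ shiftBound d A * ‖y - y'‖ := by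
  simp only [frozenSymbol_eq]
  refine (norm_iteratedFDeriv_comp_affine_sub_le h.contDiff (M := shiftBound d A)
    (fun j _ hj z => h.shifted_le (by omega) z) (norm_tilt_le (by simp)) (norm_tilt_le (by simp))
    (0, (y, 0)) (0, (y', 0)) z).trans (le_of_eq ?_)
  simp [Prod.norm_mk]

/-- The field is evaluated at τκx and at τs, which differ by τ(κx - s); the linear parts of the two
affine maps differ by at most |τκ| ≤ |τ|. Together these give the weight 1 + ‖κx - s‖ centred at the
window. -/
lemma HasDerivBounds.perturbed_sub_frozen_le (h : HasDerivBounds (2 * d + 4) A a F) {κ τ : ℝ}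
    (hκ : |κ| ≤ 1) (hτ : |τ| ≤ 1) {n : ℕ} (hn : n ≤ 2 * d + 2) (s : Space d)
    (z : Space d × Space d) :
    ‖iteratedFDeriv ℝ n (Function.uncurry fun x ξ =>
      perturbedSymbol a F (τ * κ) x ξ - frozenSymbol a F (τ • s) x ξ) z‖ ≤
        shiftBound d A * ((2 * d + 3) * |τ|) * (1 + ‖κ • z.1 - s‖) := by
  have hδ : |τ * κ| ≤ 1 := by
    rw [abs_mul]; exact mul_le_one₀ hτ (abs_nonneg _) hκ
  simp only [frozenSymbol_eq, perturbedSymbol_eq]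
  refine (norm_iteratedFDeriv_comp_affine_sub_le h.contDiff (M := shiftBound d A)
    (fun j _ hj z => h.shifted_le (by omega) z) (norm_tilt_le hδ) (norm_tilt_le (by simp))
    0 (0, (τ • s, 0)) z).trans ?_
  rw [mul_assoc]
  refine mul_le_mul_of_nonneg_left ?_ h.shiftBound_nonneg
  have e : (tilt (τ * κ) z + 0) - (tilt 0 z + ((0, (τ • s, 0)) :
      (Space d × Space d) × (Space d × Space d))) = (0, (τ • (κ • z.1 - s), 0)) := by
    rw [tilt_apply, tilt_apply]
    simp [smul_sub, smul_smul]
  have e2 : ‖((0, (τ • (κ • z.1 - s), 0)) : (Space d × Space d) × (Space d × Space d))‖ =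
      |τ| * ‖κ • z.1 - s‖ := by
    rw [norm_zero_prodMk, norm_prodMk_zero, norm_smul, Real.norm_eq_abs]
  rw [e, e2]
  have h1 := norm_tilt_sub_le (d := d) (τ * κ)
  have h2 : |τ * κ| ≤ |τ| := by
    rw [abs_mul]; exact mul_le_of_le_one_right (abs_nonneg _) hκ
  have h3 : (n : ℝ) ≤ 2 * d + 2 := by exact_mod_cast hn
  have h4 : (n : ℝ) * ‖(tilt (τ * κ) - tilt 0 : Space d × Space d →L[ℝ] _)‖ ≤
      (2 * d + 2) * |τ| := mul_le_mul h3 (h1.trans h2) (norm_nonneg _) (by positivity)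
  have h5 : 0 ≤ (2 * (d : ℝ) + 2) * |τ| * ‖κ • z.1 - s‖ := by positivity
  nlinarith [abs_nonneg τ]

/-- Inside `shiftedSymbol` the two frozen symbols are the perturbed one displaced by opposite
vectors, so the first order cancels. The expression is bracketed as a difference of differences to
match `weylForm_sub`. -/
lemma HasDerivBounds.second_difference_le (h : HasDerivBounds (2 * d + 4) A a F) {κ τ : ℝ}
    (hκ : |κ| ≤ 1) (hτ : |τ| ≤ 1) {n : ℕ} (hn : n ≤ 2 * d + 2) (t k : Space d)
    (z : Space d × Space d) :
    ‖iteratedFDeriv ℝ n (Function.uncurry fun x ξ =>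
      (perturbedSymbol a F (τ * κ) x ξ - frozenSymbol a F (τ • (κ • x - t)) x (ξ - k)) -
      (frozenSymbol a F (τ • (κ • x - -t)) x (ξ - -k) - perturbedSymbol a F (τ * κ) x ξ)) z‖ ≤
        shiftBound d A * max (|τ| * ‖t‖) ‖k‖ ^ 2 := by
  have hδ : |τ * κ| ≤ 1 := by
    rw [abs_mul]; exact mul_le_one₀ hτ (abs_nonneg _) hκ
  set q : (Space d × Space d) × (Space d × Space d) := (0, (-(τ • t), -k)) with hq
  set f : (Space d × Space d) × (Space d × Space d) → ℝ := fun v =>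
    (2 : ℝ) • shiftedSymbol a F v - shiftedSymbol a F (v + q) - shiftedSymbol a F (v - q) with hf
  have e : (Function.uncurry fun x ξ =>
      (perturbedSymbol a F (τ * κ) x ξ - frozenSymbol a F (τ • (κ • x - t)) x (ξ - k)) -
      (frozenSymbol a F (τ • (κ • x - -t)) x (ξ - -k) - perturbedSymbol a F (τ * κ) x ξ)) =
      fun v => f (tilt (τ * κ) v + 0) := by
    funext v
    have h1 := congrFun (congrFun (frozenSymbol_shift_eq a F κ τ t k) v.1) v.2
    have h2 := congrFun (congrFun (frozenSymbol_shift_eq a F κ τ (-t) (-k)) v.1) v.2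
    have hq2 : ((0, (-(τ • -t), - -k)) : (Space d × Space d) × (Space d × Space d)) = -q := by
      simp [hq]
    rw [hq2, ← sub_eq_add_neg] at h2
    simp only [Function.uncurry, hf]
    rw [h1, h2, perturbedSymbol_eq]
    simp only [add_zero, smul_eq_mul, Prod.mk.eta]
    ring
  have hs := h.contDiff
  have hfs : ContDiff ℝ ∞ f := by
    have h1 : ContDiff ℝ ∞ fun v => shiftedSymbol a F (v + q) := hs.comp (by fun_prop)
    have h2 : ContDiff ℝ ∞ fun v => shiftedSymbol a F (v - q) := hs.comp (by fun_prop)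
    have h0 : ContDiff ℝ ∞ fun v => (2 : ℝ) • shiftedSymbol a F v := hs.const_smul (2 : ℝ)
    exact (h0.sub h1).sub h2
  rw [e]
  refine (norm_iteratedFDeriv_comp_affine_le hfs (tilt (τ * κ)) 0 n z).trans ?_
  refine (mul_le_of_le_one_right (norm_nonneg _) (pow_le_one₀ (norm_nonneg _)
    (norm_tilt_le hδ))).trans ?_
  refine (norm_iteratedFDeriv_second_difference_le hs
    (fun v => h.shifted_le (by omega) v) q _).trans (le_of_eq ?_)
  congr 2
  rw [hq, norm_zero_prodMk, Prod.norm_mk, norm_neg, norm_neg, norm_smul, Real.norm_eq_abs]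

end SymbolFamilies

/-! ### The commutator, freezing and averaging errors. -/

section Comparison

variable {d : ℕ}

/-- The moment of the squared window. -/
noncomputable def windowMoment (d : ℕ) : ℝ :=
  ∫ t : Space d, (1 + ‖t‖) ^ 2 * gauss (2 * Real.pi) t

lemma windowMoment_nonneg : 0 ≤ windowMoment d :=
  integral_nonneg fun t => by have := gauss_pos (2 * Real.pi) t; positivity

variable {A : ℝ} {a : Space d → Space d → ℝ} {F : Space d → Space d}

lemma HasDerivBounds.norm_perturbedOp_le {C : ℝ}
    (hC : ∀ (b : Space d → Space d → ℝ) (M : ℝ), IsRealSymbol b → 0 ≤ M →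
      (∀ n ≤ 2 * d + 2, ∀ z, ‖iteratedFDeriv ℝ n (Function.uncurry b) z‖ ≤ M) → ‖weylOp b‖ ≤ C * M)
    (h : HasDerivBounds (2 * d + 4) A a F) {δ : ℝ} (hδ : |δ| ≤ 1) :
    ‖perturbedOp a F δ‖ ≤ C * shiftBound d A :=
  hC _ _ (h.symbol.perturbedSymbol h.field δ) h.shiftBound_nonneg
    fun n hn z => h.perturbedSymbol_le hδ (by omega) z

lemma HasDerivBounds.continuous_frozenOp {C : ℝ}
    (hC : ∀ (b : Space d → Space d → ℝ) (M : ℝ), IsRealSymbol b → 0 ≤ M →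
      (∀ n ≤ 2 * d + 2, ∀ z, ‖iteratedFDeriv ℝ n (Function.uncurry b) z‖ ≤ M) → ‖weylOp b‖ ≤ C * M)
    (hC0 : 0 ≤ C) (h : HasDerivBounds (2 * d + 4) A a F) :
    Continuous fun y => weylOp (frozenSymbol a F y) := by
  have hs := h.symbol.frozenSymbol h.field
  have hM := h.shiftBound_nonneg
  refine (LipschitzWith.of_dist_le_mul (K := (C * shiftBound d A).toNNReal)
    fun y y' => ?_).continuous
  rw [dist_eq_norm, dist_eq_norm, ← weylOp_sub (hs y) (hs y')]
  refine (hC _ _ ((hs y).sub (hs y')) (mul_nonneg hM (norm_nonneg (y - y'))) fun n hn z =>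
    h.frozen_sub_le hn y y' z).trans (le_of_eq ?_)
  rw [Real.coe_toNNReal _ (by positivity)]; ring

/-- The characters making up a window have frequency κη, so their commutators quantize symbol
differences over a frequency step 2πκη. This is the source of the factor κ². -/
lemma HasDerivBounds.lintegral_commutator_le {C : ℝ}
    (hC : ∀ (b : Space d → Space d → ℝ) (M : ℝ), IsRealSymbol b → 0 ≤ M →
      (∀ n ≤ 2 * d + 2, ∀ z, ‖iteratedFDeriv ℝ n (Function.uncurry b) z‖ ≤ M) → ‖weylOp b‖ ≤ C * M)
    (hC0 : 0 ≤ C) (h : HasDerivBounds (2 * d + 4) A a F) {κ δ : ℝ} (hκ : 0 ≤ κ) (hδ : |δ| ≤ 1)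
    (φ : 𝓢(Space d, ℂ)) :
    ∫⁻ s, ‖mulOp (window κ s) (perturbedOp a F δ (toL2 φ)) -
        perturbedOp a F δ (mulOp (window κ s) (toL2 φ))‖ₑ ^ 2 ≤
      ENNReal.ofReal (windowConst d ^ 2 * windowMoment d *
        (2 * Real.pi * C * shiftBound d A) ^ 2 * κ ^ 2 * ‖toL2 φ‖ ^ 2) := by
  have hM := h.shiftBound_nonneg
  have hs := h.symbol.perturbedSymbol h.field δ
  refine (lintegral_commutator_window κ (perturbedOp a F δ) (toL2 φ)
    (A := 2 * Real.pi * C * shiftBound d A * κ * ‖toL2 φ‖) (by positivity) fun η => ?_).trans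
    (le_of_eq ?_)
  · refine (norm_commutator_phase_le hs (κ • η) φ).trans ?_
    have h2 := hs.comp_add 0 (-((2 * Real.pi) • κ • η))
    simp only [add_zero] at h2
    have h3 := hC _ _ (h2.sub hs) (mul_nonneg hM (norm_nonneg _))
      fun n hn z => h.modulation_le hδ hn (-((2 * Real.pi) • κ • η)) z
    have h4 : ‖-((2 * Real.pi) • κ • η)‖ = 2 * Real.pi * (κ * ‖η‖) := by
      rw [norm_neg, norm_smul, norm_smul, Real.norm_eq_abs, Real.norm_eq_abs, abs_of_nonneg hκ,
        abs_of_pos (by positivity)]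
    rw [h4] at h3
    refine (mul_le_mul_of_nonneg_right h3 (norm_nonneg _)).trans (le_of_eq ?_)
    ring
  · congr 1
    rw [windowMoment]; ring

/-- The freezing error is controlled by a weight unbounded in x, but the squared window has finite
moments around the same centre. The weighted operator bound lets the weight act on the windowed
function before integrating in s. -/
lemma HasDerivBounds.lintegral_freeze_le {C : ℝ}
    (hC : ∀ (b : Space d → Space d → ℝ) (m : Space d → ℝ), IsRealSymbol b → Continuous m →
      (∀ x y, m (x + y) ≤ m x * (1 + ‖y‖)) →
      (∀ n ≤ 2 * d + 2, ∀ z, ‖iteratedFDeriv ℝ n (Function.uncurry b) z‖ ≤ m z.1) →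
      ∀ φ : 𝓢(Space d, ℂ), ‖weylOp b (toL2 φ)‖ₑ ≤
        ENNReal.ofReal C * (∫⁻ x, (ENNReal.ofReal (m x) * ‖φ x‖ₑ) ^ 2) ^ (1 / 2 : ℝ))
    (hC0 : 0 ≤ C) (h : HasDerivBounds (2 * d + 4) A a F) {κ τ : ℝ} (hκ : |κ| ≤ 1) (hτ : |τ| ≤ 1)
    (φ : 𝓢(Space d, ℂ)) :
    ∫⁻ s, ‖perturbedOp a F (τ * κ) (mulOp (window κ s) (toL2 φ)) -
        weylOp (frozenSymbol a F (τ • s)) (mulOp (window κ s) (toL2 φ))‖ₑ ^ 2 ≤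
      ENNReal.ofReal (windowConst d ^ 2 * windowMoment d *
        (C * shiftBound d A * (2 * d + 3)) ^ 2 * |τ| ^ 2 * ‖toL2 φ‖ ^ 2) := by
  have hM := h.shiftBound_nonneg
  have hs := h.symbol.perturbedSymbol h.field (τ * κ)
  have hf := h.symbol.frozenSymbol h.field
  set D := shiftBound d A * ((2 * d + 3) * |τ|) with hD
  have hD0 : 0 ≤ D := by positivity
  have hpt : ∀ s, ‖perturbedOp a F (τ * κ) (mulOp (window κ s) (toL2 φ)) -
        weylOp (frozenSymbol a F (τ • s)) (mulOp (window κ s) (toL2 φ))‖ₑ ^ 2 ≤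
      ENNReal.ofReal ((C * D) ^ 2) * ∫⁻ x, ENNReal.ofReal ((1 + ‖κ • x - s‖) ^ 2) *
        ‖window κ s x‖ₑ ^ 2 * ‖φ x‖ₑ ^ 2 := by
    intro s
    have h1 := hC _ (fun x => D * (1 + ‖κ • x - s‖)) (hs.sub (hf (τ • s))) (by fun_prop)
      (fun x y => by
        have h2 : ‖κ • (x + y) - s‖ ≤ ‖κ • x - s‖ + ‖y‖ := by
          have : κ • (x + y) - s = (κ • x - s) + κ • y := by module
          rw [this]
          refine (norm_add_le _ _).trans (add_le_add le_rfl ?_)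
          rw [norm_smul, Real.norm_eq_abs]
          exact mul_le_of_le_one_left (norm_nonneg _) hκ
        refine (mul_le_mul_of_nonneg_left (?_ : _ ≤ (1 + ‖κ • x - s‖) * (1 + ‖y‖)) hD0).trans
          (le_of_eq (mul_assoc _ _ _).symm)
        nlinarith [norm_nonneg (κ • x - s), norm_nonneg y])
      (fun n hn z => h.perturbed_sub_frozen_le hκ hτ hn s z) (windowMul κ s φ)
    rw [weylOp_sub hs (hf _), sub_apply, ← mulOp_window_toL2] at h1
    refine (pow_le_pow_left₀ zero_le h1 2).trans (le_of_eq ?_)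
    rw [mul_pow, ← ENNReal.rpow_natCast (_ ^ (1 / 2 : ℝ)), ← ENNReal.rpow_mul, mul_pow C D 2,
      ENNReal.ofReal_mul (sq_nonneg C), ENNReal.ofReal_pow hC0, mul_assoc,
      ← lintegral_const_mul' _ _ ENNReal.ofReal_ne_top]
    norm_num
    congr 1
    refine lintegral_congr fun x => ?_
    rw [windowMul_apply, enorm_mul, ENNReal.ofReal_mul hD0, ENNReal.ofReal_pow hD0,
      ENNReal.ofReal_pow (by positivity)]
    ring
  refine (lintegral_mono hpt).trans ?_
  rw [lintegral_const_mul' _ _ ENNReal.ofReal_ne_top,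
    lintegral_window_mul κ (h := fun x => ‖φ x‖ₑ ^ 2) (by
      have := φ.continuous.measurable; fun_prop)
      (w := fun t => ENNReal.ofReal ((1 + ‖t‖) ^ 2)) (by fun_prop)]
  have e1 : ∫⁻ t : Space d, ENNReal.ofReal ((1 + ‖t‖) ^ 2) *
      ENNReal.ofReal (gauss (2 * Real.pi) t) = ENNReal.ofReal (windowMoment d) := by
    rw [windowMoment, ofReal_integral_eq_lintegral_ofReal
      (integrable_pow_mul_gauss (by positivity) 2)
      (ae_of_all _ fun t => by have := gauss_pos (2 * Real.pi) t; positivity)]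
    refine lintegral_congr fun t => ?_
    rw [ENNReal.ofReal_mul (by positivity)]
  have e2 : ∫⁻ x, ‖φ x‖ₑ ^ 2 = ENNReal.ofReal (‖toL2 φ‖ ^ 2) := by
    rw [← lintegral_enorm_sq_toL2, ← enorm_sq_L2_eq, ← ofReal_norm,
      ENNReal.ofReal_pow (norm_nonneg _)]
  have hmm := windowMoment_nonneg (d := d)
  rw [e1, e2, ← ENNReal.ofReal_mul (sq_nonneg _), ← ENNReal.ofReal_mul (by positivity),
    ← ENNReal.ofReal_mul (sq_nonneg _)]
  refine le_of_eq ?_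
  congr 1
  rw [hD]; ring

/-- With |τ| = κ the displacement τt of the field's argument and the frequency shift 2πκη are both
of size κ, so their second differences are O(κ²), one order better than the localisation errors
themselves. -/
lemma HasDerivBounds.norm_inner_sub_average_le {C : ℝ}
    (hC : ∀ (b : Space d → Space d → ℝ) (M : ℝ), IsRealSymbol b → 0 ≤ M →
      (∀ n ≤ 2 * d + 2, ∀ z, ‖iteratedFDeriv ℝ n (Function.uncurry b) z‖ ≤ M) → ‖weylOp b‖ ≤ C * M)
    (hC0 : 0 ≤ C) (h : HasDerivBounds (2 * d + 4) A a F) {κ τ : ℝ} (hκ0 : 0 ≤ κ) (hκ : κ ≤ 1)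
    (hτ : |τ| = κ) (ψ φ : 𝓢(Space d, ℂ)) :
    ‖inner ℂ (toL2 ψ) (perturbedOp a F (τ * κ) (toL2 φ)) -
        ∫ s, inner ℂ (mulOp (window κ s) (toL2 ψ))
          (weylOp (frozenSymbol a F (τ • s)) (mulOp (window κ s) (toL2 φ)))‖ ≤
      windowConst d ^ 4 * windowMoment d ^ 2 * (C * shiftBound d A * (2 * Real.pi) ^ 2) * κ ^ 2 *
        (‖toL2 ψ‖ * ‖toL2 φ‖) := by
  have hM := h.shiftBound_nonneg
  have hκ1 : |κ| ≤ 1 := by rwa [abs_of_nonneg hκ0]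
  have hτ1 : |τ| ≤ 1 := hτ.le.trans hκ
  have hs := h.symbol.perturbedSymbol h.field (τ * κ)
  have hf := h.symbol.frozenSymbol h.field
  have hsh : ∀ t k : Space d,
      IsRealSymbol fun x ξ => frozenSymbol a F (τ • (κ • x - t)) x (ξ - k) := fun t k => by
    rw [frozenSymbol_shift_eq]
    exact isRealSymbol_shiftedSymbol_comp h.symbol h.field _ _
  obtain ⟨B, hB⟩ := h.symbol.exists_bound
  have e : ∀ s, inner ℂ (mulOp (window κ s) (toL2 ψ))
      (weylOp (frozenSymbol a F (τ • s)) (mulOp (window κ s) (toL2 φ))) =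
      weylForm (frozenSymbol a F (τ • s)) (windowMul κ s ψ) (windowMul κ s φ) := fun s => by
    rw [mulOp_window_toL2, mulOp_window_toL2, (hf _).inner_weylOp]
  simp_rw [e]
  rw [perturbedOp, hs.inner_weylOp]
  refine (norm_inner_sub_integral_window_le (b := fun s => frozenSymbol a F (τ • s)) (B := B)
    (A := C * shiftBound d A * (2 * Real.pi) ^ 2 * κ ^ 2 * (‖toL2 ψ‖ * ‖toL2 φ‖))
    (continuous_frozenSymbol h.symbol h.field τ) (fun s x ξ => hB _ _) (fun s => hf _)
    (fun t η => hsh t _) ψ φ fun t η => ?_).trans (le_of_eq ?_)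
  · set k : Space d := (2 * Real.pi * κ) • η with hk
    have hk2 : (2 * Real.pi * κ) • -η = -k := smul_neg _ _
    rw [hk2]
    have h1 := hs.sub (hsh t k)
    have h2 := (hsh (-t) (-k)).sub hs
    have e1 : 2 * weylForm (perturbedSymbol a F (τ * κ)) ψ φ -
        weylForm (fun x ξ => frozenSymbol a F (τ • (κ • x - t)) x (ξ - k)) ψ φ -
        weylForm (fun x ξ => frozenSymbol a F (τ • (κ • x - -t)) x (ξ - -k)) ψ φ =
        inner ℂ (toL2 ψ) (weylOp (fun x ξ =>
          (perturbedSymbol a F (τ * κ) x ξ - frozenSymbol a F (τ • (κ • x - t)) x (ξ - k)) -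
          (frozenSymbol a F (τ • (κ • x - -t)) x (ξ - -k) - perturbedSymbol a F (τ * κ) x ξ))
          (toL2 φ)) := by
      rw [(h1.sub h2).inner_weylOp, weylForm_sub h1 h2, weylForm_sub hs (hsh t k),
        weylForm_sub (hsh (-t) (-k)) hs]
      ring
    rw [e1]
    have h3 := hC _ _ (h1.sub h2) (mul_nonneg hM (sq_nonneg _))
      fun n hn z => h.second_difference_le hκ1 hτ1 hn t k z
    have h4 : max (|τ| * ‖t‖) ‖k‖ ≤ 2 * Real.pi * κ * ((1 + ‖t‖) * (1 + ‖η‖)) := by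
      have hk3 : ‖k‖ = 2 * Real.pi * κ * ‖η‖ := by
        rw [hk, norm_smul, Real.norm_eq_abs, abs_of_nonneg (by positivity)]
      have h2pi : 1 ≤ 2 * Real.pi := by linarith [Real.pi_gt_three]
      have ht := norm_nonneg t
      have hη := norm_nonneg η
      rw [hk3, hτ]
      refine max_le ?_ ?_
      · calc κ * ‖t‖ ≤ (2 * Real.pi * κ) * ‖t‖ := by
              gcongr; exact le_mul_of_one_le_left hκ0 h2pi
          _ ≤ _ := by gcongr; nlinarith
      · gcongr; nlinarith
    have h5 : max (|τ| * ‖t‖) ‖k‖ ^ 2 ≤ (2 * Real.pi * κ * ((1 + ‖t‖) * (1 + ‖η‖))) ^ 2 :=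
      pow_le_pow_left₀ (le_max_of_le_right (norm_nonneg _)) h4 2
    refine (norm_inner_le_norm _ _).trans ?_
    calc _ ≤ ‖toL2 ψ‖ * (C * (shiftBound d A *
          (2 * Real.pi * κ * ((1 + ‖t‖) * (1 + ‖η‖))) ^ 2) * ‖toL2 φ‖) := by
          refine mul_le_mul_of_nonneg_left ((ContinuousLinearMap.le_opNorm _ _).trans
            (mul_le_mul_of_nonneg_right (h3.trans ?_) (norm_nonneg _))) (norm_nonneg _)
          gcongr
      _ = _ := by ring
  · rw [windowMoment]; ring

end Comparison

/-! ### Transfer of lower bounds from the unperturbed to the perturbed operator. -/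

section Comparison

variable {d : ℕ} {A : ℝ} {a : Space d → Space d → ℝ} {F : Space d → Space d}

/-- The frozen symbol at y is the symbol of the unperturbed operator translated by F y - F 0. -/
lemma le_norm_frozenOp_sub (ha : IsRealSymbol a) (hF : IsAdmissibleField F) {c E : ℝ}
    (h : ∀ f, c * ‖f‖ ≤ ‖perturbedOp a F 0 f - (E : ℂ) • f‖) (y : Space d) (f : L2Space d) :
    c * ‖f‖ ≤ ‖weylOp (frozenSymbol a F y) f - (E : ℂ) • f‖ := by
  have := le_norm_weylOp_shift_sub (ha.perturbedSymbol hF 0) (F y - F 0) h f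
  have e : (fun x ξ => perturbedSymbol a F 0 (x + (F y - F 0)) ξ) = frozenSymbol a F y := by
    funext x ξ
    simp only [perturbedSymbol, frozenSymbol, zero_smul]
    congr 1
    abel
  rwa [e] at this

/-- Expand ‖Jw - r‖², where w = (K - E)u and r collects the localisation errors: the cross term is
O(κ²) by averaging and ‖r‖² is O(κ²) by the commutator and freezing bounds. The constant depends
only on d, A and R, so the estimate can later be applied to a perturbed symbol with constants
uniform in δ. -/
lemma exists_le_norm_sq_perturbedOp_toL2 (d : ℕ) (A R : ℝ) : ∃ C : ℝ, 0 ≤ C ∧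
    ∀ (a : Space d → Space d → ℝ) (F : Space d → Space d), HasDerivBounds (2 * d + 4) A a F →
    ∀ κ τ : ℝ, 0 ≤ κ → κ ≤ 1 → |τ| = κ → ∀ E c : ℝ, |E| ≤ R → 0 ≤ c →
      (∀ f, c * ‖f‖ ≤ ‖perturbedOp a F 0 f - (E : ℂ) • f‖) → ∀ φ : 𝓢(Space d, ℂ),
        c ^ 2 * ‖toL2 φ‖ ^ 2 ≤ ‖perturbedOp a F (τ * κ) (toL2 φ) - (E : ℂ) • toL2 φ‖ ^ 2 +
          C * κ ^ 2 * ‖toL2 φ‖ ^ 2 := by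
  obtain ⟨C₁, hC₁, hop⟩ := exists_norm_weylOp_le d
  obtain ⟨C₂, hC₂, hwt⟩ := exists_enorm_weylOp_toL2_le d
  set M := shiftBound d A with hMdef
  set X₁ := windowConst d ^ 2 * windowMoment d * (2 * Real.pi * C₁ * M) ^ 2 with hX₁
  set X₂ := windowConst d ^ 2 * windowMoment d * (C₂ * M * (2 * d + 3)) ^ 2 with hX₂
  set C₃ := 2 * X₁ + 2 * X₂ with hC₃
  -- The sign of M is unknown until some a and F with these bounds are given, hence the absolute
  -- value.
  set C₄ := windowConst d ^ 4 * windowMoment d ^ 2 * (C₁ * |M| * (2 * Real.pi) ^ 2) with hC₄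
  have hmm := windowMoment_nonneg (d := d)
  have hX₁0 : 0 ≤ X₁ := by positivity
  have hX₂0 : 0 ≤ X₂ := by positivity
  have hC₃0 : 0 ≤ C₃ := by positivity
  have hC₄0 : 0 ≤ C₄ := by positivity
  refine ⟨2 * C₄ * (C₁ * |M| + |R|) + C₃, by positivity,
    fun a F h κ τ hκ0 hκ hτ E c hE hc hlow φ => ?_⟩
  have hM : 0 ≤ M := h.shiftBound_nonneg
  rw [abs_of_nonneg hM] at hC₄ ⊢
  have hκ1 : |κ| ≤ 1 := by rwa [abs_of_nonneg hκ0]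
  have hτ1 : |τ| ≤ 1 := hτ.le.trans hκ
  have hδ : |τ * κ| ≤ 1 := by
    rw [abs_mul]; exact mul_le_one₀ hτ1 (abs_nonneg _) hκ1
  set u := toL2 φ with hu
  set K := perturbedOp a F (τ * κ) with hK
  have hfz := h.symbol.frozenSymbol h.field
  set T : Space d → L2Space d →L[ℂ] L2Space d := fun s => weylOp (frozenSymbol a F (τ • s)) with hT
  have hTc : Continuous T := (h.continuous_frozenOp hop hC₁).comp (by fun_prop)
  set G : Space d → L2Space d → L2Space d := fun s f => mulOp (window κ s) f with hG
  have hGc : ∀ f, Continuous fun s => G s f := continuous_mulOp_window κ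
  have hTG : Continuous fun s => T s (G s u) := hTc.clm_apply (hGc u)
  have hKn : ‖K‖ ≤ C₁ * M := h.norm_perturbedOp_le hop hδ
  have hrc : Continuous fun s => G s (K u) - T s (G s u) := (hGc _).sub hTG
  have hrl : ∫⁻ s, ‖G s (K u) - T s (G s u)‖ₑ ^ 2 ≤ ENNReal.ofReal (C₃ * κ ^ 2 * ‖u‖ ^ 2) := by
    have h1 := h.lintegral_commutator_le hop hC₁ hκ0 hδ φ
    have h2 := h.lintegral_freeze_le hwt hC₂ hκ1 hτ1 φ
    have h3 : ∀ s, ‖G s (K u) - T s (G s u)‖ₑ ^ 2 ≤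
        ENNReal.ofReal 2 * ‖G s (K u) - K (G s u)‖ₑ ^ 2 +
          ENNReal.ofReal 2 * ‖K (G s u) - T s (G s u)‖ₑ ^ 2 := by
      intro s
      simp only [← ofReal_norm]
      rw [← ENNReal.ofReal_pow (norm_nonneg _), ← ENNReal.ofReal_pow (norm_nonneg _),
        ← ENNReal.ofReal_pow (norm_nonneg _),
        ← ENNReal.ofReal_mul (by norm_num),
        ← ENNReal.ofReal_mul (by norm_num), ← ENNReal.ofReal_add (by positivity) (by positivity)]
      refine ENNReal.ofReal_le_ofReal ?_
      have h4 := norm_add_le (G s (K u) - K (G s u)) (K (G s u) - T s (G s u))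
      rw [sub_add_sub_cancel] at h4
      have h5 := pow_le_pow_left₀ (norm_nonneg _) h4 2
      nlinarith [sq_nonneg (‖G s (K u) - K (G s u)‖ - ‖K (G s u) - T s (G s u)‖)]
    refine (lintegral_mono h3).trans ?_
    have hm1 : Measurable fun s => ‖G s (K u) - K (G s u)‖ₑ ^ 2 :=
      ((hGc _).sub (K.continuous.comp (hGc u))).enorm.measurable.pow_const 2
    have hm2 : Measurable fun s => ‖K (G s u) - T s (G s u)‖ₑ ^ 2 :=
      ((K.continuous.comp (hGc u)).sub hTG).enorm.measurable.pow_const 2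
    rw [lintegral_add_left (hm1.const_mul _), lintegral_const_mul _ hm1, lintegral_const_mul _ hm2]
    refine (add_le_add (mul_le_mul_right h1 _) (mul_le_mul_right h2 _)).trans ?_
    rw [← ENNReal.ofReal_mul (by norm_num),
      ← ENNReal.ofReal_mul (by norm_num), ← ENNReal.ofReal_add (by positivity) (by positivity)]
    refine ENNReal.ofReal_le_ofReal (le_of_eq ?_)
    rw [hτ, hC₃, hX₁, hX₂]; ring
  have hrm : MemLp (fun s => G s (K u) - T s (G s u)) 2 :=
    memLp_two_of_lintegral_enorm_sq hrc.aestronglyMeasurable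
      (ne_top_of_le_ne_top ENNReal.ofReal_ne_top hrl)
  set r := hrm.toLp _ with hr
  have hrn : ‖r‖ ^ 2 ≤ C₃ * κ ^ 2 * ‖u‖ ^ 2 := by
    have h1 := (enorm_sq_toLp_two hrm).le.trans hrl
    rw [← ofReal_norm, ← ENNReal.ofReal_pow (norm_nonneg _),
      ENNReal.ofReal_le_ofReal_iff (by positivity)] at h1
    exact h1
  set J := localize (d := d) κ with hJ
  have hJae : ∀ f, ∀ᵐ s, J f s = G s f := fun f => MemLp.coeFn_toLp (memLp_mulOp_window κ f)
  have hrae : ∀ᵐ s, r s = G s (K u) - T s (G s u) := MemLp.coeFn_toLp hrm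
  -- Cauchy-Schwarz with the bound on ‖r‖ would give only κ; the averaging estimate gives κ².
  have hcross : ∀ f, ‖inner ℂ (J f) r‖ ≤ C₄ * κ ^ 2 * ‖u‖ * ‖f‖ := by
    intro f
    refine denseRange_toL2.induction_on (p := fun f => ‖inner ℂ (J f) r‖ ≤ C₄ * κ ^ 2 * ‖u‖ * ‖f‖)
      f (isClosed_le ?_ (by fun_prop)) fun ψ => ?_
    · have := J.continuous
      fun_prop
    · have h1 := h.norm_inner_sub_average_le hop hC₁ hκ0 hκ hτ ψ φ
      have e1 : inner ℂ (J (toL2 ψ)) r = inner ℂ (toL2 ψ) (K u) -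
          ∫ s, inner ℂ (G s (toL2 ψ)) (T s (G s u)) := by
        -- The element J (K u) - r is the family T s (G s u), so no operator on the vector-valued
        -- space has to be introduced.
        have e2 : inner ℂ (J (toL2 ψ)) (J (K u) - r) =
            ∫ s, inner ℂ (G s (toL2 ψ)) (T s (G s u)) := by
          rw [L2.inner_def]
          refine integral_congr_ae ?_
          filter_upwards [hJae (toL2 ψ), hJae (K u), hrae, Lp.coeFn_sub (J (K u)) r]
            with s h2 h3 h4 h5
          rw [h2, h5, Pi.sub_apply, h3, h4, sub_sub_cancel]
        rw [← e2, inner_sub_right, J.inner_map_map, sub_sub_cancel]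
      rw [e1]
      refine h1.trans (le_of_eq ?_)
      rw [hC₄]; ring
  set w := K u - (E : ℂ) • u with hw
  have hwn : ‖w‖ ≤ (C₁ * M + |R|) * ‖u‖ := by
    refine (norm_sub_le _ _).trans ?_
    rw [norm_smul, Complex.norm_real, Real.norm_eq_abs, add_mul]
    have h1 := (K.le_opNorm u).trans (mul_le_mul_of_nonneg_right hKn (norm_nonneg _))
    have h2 : |E| * ‖u‖ ≤ |R| * ‖u‖ :=
      mul_le_mul_of_nonneg_right (hE.trans (le_abs_self R)) (norm_nonneg _)
    linarith
  -- At almost every s the vector Jw - r equals (T s - E)(G s u), and the frozen lower bound applies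
  -- fibre by fibre.
  have hZ : c * ‖u‖ ≤ ‖J w - r‖ := by
    have h1 : ‖(c : ℂ) • J u‖ = c * ‖u‖ := by
      rw [norm_smul, Complex.norm_real, Real.norm_eq_abs, abs_of_nonneg hc, J.norm_map]
    rw [← h1]
    refine Lp.norm_le_norm_of_ae_le ?_
    filter_upwards [hJae u, hJae w, hrae, Lp.coeFn_sub (J w) r, Lp.coeFn_smul (c : ℂ) (J u)]
      with s h2 h3 h4 h5 h6
    rw [h5, h6, Pi.sub_apply, Pi.smul_apply, h2, h3, h4, norm_smul, Complex.norm_real,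
      Real.norm_eq_abs, abs_of_nonneg hc]
    have e : G s w - (G s (K u) - T s (G s u)) = T s (G s u) - (E : ℂ) • G s u := by
      simp only [hG, hw, map_sub, map_smul]; abel
    rw [e]
    exact le_norm_frozenOp_sub h.symbol h.field hlow _ _
  have hexp : ‖J w - r‖ ^ 2 = ‖w‖ ^ 2 - 2 * RCLike.re (inner ℂ (J w) r) + ‖r‖ ^ 2 := by
    rw [norm_sub_sq (𝕜 := ℂ), J.norm_map]
  have hre : -RCLike.re (inner ℂ (J w) r) ≤ C₄ * κ ^ 2 * ‖u‖ * ‖w‖ :=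
    (neg_le_abs _).trans ((RCLike.abs_re_le_norm _).trans (hcross w))
  have hre2 : C₄ * κ ^ 2 * ‖u‖ * ‖w‖ ≤ C₄ * κ ^ 2 * ‖u‖ * ((C₁ * M + |R|) * ‖u‖) := by gcongr
  have hsq := pow_le_pow_left₀ (by positivity) hZ 2
  rw [mul_pow, hexp] at hsq
  calc c ^ 2 * ‖u‖ ^ 2 ≤ ‖w‖ ^ 2 + 2 * (C₄ * κ ^ 2 * ‖u‖ * ((C₁ * M + |R|) * ‖u‖)) +
        C₃ * κ ^ 2 * ‖u‖ ^ 2 := by linarith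
    _ = _ := by ring

theorem exists_le_norm_sq_perturbedOp (d : ℕ) (A R : ℝ) : ∃ C : ℝ, 0 ≤ C ∧
    ∀ (a : Space d → Space d → ℝ) (F : Space d → Space d), HasDerivBounds (2 * d + 4) A a F →
    ∀ δ : ℝ, |δ| ≤ 1 → ∀ E c : ℝ, |E| ≤ R → 0 ≤ c →
      (∀ f, c * ‖f‖ ≤ ‖perturbedOp a F 0 f - (E : ℂ) • f‖) → ∀ f : L2Space d,
        c ^ 2 * ‖f‖ ^ 2 ≤ ‖perturbedOp a F δ f - (E : ℂ) • f‖ ^ 2 + C * |δ| * ‖f‖ ^ 2 := by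
  obtain ⟨C, hC, hmain⟩ := exists_le_norm_sq_perturbedOp_toL2 d A R
  refine ⟨C, hC, fun a F h δ hδ E c hE hc hlow f => ?_⟩
  -- With δ = τκ, the choice κ = |τ| balances the commutator error, of order κ, against the freezing
  -- error, of order |τ|; the sign of δ is carried by τ.
  obtain ⟨τ, hτ, hτδ⟩ : ∃ τ : ℝ, |τ| = √|δ| ∧ τ * √|δ| = δ := by
    have hs := Real.mul_self_sqrt (abs_nonneg δ)
    rcases le_total 0 δ with h0 | h0
    · refine ⟨√|δ|, abs_of_nonneg (Real.sqrt_nonneg _), ?_⟩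
      rw [hs, abs_of_nonneg h0]
    · refine ⟨-√|δ|, by rw [abs_neg, abs_of_nonneg (Real.sqrt_nonneg _)], ?_⟩
      rw [neg_mul, hs, abs_of_nonpos h0, neg_neg]
  refine denseRange_toL2.induction_on (p := fun f => c ^ 2 * ‖f‖ ^ 2 ≤
    ‖perturbedOp a F δ f - (E : ℂ) • f‖ ^ 2 + C * |δ| * ‖f‖ ^ 2) f
    (isClosed_le (by fun_prop) (by fun_prop)) fun φ => ?_
  have := hmain a F h (√|δ|) τ (Real.sqrt_nonneg _)
    (Real.sqrt_le_one.2 hδ) hτ E c hE hc hlow φ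
  rwa [hτδ, Real.sq_sqrt (abs_nonneg _)] at this

end Comparison

/-! ### The inverse of id + δF and its derivative bounds. -/

section InverseField

variable {V : Type*} [NormedAddCommGroup V] [NormedSpace ℝ V]

/-- Put ψ = F ∘ Ω. Differentiating Ω = id - δψ gives Dψ = (DF ∘ Ω)(id - δDψ). In its n-th derivative
the top order of ψ reappears with a factor at most 1/2 and is absorbed on the left, whence the 2;
the other terms are lower order and covered by induction. -/
lemma norm_iteratedFDeriv_comp_inverse_succ_le {F Ω : V → V} {δ : ℝ} (hF : ContDiff ℝ ∞ F)
    (hΩ : ContDiff ℝ ∞ Ω) (heq : ∀ t, Ω t = t - δ • F (Ω t)) (hδ : |δ| ≤ 1)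
    (hL : ∀ x, ‖fderiv ℝ F x‖ * |δ| ≤ 1 / 2) {n : ℕ} {A B : ℝ} (hB : 0 ≤ B)
    (hA : ∀ i, 1 ≤ i → i ≤ n + 1 → ∀ x, ‖iteratedFDeriv ℝ i F x‖ ≤ A)
    (hind : ∀ i, 1 ≤ i → i ≤ n → ∀ t, ‖iteratedFDeriv ℝ i (F ∘ Ω) t‖ ≤ B) (t : V) :
    ‖iteratedFDeriv ℝ (n + 1) (F ∘ Ω) t‖ ≤
      2 * (A + 2 ^ n * (n.factorial * A * (1 + B) ^ n * (1 + B))) := by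
  set ψ := F ∘ Ω with hψ
  have hA0 : 0 ≤ A := (norm_nonneg _).trans (hA 1 le_rfl (by omega) 0)
  have hψs : ContDiff ℝ ∞ ψ := hF.comp hΩ
  have hΩeq : Ω = fun t => t - δ • ψ t := funext heq
  have hle : ∀ m : ℕ, (m : ℕ∞ω) ≤ ∞ := fun m => by exact_mod_cast le_top
  have hΩd : ∀ i, 1 ≤ i → i ≤ n → ‖iteratedFDeriv ℝ i Ω t‖ ≤ (1 + B) ^ i := by
    intro i hi hin
    have h1 : ‖iteratedFDeriv ℝ i Ω t‖ ≤ 1 + B := by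
      have e1 : iteratedFDeriv ℝ i (fun t => t - δ • ψ t) t =
          iteratedFDeriv ℝ i (ContinuousLinearMap.id ℝ V) t -
            iteratedFDeriv ℝ i (fun t => δ • ψ t) t :=
        fun_iteratedFDeriv_sub_apply (f := ContinuousLinearMap.id ℝ V)
          (ContinuousLinearMap.contDiff _).contDiffAt
          ((hψs.const_smul δ).contDiffAt.of_le (hle i))
      rw [hΩeq, e1, iteratedFDeriv_const_smul_apply' (hψs.contDiffAt.of_le (hle i))]
      refine (norm_sub_le _ _).trans (add_le_add ?_ ?_)
      · exact (norm_iteratedFDeriv_continuousLinearMap_le (ContinuousLinearMap.id ℝ V) hi t).trans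
          ContinuousLinearMap.norm_id_le
      · rw [norm_smul, Real.norm_eq_abs]
        exact (mul_le_of_le_one_left (norm_nonneg _) hδ).trans (hind i hi hin t)
    exact h1.trans (le_self_pow₀ (by linarith) (by omega))
  have hdF : ContDiff ℝ ∞ (fderiv ℝ F) := hF.fderiv_right (by simp)
  have hdψ : ContDiff ℝ ∞ (fderiv ℝ ψ) := hψs.fderiv_right (by simp)
  set f : V → V →L[ℝ] V := fderiv ℝ F ∘ Ω with hf
  set g : V → V →L[ℝ] V := fun t => ContinuousLinearMap.id ℝ V - δ • fderiv ℝ ψ t with hg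
  have hgs : ContDiff ℝ ∞ g := contDiff_const.sub (hdψ.const_smul δ)
  have hfs : ContDiff ℝ ∞ f := hdF.comp hΩ
  have hdiff : fderiv ℝ ψ = fun t => ContinuousLinearMap.compL ℝ V V V (f t) (g t) := by
    funext t
    have hd1 : DifferentiableAt ℝ ψ t := (hψs.differentiable (by simp)) t
    have h2 : fderiv ℝ Ω t = g t := by
      rw [hΩeq]
      exact ((hasFDerivAt_id t).sub (hd1.hasFDerivAt.const_smul δ)).fderiv
    rw [hψ, fderiv_comp t ((hF.differentiable (by simp)) _) ((hΩ.differentiable (by simp)) _), h2]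
    rfl
  have hgd : ∀ m, ‖iteratedFDeriv ℝ m g t‖ ≤ 1 + |δ| * ‖iteratedFDeriv ℝ (m + 1) ψ t‖ := by
    intro m
    rw [hg, fun_iteratedFDeriv_sub_apply contDiff_const.contDiffAt
      ((hdψ.const_smul δ).contDiffAt.of_le (hle m)),
      iteratedFDeriv_const_smul_apply' (hdψ.contDiffAt.of_le (hle m))]
    refine (norm_sub_le _ _).trans (add_le_add ?_ ?_)
    · rcases Nat.eq_zero_or_pos m with rfl | hm
      · rw [norm_iteratedFDeriv_zero]; exact ContinuousLinearMap.norm_id_le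
      · rw [iteratedFDeriv_const_of_ne hm.ne']; simp
    · rw [norm_smul, Real.norm_eq_abs, norm_iteratedFDeriv_fderiv]
  have hfd : ∀ i, i ≤ n → ‖iteratedFDeriv ℝ i f t‖ ≤ n.factorial * A * (1 + B) ^ n := by
    intro i hi
    refine (norm_iteratedFDeriv_comp_le hdF hΩ (hle i) t (C := A) (D := 1 + B)
      (fun j hj => ?_) (fun j hj hji => hΩd j hj (hji.trans hi))).trans ?_
    · rw [norm_iteratedFDeriv_fderiv]
      exact hA (j + 1) (by omega) (by omega) _
    · have h3 : (i.factorial : ℝ) ≤ n.factorial := by exact_mod_cast Nat.factorial_le hi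
      have h4 : (1 + B) ^ i ≤ (1 + B) ^ n := pow_le_pow_right₀ (by linarith) hi
      gcongr
  have hmain := ContinuousLinearMap.norm_iteratedFDeriv_le_of_bilinear_of_le_one
    (ContinuousLinearMap.compL ℝ V V V) hfs hgs t (hle n) (ContinuousLinearMap.norm_compL_le ℝ V V V)
  rw [← hdiff, norm_iteratedFDeriv_fderiv, Finset.sum_range_succ'] at hmain
  set Y := ‖iteratedFDeriv ℝ (n + 1) ψ t‖ with hY
  have h0 : (n.choose 0 : ℝ) * ‖iteratedFDeriv ℝ 0 f t‖ * ‖iteratedFDeriv ℝ (n - 0) g t‖ ≤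
      A + 1 / 2 * Y := by
    rw [norm_iteratedFDeriv_zero, Nat.choose_zero_right, Nat.cast_one, one_mul, Nat.sub_zero]
    have h1 : ‖f t‖ ≤ A := by
      have := hA 1 le_rfl (by omega) (Ω t)
      rwa [norm_iteratedFDeriv_one] at this
    have h2 : ‖f t‖ * |δ| ≤ 1 / 2 := hL _
    calc _ ≤ ‖f t‖ * (1 + |δ| * Y) := mul_le_mul_of_nonneg_left (hgd n) (norm_nonneg _)
      _ = ‖f t‖ + (‖f t‖ * |δ|) * Y := by ring
      _ ≤ _ := by gcongr
  have h1 : ∑ i ∈ Finset.range n, (n.choose (i + 1) : ℝ) * ‖iteratedFDeriv ℝ (i + 1) f t‖ *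
      ‖iteratedFDeriv ℝ (n - (i + 1)) g t‖ ≤
      2 ^ n * (n.factorial * A * (1 + B) ^ n * (1 + B)) := by
    calc _ ≤ ∑ i ∈ Finset.range n, (n.choose (i + 1) : ℝ) *
          (n.factorial * A * (1 + B) ^ n * (1 + B)) := by
          refine Finset.sum_le_sum fun i hi => ?_
          have hi' := Finset.mem_range.1 hi
          rw [mul_assoc]
          refine mul_le_mul_of_nonneg_left ?_ (Nat.cast_nonneg _)
          refine mul_le_mul (hfd _ (by omega)) ((hgd _).trans ?_) (norm_nonneg _) (by positivity)
          refine add_le_add le_rfl ((mul_le_of_le_one_left (norm_nonneg _) hδ).trans ?_)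
          exact hind _ (by omega) (by omega) t
      _ ≤ _ := by
          rw [← Finset.sum_mul]
          refine mul_le_mul_of_nonneg_right ?_ (by positivity)
          have h2 : ∑ i ∈ Finset.range (n + 1), (n.choose i : ℝ) = 2 ^ n := by
            exact_mod_cast Nat.sum_range_choose n
          rw [← h2, Finset.sum_range_succ']
          simp
  linarith

/-- A bound for the derivatives of `F ∘ (id + δ F)⁻¹` of order between `1` and `n`. -/
noncomputable def inverseBound (A : ℝ) : ℕ → ℝ
  | 0 => 0
  | n + 1 => inverseBound A n + 2 * (A + 2 ^ n * (n.factorial * A *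
      (1 + inverseBound A n) ^ n * (1 + inverseBound A n)))

lemma inverseBound_nonneg {A : ℝ} (hA : 0 ≤ A) (n : ℕ) : 0 ≤ inverseBound A n := by
  induction n with
  | zero => exact le_rfl
  | succ n ih => rw [inverseBound]; positivity

lemma norm_iteratedFDeriv_comp_inverse_le {F Ω : V → V} {δ : ℝ} (hF : ContDiff ℝ ∞ F)
    (hΩ : ContDiff ℝ ∞ Ω) (heq : ∀ t, Ω t = t - δ • F (Ω t)) (hδ : |δ| ≤ 1)
    (hL : ∀ x, ‖fderiv ℝ F x‖ * |δ| ≤ 1 / 2) {A : ℝ} (hA0 : 0 ≤ A) (n : ℕ)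
    (hA : ∀ i, 1 ≤ i → i ≤ n → ∀ x, ‖iteratedFDeriv ℝ i F x‖ ≤ A) :
    ∀ i, 1 ≤ i → i ≤ n → ∀ t, ‖iteratedFDeriv ℝ i (F ∘ Ω) t‖ ≤ inverseBound A n := by
  induction n with
  | zero => intro i h1 h2; omega
  | succ n ih =>
    have ih' := ih fun i h1 h2 => hA i h1 (by omega)
    have hB := inverseBound_nonneg hA0 n
    intro i h1 h2 t
    rw [inverseBound]
    rcases Nat.lt_or_ge i (n + 1) with h | h
    · refine (ih' i h1 (by omega) t).trans (le_add_of_nonneg_right (by positivity))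
    · obtain rfl : i = n + 1 := by omega
      refine (norm_iteratedFDeriv_comp_inverse_succ_le hF hΩ heq hδ hL hB hA ih' t).trans ?_
      linarith

/-- A smooth global inverse of `id + δ F` when `δ F` is a contraction. -/
lemma exists_inverse_add_smul [CompleteSpace V] {F : V → V} {δ : ℝ} (hF : ContDiff ℝ ∞ F)
    (hL : ∀ x, ‖fderiv ℝ F x‖ * |δ| ≤ 1 / 2) :
    ∃ Ω : V → V, ContDiff ℝ ∞ Ω ∧ (∀ t, Ω t = t - δ • F (Ω t)) ∧ ∀ s, Ω (s + δ • F s) = s := by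
  have hFd : Differentiable ℝ F := hF.differentiable (by simp)
  have hlip : ∀ s s', ‖δ • F s - δ • F s'‖ ≤ 1 / 2 * ‖s - s'‖ := by
    intro s s'
    refine convex_univ.norm_image_sub_le_of_norm_fderiv_le (𝕜 := ℝ) (f := fun s => δ • F s)
      (fun x _ => (hFd x).const_smul δ) (fun x _ => ?_) (Set.mem_univ s') (Set.mem_univ s)
    rw [fderiv_fun_const_smul (hFd x), norm_smul, Real.norm_eq_abs, mul_comm]
    exact hL x
  have hcon : ∀ t, ContractingWith (1 / 2) fun s => t - δ • F s := by
    intro t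
    refine ⟨by norm_num, LipschitzWith.of_dist_le_mul fun s s' => ?_⟩
    rw [dist_eq_norm, dist_eq_norm, sub_sub_sub_cancel_left, norm_sub_rev]
    simpa using hlip s s'
  let Ω : V → V := fun t => ContractingWith.fixedPoint _ (hcon t)
  have hΩ : ∀ t, Ω t = t - δ • F (Ω t) := fun t => (hcon t).fixedPoint_isFixedPt.symm
  have hinj : ∀ s s', ‖s - s'‖ ≤ 2 * ‖(s + δ • F s) - (s' + δ • F s')‖ := by
    intro s s'
    have h1 := hlip s s'
    have h2 : s - s' = ((s + δ • F s) - (s' + δ • F s')) - (δ • F s - δ • F s') := by abel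
    have h3 := norm_sub_le ((s + δ • F s) - (s' + δ • F s')) (δ • F s - δ • F s')
    rw [← h2] at h3
    linarith
  have hright : ∀ t, Ω t + δ • F (Ω t) = t := fun t =>
    eq_sub_iff_add_eq.1 (hΩ t)
  have hleft : ∀ s, Ω (s + δ • F s) = s := fun s => by
    have h1 := hinj (Ω (s + δ • F s)) s
    rw [hright, sub_self, norm_zero, mul_zero] at h1
    exact sub_eq_zero.1 (norm_le_zero_iff.1 h1)
  have hΩc : Continuous Ω := by
    refine (LipschitzWith.of_dist_le_mul (K := 2) fun t t' => ?_).continuous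
    rw [dist_eq_norm, dist_eq_norm]
    have h1 := hinj (Ω t) (Ω t')
    rw [hright, hright] at h1
    simpa using h1
  have hΦ : ContDiff ℝ ∞ fun s => s + δ • F s := contDiff_id.add (hF.const_smul δ)
  let e : V ≃ₜ V :=
    { toFun := fun s => s + δ • F s
      invFun := Ω
      left_inv := hleft
      right_inv := hright
      continuous_toFun := hΦ.continuous
      continuous_invFun := hΩc }
  have hunit : ∀ s, ‖-(δ • fderiv ℝ F s)‖ < 1 := fun s => by
    rw [norm_neg, norm_smul, Real.norm_eq_abs, mul_comm]
    linarith [hL s]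
  -- The derivative id + δDF is one minus an operator of norm below one, hence invertible by the
  -- Neumann series.
  let D : V → V ≃L[ℝ] V := fun s =>
    ContinuousLinearEquiv.unitsEquiv ℝ V (Units.oneSub _ (hunit s))
  have hD : ∀ s, HasFDerivAt e (D s : V →L[ℝ] V) s := by
    intro s
    have h1 : (D s : V →L[ℝ] V) = ContinuousLinearMap.id ℝ V + δ • fderiv ℝ F s := by
      ext v
      simp [D]
    rw [h1]
    exact (hasFDerivAt_id s).add ((hFd s).hasFDerivAt.const_smul δ)
  exact ⟨Ω, e.contDiff_symm hD hΦ, hΩ, hleft⟩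

end InverseField

/-! ### Exchanging the roles of the two operators. -/

section TwoSided

variable {d : ℕ}

/-- With Ω the inverse of id + δF, the field F' = -F ∘ Ω satisfies δ(y + F'(δy)) = Ω(δy), so the two
displacements cancel and F' undoes the perturbation. The normalisation F 0 = 0 gives F' 0 = 0. The
new derivative bound depends on d and A, not on δ. -/
lemma exists_hasDerivBounds_inverse {A δ : ℝ} {a : Space d → Space d → ℝ}
    {F : Space d → Space d} (h : HasDerivBounds (2 * d + 4) A a F) (hF0 : F 0 = 0) (hδ : |δ| ≤ 1)
    (hδA : A * |δ| ≤ 1 / 2) : ∃ F' : Space d → Space d,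
      HasDerivBounds (2 * d + 4) (max (shiftBound d A) (inverseBound A (2 * d + 4)))
        (perturbedSymbol a F δ) F' ∧
      perturbedSymbol (perturbedSymbol a F δ) F' δ = perturbedSymbol a F 0 ∧
      perturbedSymbol (perturbedSymbol a F δ) F' 0 = perturbedSymbol a F δ := by
  have hL : ∀ x, ‖fderiv ℝ F x‖ * |δ| ≤ 1 / 2 := fun x => by
    have h1 := h.field_le 1 le_rfl (by omega) x
    rw [norm_iteratedFDeriv_one] at h1
    exact (mul_le_mul_of_nonneg_right h1 (abs_nonneg _)).trans hδA
  obtain ⟨Ω, hΩs, hΩ, hleft⟩ := exists_inverse_add_smul h.field.1 hL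
  have hΩ0 : Ω 0 = 0 := by simpa [hF0] using hleft 0
  refine ⟨fun t => -F (Ω t), ⟨h.symbol.perturbedSymbol h.field δ, ⟨(h.field.1.comp hΩs).neg,
    fun n hn => ?_⟩, fun n hn z => ?_, fun n hn hnN t => ?_⟩, ?_, ?_⟩
  · obtain ⟨B, hB⟩ := exists_hasDerivBounds h.symbol h.field n
    refine ⟨inverseBound B n, fun t => ?_⟩
    have e : iteratedFDeriv ℝ n (fun t => -F (Ω t)) t = -iteratedFDeriv ℝ n (F ∘ Ω) t :=
      iteratedFDeriv_neg_apply
    rw [e, norm_neg]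
    exact norm_iteratedFDeriv_comp_inverse_le h.field.1 hΩs hΩ hδ hL hB.nonneg n hB.field_le
      n hn le_rfl t
  · exact (h.perturbedSymbol_le hδ hn z).trans (le_max_left _ _)
  · have e : iteratedFDeriv ℝ n (fun t => -F (Ω t)) t = -iteratedFDeriv ℝ n (F ∘ Ω) t :=
      iteratedFDeriv_neg_apply
    rw [e, norm_neg]
    exact (norm_iteratedFDeriv_comp_inverse_le h.field.1 hΩs hΩ hδ hL h.nonneg _ h.field_le
      n hn hnN t).trans (le_max_right _ _)
  · funext y ξ
    simp only [perturbedSymbol, zero_smul, hF0, add_zero]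
    have e : δ • (y + -F (Ω (δ • y))) = Ω (δ • y) := by
      rw [smul_add, smul_neg, ← sub_eq_add_neg, ← hΩ]
    rw [e, neg_add_cancel_right]
  · funext y ξ
    simp only [perturbedSymbol, zero_smul, hΩ0, hF0, neg_zero, add_zero]

/-- Lower bounds for the two operators are comparable up to an error of order `δ`. -/
def LowerBoundTransfer (K L : L2Space d →L[ℂ] L2Space d) (η R : ℝ) : Prop :=
  ∀ E c : ℝ, |E| ≤ R → 0 ≤ c → (∀ f, c * ‖f‖ ≤ ‖K f - (E : ℂ) • f‖) →
    ∀ f, c ^ 2 * ‖f‖ ^ 2 ≤ ‖L f - (E : ℂ) • f‖ ^ 2 + η * ‖f‖ ^ 2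

lemma exists_lowerBoundTransfer_of_zero {a : Space d → Space d → ℝ} {F : Space d → Space d}
    (ha : IsRealSymbol a) (hF : IsAdmissibleField F) (hF0 : F 0 = 0) (R : ℝ) :
    ∃ C δ₀ : ℝ, 0 ≤ C ∧ 0 < δ₀ ∧ δ₀ ≤ 1 ∧ ∀ δ : ℝ, |δ| ≤ δ₀ →
      LowerBoundTransfer (perturbedOp a F 0) (perturbedOp a F δ) (C * |δ|) R ∧
      LowerBoundTransfer (perturbedOp a F δ) (perturbedOp a F 0) (C * |δ|) R := by
  obtain ⟨A, hA⟩ := exists_hasDerivBounds ha hF (2 * d + 4)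
  have hA0 := hA.nonneg
  obtain ⟨C₁, hC₁, h₁⟩ := exists_le_norm_sq_perturbedOp d A R
  obtain ⟨C₂, hC₂, h₂⟩ := exists_le_norm_sq_perturbedOp d
    (max (shiftBound d A) (inverseBound A (2 * d + 4))) R
  have hδ₀ : 1 / (2 * (A + 1)) ≤ 1 := by
    rw [div_le_one (by positivity)]; linarith
  refine ⟨max C₁ C₂, 1 / (2 * (A + 1)), le_max_of_le_left hC₁, by positivity, hδ₀,
    fun δ hδ => ?_⟩
  have hδ1 := hδ.trans hδ₀
  have hδA : A * |δ| ≤ 1 / 2 := by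
    rw [le_div_iff₀ (by positivity)] at hδ
    nlinarith [abs_nonneg δ]
  obtain ⟨F', hF', e1, e2⟩ := exists_hasDerivBounds_inverse hA hF0 hδ1 hδA
  constructor
  · intro E c hE hc h f
    refine (h₁ a F hA δ hδ1 E c hE hc h f).trans ?_
    gcongr
    exact le_max_left _ _
  · intro E c hE hc h f
    have e3 : perturbedOp (perturbedSymbol a F δ) F' 0 = perturbedOp a F δ := by
      rw [perturbedOp, e2, perturbedOp]
    have e4 : perturbedOp (perturbedSymbol a F δ) F' δ = perturbedOp a F 0 := by
      rw [perturbedOp, e1, perturbedOp]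
    have h3 := h₂ _ F' hF' δ hδ1 E c hE hc (by rw [e3]; exact h) f
    rw [e4] at h3
    refine h3.trans ?_
    gcongr
    exact le_max_right _ _

/-- The constant vector F 0 is absorbed into a by a translation, which reduces to a field vanishing
at the origin. -/
lemma exists_lowerBoundTransfer {a : Space d → Space d → ℝ} {F : Space d → Space d}
    (ha : IsRealSymbol a) (hF : IsAdmissibleField F) (R : ℝ) :
    ∃ C δ₀ : ℝ, 0 ≤ C ∧ 0 < δ₀ ∧ δ₀ ≤ 1 ∧ ∀ δ : ℝ, |δ| ≤ δ₀ →
      LowerBoundTransfer (perturbedOp a F 0) (perturbedOp a F δ) (C * |δ|) R ∧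
      LowerBoundTransfer (perturbedOp a F δ) (perturbedOp a F 0) (C * |δ|) R := by
  have ha' := ha.comp_add (F 0) 0
  simp only [add_zero] at ha'
  have hF' : IsAdmissibleField fun x => F x - F 0 := by
    refine ⟨hF.1.sub contDiff_const, fun n hn => ?_⟩
    obtain ⟨B, hB⟩ := hF.2 n hn
    refine ⟨B, fun x => ?_⟩
    rw [fun_iteratedFDeriv_sub_apply (hF.1.contDiffAt.of_le (by exact_mod_cast le_top))
      contDiff_const.contDiffAt, iteratedFDeriv_const_of_ne (by omega)]
    simpa using hB x
  have e : ∀ δ, perturbedOp (fun x ξ => a (x + F 0) ξ) (fun x => F x - F 0) δ =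
      perturbedOp a F δ := fun δ => by
    unfold perturbedOp
    congr 1
    funext x ξ
    simp only [perturbedSymbol]
    congr 1
    abel
  have := exists_lowerBoundTransfer_of_zero ha' hF' (sub_self _) R
  simpa only [e] using this

end TwoSided

/-! ### Lower bounds and distance to the spectrum. -/

section SelfAdjoint

variable {H : Type*} [NormedAddCommGroup H] [InnerProductSpace ℂ H] [CompleteSpace H]

lemma algebraMap_real_apply (x : ℝ) (f : H) :
    (algebraMap ℝ (H →L[ℂ] H) x) f = (x : ℂ) • f := by
  rw [Algebra.algebraMap_eq_smul_one]
  simp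

/-- For c > 0 the functional calculus of 1/(x - E) gives a left inverse of T - E of norm at most
1/c. -/
lemma IsSelfAdjoint.le_norm_sub_of_forall_spectrum {T : H →L[ℂ] H} (hT : IsSelfAdjoint T) {E c : ℝ}
    (hc : 0 ≤ c) (h : ∀ x ∈ spectrum ℝ T, c ≤ |x - E|) (f : H) :
    c * ‖f‖ ≤ ‖T f - (E : ℂ) • f‖ := by
  rcases hc.eq_or_lt with rfl | hc
  · simp
  have hne : ∀ x ∈ spectrum ℝ T, x - E ≠ 0 := fun x hx h0 => by
    have := h x hx
    rw [h0, abs_zero] at this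
    linarith
  have hcont : ContinuousOn (fun x : ℝ => (x - E)⁻¹) (spectrum ℝ T) :=
    ContinuousOn.inv₀ (by fun_prop) hne
  set X := cfc (fun x : ℝ => (x - E)⁻¹) T with hX
  have hXn : ‖X‖ ≤ c⁻¹ := by
    refine norm_cfc_le (by positivity) fun x hx => ?_
    rw [norm_inv, Real.norm_eq_abs]
    exact inv_anti₀ hc (h x hx)
  have hcfc : T - algebraMap ℝ (H →L[ℂ] H) E = cfc (fun x : ℝ => x - E) T := by
    rw [cfc_sub (fun x : ℝ => x) (fun _ => E) T, cfc_id' ℝ T, cfc_const E T]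
  have hmul : X * (T - algebraMap ℝ (H →L[ℂ] H) E) = 1 := by
    rw [hcfc, hX, ← cfc_mul _ _ T hcont (by fun_prop)]
    rw [← cfc_one ℝ T]
    exact cfc_congr fun x hx => inv_mul_cancel₀ (hne x hx)
  have hf : X (T f - (E : ℂ) • f) = f := by
    have := congrArg (fun Y : H →L[ℂ] H => Y f) hmul
    simpa [algebraMap_real_apply] using this
  have h1 := X.le_opNorm (T f - (E : ℂ) • f)
  rw [hf] at h1
  have h2 := h1.trans (mul_le_mul_of_nonneg_right hXn (norm_nonneg _))
  rwa [← div_eq_inv_mul, le_div_iff₀ hc, mul_comm] at h2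

/-- The lower bound makes T antilipschitz; by self-adjointness the orthogonal complement of its
range is its kernel, which is zero, so the range is dense. -/
lemma IsSelfAdjoint.isUnit_of_le_norm {T : H →L[ℂ] H} (hT : IsSelfAdjoint T) {c : ℝ}
    (hc : 0 < c) (h : ∀ f, c * ‖f‖ ≤ ‖T f‖) : IsUnit T := by
  have hanti : AntilipschitzWith (c⁻¹).toNNReal T := by
    refine T.antilipschitz_of_bound fun f => ?_
    rw [Real.coe_toNNReal _ (by positivity), ← div_eq_inv_mul, le_div_iff₀ hc, mul_comm]
    exact h f
  rw [ContinuousLinearMap.isUnit_iff_bijective, ContinuousLinearMap.bijective_iff_dense_range_and_antilipschitz]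
  refine ⟨?_, _, hanti⟩
  rw [Submodule.topologicalClosure_eq_top_iff, Submodule.eq_bot_iff]
  intro g hg
  have h1 : T g = 0 := by
    refine ext_inner_left ℂ fun f => ?_
    rw [inner_zero_right, ← hT.adjoint_eq, ContinuousLinearMap.adjoint_inner_right]
    exact (Submodule.mem_orthogonal _ _).1 hg _ (LinearMap.mem_range_self _ f)
  have h2 := h g
  rw [h1, norm_zero] at h2
  exact norm_le_zero_iff.1 (by nlinarith [norm_nonneg g])

lemma IsSelfAdjoint.le_abs_sub_of_le_norm_sub {T : H →L[ℂ] H} (hT : IsSelfAdjoint T) {E c : ℝ}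
    (h : ∀ f, c * ‖f‖ ≤ ‖T f - (E : ℂ) • f‖) : ∀ x ∈ spectrum ℝ T, c ≤ |x - E| := by
  intro x hx
  by_contra hlt
  rw [not_le] at hlt
  refine spectrum.mem_iff.1 hx ?_
  rw [← IsUnit.neg_iff, neg_sub]
  have hsa : IsSelfAdjoint (T - algebraMap ℝ (H →L[ℂ] H) x) :=
    hT.sub (IsSelfAdjoint.algebraMap _ (IsSelfAdjoint.all x))
  refine hsa.isUnit_of_le_norm (sub_pos.2 hlt) fun f => ?_
  have e : T f - (E : ℂ) • f = (T - algebraMap ℝ (H →L[ℂ] H) x) f + ((x - E : ℝ) : ℂ) • f := by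
    rw [sub_apply, algebraMap_real_apply, Complex.ofReal_sub, sub_smul]; abel
  have h1 := h f
  rw [e] at h1
  have h2 := h1.trans (norm_add_le _ _)
  rw [norm_smul, Complex.norm_real, Real.norm_eq_abs] at h2
  linarith

end SelfAdjoint

/-! ### Gap edges of two sets of reals with comparable gaps. -/

section RealSets

/-- This is √(c² - η) ≥ c - η/c. Away from c = 0 it turns an error in the square into an error
linear in η, which is why edges move linearly while the Hausdorff estimate has a square root. -/
lemma sub_div_le_of_sq_le {c t η : ℝ} (hc : 0 < c) (ht : 0 ≤ t) (hη : 0 ≤ η) (hηc : η ≤ c ^ 2)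
    (h : c ^ 2 ≤ t ^ 2 + η) : c - η / c ≤ t := by
  have h1 : (c - η / c) ^ 2 ≤ t ^ 2 := by
    have e : (c - η / c) ^ 2 = c ^ 2 - 2 * η + η * (η / c ^ 2) := by
      field_simp
      ring
    have h2 : η * (η / c ^ 2) ≤ η * 1 :=
      mul_le_mul_of_nonneg_left ((div_le_one (by positivity)).2 hηc) hη
    linarith
  exact (le_abs_self _).trans (abs_le_of_sq_le_sq h1 ht)

/-- Gaps of `S` persist in `T`, up to an error `η` in the squared distance. -/
def GapTransfer (S T : Set ℝ) (η R : ℝ) : Prop :=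
  ∀ E c : ℝ, |E| ≤ R → 0 ≤ c → (∀ y ∈ S, c ≤ |y - E|) → ∀ y ∈ T, c ^ 2 ≤ |y - E| ^ 2 + η

/-- Take the centre E to be the point x of T itself: were S at distance at least r from x, the
transfer would give r² ≤ η. -/
lemma GapTransfer.exists_abs_sub_le {S T : Set ℝ} {η R r : ℝ} (h : GapTransfer S T η R)
    (hT : ∀ y ∈ T, |y| ≤ R) (hr : 0 ≤ r) (hηr : η < r ^ 2) {x : ℝ} (hx : x ∈ T) :
    ∃ y ∈ S, |x - y| ≤ r := by
  by_contra! hne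
  have h1 := h x r (hT x hx) hr (fun y hy => by rw [abs_sub_comm]; exact (hne y hy).le) x hx
  rw [sub_self, abs_zero] at h1
  linarith

lemma le_of_disjoint_Ioo {S : Set ℝ} {l m y : ℝ} (hdis : Disjoint (Set.Ioo l m) S) (hy : y ∈ S) :
    (m - l) / 2 ≤ |y - (m + l) / 2| := by
  by_contra! hlt
  rw [abs_lt] at hlt
  exact Set.disjoint_left.1 hdis ⟨by linarith, by linarith⟩ hy

/-- Transfer from S to T at the midpoint M keeps the edges of T from moving into the gap by more
than 2η/g, with g = m - l. Transfer back, at the midpoint of the gap of T, keeps them from moving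
outwards. The nearby points of T guarantee that both edges exist and that the gap of T is centred
within the range R. -/
lemma abs_edge_sub_le {S T : Set ℝ} {R η l m : ℝ} (hS : ∀ y ∈ S, |y| ≤ R)
    (hη : 0 ≤ η) (hST : GapTransfer S T η R) (hTS : GapTransfer T S η R) (hlm : l < m)
    (hl : l ∈ S) (hm : m ∈ S) (hdis : Disjoint (Set.Ioo l m) S) (hηg : η ≤ (m - l) ^ 2 / 64)
    (hl' : ∃ y ∈ T, |l - y| ≤ (m - l) / 8) (hm' : ∃ y ∈ T, |m - y| ≤ (m - l) / 8) :
    max |edgeBelow T ((m + l) / 2) - l| |edgeAbove T ((m + l) / 2) - m| ≤ 4 * η / (m - l) := by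
  set g := m - l with hg
  have hg0 : 0 < g := by linarith
  set M := (m + l) / 2 with hM
  have hlR := abs_le.1 (hS l hl)
  have hmR := abs_le.1 (hS m hm)
  have hηdiv : η / (g / 2) ≤ g / 32 := by
    rw [div_le_iff₀ (by positivity)]
    linarith [sq g]
  have hgap : ∀ y ∈ T, g / 2 - η / (g / 2) ≤ |y - M| := fun y hy =>
    sub_div_le_of_sq_le (by positivity) (abs_nonneg _) hη (by nlinarith)
      (hST M (g / 2) (abs_le.2 ⟨by linarith, by linarith⟩) (by positivity)
        (fun z hz => le_of_disjoint_Ioo hdis hz) y hy)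
  obtain ⟨p, hp, hpl⟩ := hl'
  obtain ⟨q, hq, hqm⟩ := hm'
  rw [abs_le] at hpl hqm
  have hpM : p ∈ T ∩ Set.Iio M := ⟨hp, by rw [Set.mem_Iio]; linarith⟩
  have hqM : q ∈ T ∩ Set.Ioi M := ⟨hq, by rw [Set.mem_Ioi]; linarith⟩
  have hbb : BddAbove (T ∩ Set.Iio M) := ⟨M, fun y hy => hy.2.le⟩
  have hba : BddBelow (T ∩ Set.Ioi M) := ⟨M, fun y hy => hy.2.le⟩
  have hb1 : edgeBelow T M ≤ l + η / (g / 2) := csSup_le ⟨p, hpM⟩ fun y hy => by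
    have h1 := hgap y hy.1
    have h2 : y < M := hy.2
    rw [abs_of_neg (by linarith)] at h1
    linarith
  have ha1 : m - η / (g / 2) ≤ edgeAbove T M := le_csInf ⟨q, hqM⟩ fun y hy => by
    have h1 := hgap y hy.1
    have h2 : M < y := hy.2
    rw [abs_of_pos (by linarith)] at h1
    linarith
  have hb2 : p ≤ edgeBelow T M := le_csSup hbb hpM
  have ha2 : edgeAbove T M ≤ q := csInf_le hba hqM
  have hdisT : Disjoint (Set.Ioo (edgeBelow T M) (edgeAbove T M)) T := by
    rw [Set.disjoint_left]
    rintro y ⟨h1, h2⟩ hy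
    rcases lt_trichotomy y M with h | h | h
    · exact (le_csSup hbb ⟨hy, h⟩).not_gt h1
    · have h3 := hgap y hy
      rw [h, sub_self, abs_zero] at h3
      linarith
    · exact (csInf_le hba ⟨hy, h⟩).not_gt h2
  set l' := edgeBelow T M
  set m' := edgeAbove T M
  have hg' : g / 2 ≤ m' - l' := by linarith
  have hηdiv' : η / ((m' - l') / 2) ≤ 4 * η / g := by
    rw [div_le_div_iff₀ (by linarith) hg0]
    nlinarith
  -- The half-length of the gap of T is at least g/4, hence the error 4η/g in the reverse transfer.
  have hgap' : ∀ y ∈ S, (m' - l') / 2 - 4 * η / g ≤ |y - (m' + l') / 2| := fun y hy => by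
    have := sub_div_le_of_sq_le (by linarith) (abs_nonneg (y - (m' + l') / 2)) hη (by nlinarith)
      (hTS ((m' + l') / 2) ((m' - l') / 2) (abs_le.2 ⟨by linarith, by linarith⟩) (by linarith)
        (fun z hz => le_of_disjoint_Ioo hdisT hz) y hy)
    linarith
  have e : η / (g / 2) ≤ 4 * η / g := by
    rw [div_le_div_iff₀ (by linarith) hg0]
    nlinarith
  have h1 := hgap' l hl
  have h2 := hgap' m hm
  rw [abs_of_neg (by linarith)] at h1
  rw [abs_of_pos (by linarith)] at h2
  exact max_le (abs_le.2 ⟨by linarith, by linarith⟩) (abs_le.2 ⟨by linarith, by linarith⟩)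

end RealSets

/-! ### From lower bounds to spectra. -/

section Spectra

variable {d : ℕ}

lemma LowerBoundTransfer.gapTransfer {K L : L2Space d →L[ℂ] L2Space d} {η R : ℝ}
    (h : LowerBoundTransfer K L η R) (hK : IsSelfAdjoint K) (hL : IsSelfAdjoint L) :
    GapTransfer (spectrum ℝ K) (spectrum ℝ L) η R := by
  intro E c hE hc hS y hy
  rcases le_total (c ^ 2) η with hcη | hcη
  · nlinarith [sq_nonneg |y - E|]
  have h1 : ∀ f, √(c ^ 2 - η) * ‖f‖ ≤ ‖L f - (E : ℂ) • f‖ := fun f => by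
    refine (le_abs_self _).trans (abs_le_of_sq_le_sq ?_ (norm_nonneg _))
    rw [mul_pow, Real.sq_sqrt (by linarith)]
    linarith [h E c hE hc (fun f => hK.le_norm_sub_of_forall_spectrum hc hS f) f]
  have h2 := hL.le_abs_sub_of_le_norm_sub h1 y hy
  rw [Real.sqrt_le_left (abs_nonneg _)] at h2
  linarith

lemma abs_le_norm_of_mem_spectrum {T : L2Space d →L[ℂ] L2Space d} {x : ℝ}
    (hx : x ∈ spectrum ℝ T) : |x| ≤ ‖T‖ := by
  have h1 := spectrum.norm_le_norm_mul_of_mem hx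
  rw [Real.norm_eq_abs] at h1
  exact h1.trans (mul_le_of_le_one_right (norm_nonneg _) ContinuousLinearMap.norm_id_le)

end Spectra

/-! ### The main theorem. -/

theorem corollary2 {d : ℕ} (a : Space d → Space d → ℝ) (F : Space d → Space d)
    (ha : IsRealSymbol a) (hF : IsAdmissibleField F) :
    -- every `K_δ` is well defined, bounded and self-adjoint
    (∀ δ : ℝ, IsWeylQuantization (perturbedSymbol a F δ) (perturbedOp a F δ) ∧
      IsSelfAdjoint (perturbedOp a F δ)) ∧
    ∃ C : ℝ, 0 < C ∧
      -- `C` is a constant in the Hausdorff distance estimate for the spectra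
      (∀ δ : ℝ, |δ| ≤ 1 →
        Metric.hausdorffDist (spectrum ℝ (perturbedOp a F δ)) (spectrum ℝ (perturbedOp a F 0)) ≤
          C * √|δ|) ∧
      ∃ C' : ℝ, 0 < C' ∧
        -- both constants serve all the spectral gaps of `K_0`
        ∀ l m : ℝ, l < m →
          l ∈ spectrum ℝ (perturbedOp a F 0) → m ∈ spectrum ℝ (perturbedOp a F 0) →
          Disjoint (Set.Ioo l m) (spectrum ℝ (perturbedOp a F 0)) →
          -- the edges are well defined
          (∀ δ : ℝ, |δ| < (m - l) ^ 2 / (4 * C ^ 2) →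
            (m + l) / 2 ∈ resolventSet ℝ (perturbedOp a F δ) ∧
            (spectrum ℝ (perturbedOp a F δ) ∩ Set.Iio ((m + l) / 2)).Nonempty ∧
            (spectrum ℝ (perturbedOp a F δ) ∩ Set.Ioi ((m + l) / 2)).Nonempty) ∧
          -- the edges are Lipschitz at `δ = 0`
          ∃ δ₁ : ℝ, 0 < δ₁ ∧ δ₁ < (m - l) ^ 2 / (4 * C ^ 2) ∧
            ∀ δ : ℝ, |δ| ≤ δ₁ →
              max |edgeBelow (spectrum ℝ (perturbedOp a F δ)) ((m + l) / 2) - l|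
                  |edgeAbove (spectrum ℝ (perturbedOp a F δ)) ((m + l) / 2) - m| ≤
                C' * |δ| / (m - l) := by
  have hsym := fun δ => ha.perturbedSymbol hF δ
  have hsa : ∀ δ, IsSelfAdjoint (perturbedOp a F δ) := fun δ => (hsym δ).isSelfAdjoint
  refine ⟨fun δ => ⟨(hsym δ).isWeylQuantization, hsa δ⟩, ?_⟩
  obtain ⟨Cn, -, hop⟩ := exists_norm_weylOp_le d
  obtain ⟨A, hA⟩ := exists_hasDerivBounds ha hF (2 * d + 4)
  set R := max (Cn * shiftBound d A) 1 with hR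
  have hR1 : 1 ≤ R := le_max_right _ _
  obtain ⟨C, δ₀, hC, hδ₀, hδ₀1, hCt⟩ := exists_lowerBoundTransfer ha hF R
  have hbd : ∀ δ : ℝ, |δ| ≤ 1 → ∀ y ∈ spectrum ℝ (perturbedOp a F δ), |y| ≤ R :=
    fun δ hδ y hy => (abs_le_norm_of_mem_spectrum hy).trans
      ((hA.norm_perturbedOp_le hop hδ).trans (le_max_left _ _))
  have hbd0 := hbd 0 (by simp)
  have hgap : ∀ δ : ℝ, |δ| ≤ δ₀ →
      GapTransfer (spectrum ℝ (perturbedOp a F 0)) (spectrum ℝ (perturbedOp a F δ)) (C * |δ|) R ∧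
      GapTransfer (spectrum ℝ (perturbedOp a F δ)) (spectrum ℝ (perturbedOp a F 0)) (C * |δ|) R :=
    fun δ hδ => ⟨(hCt δ hδ).1.gapTransfer (hsa 0) (hsa δ),
      (hCt δ hδ).2.gapTransfer (hsa δ) (hsa 0)⟩
  -- The first term serves |δ| ≥ δ₀, where only the bound R on both spectra is used; C + 1 ensures C
  -- < D², so that gap transfer gives distance D√|δ|.
  set D := 2 * R / √δ₀ + C + 1 with hD
  have hs₀ : 0 < √δ₀ := Real.sqrt_pos.2 hδ₀
  have hq : 0 < 2 * R / √δ₀ := by positivity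
  have hD1 : 1 ≤ D := by linarith
  have hDC : C < D ^ 2 := by nlinarith
  have hDR : 2 * R ≤ D * √δ₀ := by
    rw [← div_le_iff₀ hs₀]
    linarith
  have hclose : ∀ δ : ℝ, |δ| ≤ δ₀ →
      (∀ x ∈ spectrum ℝ (perturbedOp a F δ), ∃ y ∈ spectrum ℝ (perturbedOp a F 0),
        |x - y| ≤ D * √|δ|) ∧
      (∀ x ∈ spectrum ℝ (perturbedOp a F 0), ∃ y ∈ spectrum ℝ (perturbedOp a F δ),
        |x - y| ≤ D * √|δ|) := fun δ hδ => by
    rcases eq_or_ne δ 0 with rfl | hne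
    · constructor <;> exact fun x hx => ⟨x, hx, by simp⟩
    have h1 : C * |δ| < (D * √|δ|) ^ 2 := by
      rw [mul_pow, Real.sq_sqrt (abs_nonneg _)]
      exact mul_lt_mul_of_pos_right hDC (abs_pos.2 hne)
    exact ⟨fun x hx => (hgap δ hδ).1.exists_abs_sub_le (hbd δ (hδ.trans hδ₀1)) (by positivity) h1 hx,
      fun x hx => (hgap δ hδ).2.exists_abs_sub_le hbd0 (by positivity) h1 hx⟩
  -- The edge estimate gives 4C; the added 1 only makes the constant positive when C = 0.
  refine ⟨D, by linarith, fun δ hδ => ?_, 4 * C + 1, by positivity,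
    fun l m hlm hl hm hdis => ?_⟩
  -- The Hausdorff distance to the empty set is 0 by convention, so nonemptiness of the spectra need
  -- not be proved.
  · rcases (spectrum ℝ (perturbedOp a F δ)).eq_empty_or_nonempty with h1 | ⟨x₁, hx₁⟩
    · rw [h1, Metric.hausdorffDist_empty']
      positivity
    rcases (spectrum ℝ (perturbedOp a F 0)).eq_empty_or_nonempty with h2 | ⟨x₂, hx₂⟩
    · rw [h2, Metric.hausdorffDist_empty]
      positivity
    rcases le_total |δ| δ₀ with h | h
    · exact Metric.hausdorffDist_le_of_mem_dist (by positivity) (hclose δ h).1 (hclose δ h).2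
    have h3 : ∀ x y : ℝ, |x| ≤ R → |y| ≤ R → |x - y| ≤ D * √|δ| := fun x y hx hy => by
      have h4 : D * √δ₀ ≤ D * √|δ| := by gcongr
      linarith [abs_sub x y]
    exact Metric.hausdorffDist_le_of_mem_dist (by positivity)
      (fun x hx => ⟨x₂, hx₂, h3 x x₂ (hbd δ hδ x hx) (hbd0 x₂ hx₂)⟩)
      (fun x hx => ⟨x₁, hx₁, h3 x x₁ (hbd0 x hx) (hbd δ hδ x₁ hx₁)⟩)
  have hg : 0 < m - l := by linarith
  have hgR : m - l ≤ 2 * R := by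
    linarith [(abs_le.1 (hbd0 l hl)).1, (abs_le.1 (hbd0 m hm)).2]
  -- A gap is no longer than 2R ≤ D√δ₀, so every δ admitted by the gap condition lies in the range
  -- of the transfer estimates.
  have hsmall : (m - l) ^ 2 / (4 * D ^ 2) ≤ δ₀ := by
    rw [div_le_iff₀ (by positivity)]
    have h1 : (m - l) ^ 2 ≤ (D * √δ₀) ^ 2 := pow_le_pow_left₀ hg.le (hgR.trans hDR) 2
    rw [mul_pow, Real.sq_sqrt hδ₀.le] at h1
    nlinarith [sq_nonneg D]
  -- This δ₁ makes D√|δ| at most (m - l)/8 and, as C < D², also C|δ| at most (m - l)²/64, the two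
  -- smallness conditions of `abs_edge_sub_le`.
  refine ⟨fun δ hδ => ?_, (m - l) ^ 2 / (64 * D ^ 2), by positivity, ?_, fun δ hδ => ?_⟩
  · have hr : D * √|δ| < (m - l) / 2 := by
      refine lt_of_pow_lt_pow_left₀ 2 (by positivity) ?_
      rw [mul_pow, Real.sq_sqrt (abs_nonneg _)]
      rw [lt_div_iff₀ (by positivity)] at hδ
      linarith
    obtain ⟨h1, h2⟩ := hclose δ (hδ.le.trans hsmall)
    refine ⟨?_, ?_, ?_⟩
    · by_contra hM
      obtain ⟨y, hy, hMy⟩ := h1 _ hM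
      have h3 := le_of_disjoint_Ioo hdis hy
      rw [abs_sub_comm] at h3
      linarith
    · obtain ⟨y, hy, hly⟩ := h2 l hl
      rw [abs_le] at hly
      exact ⟨y, hy, by rw [Set.mem_Iio]; linarith⟩
    · obtain ⟨y, hy, hmy⟩ := h2 m hm
      rw [abs_le] at hmy
      exact ⟨y, hy, by rw [Set.mem_Ioi]; linarith⟩
  · exact div_lt_div_of_pos_left (by positivity) (by positivity) (by nlinarith [sq_nonneg D])
  · have hr : D * √|δ| ≤ (m - l) / 8 := by
      refine le_of_sq_le_sq ?_ (by positivity)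
      rw [mul_pow, Real.sq_sqrt (abs_nonneg _)]
      rw [le_div_iff₀ (by positivity)] at hδ
      linarith
    have hδ' : |δ| ≤ δ₀ := by
      refine hδ.trans (le_trans ?_ hsmall)
      exact div_le_div_of_nonneg_left (by positivity) (by positivity) (by nlinarith [sq_nonneg D])
    have hη : C * |δ| ≤ (m - l) ^ 2 / 64 := by
      rw [le_div_iff₀ (by positivity)] at hδ
      nlinarith [abs_nonneg δ]
    obtain ⟨-, h2⟩ := hclose δ hδ'
    obtain ⟨yl, hyl, hyl'⟩ := h2 l hl
    obtain ⟨ym, hym, hym'⟩ := h2 m hm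
    refine (abs_edge_sub_le hbd0 (by positivity) (hgap δ hδ').1
      (hgap δ hδ').2 hlm hl hm hdis hη ⟨yl, hyl, hyl'.trans hr⟩ ⟨ym, hym, hym'.trans hr⟩).trans ?_
    exact div_le_div_of_nonneg_right (by nlinarith [abs_nonneg δ]) hg.le
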